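/- **Theorem 4.3.** For a graph $G$ and a vertex $v$ of $G$, let $N^2[v]$ be the set of vertices of $G$ at distance at most $2$ from $v$. *Closed 2-Neighbourhood Sizes* asks for $|N^2[v]|$ for every vertex $v$. A tree decomposition of $G$ is a tree $\mathcal T$ together with a bag $\beta(x)\subseteq V(G)$ for every node $x$ of $\mathcal T$, such that every vertex of $G$ lies in some bag, the two ends of every edge of $G$ lie in a common bag, and for every $v\in V(G)$ the nodes $x$ with $v\in\beta(x)$ induce a connected subgraph of $\mathcal T$; its width is $w=\max_x(|\beta(x)|-1)$ (taken as $0$ if all bags are empty), and its size is $s=\sum_{x}(1+|\beta(x)|)$. There is a deterministic algorithm that, given any finite simple graph $G$ with $n$ vertices together with any tree decomposition of $G$, of width $w$ and size $s$, solves Closed 2-Neighbourhood Sizes on $G$ in time $$O\big(2^{w}\,(w+1)\, n + s\big),$$ where the constant is absolute. In particular, the time is $O(2^{w}\,w\,n)$ if $w\ge 1$ and the given decomposition has $s=O(2^w w n)$ (for example if it has $O(wn)$ nodes). Here the algorithm is one fixed program for a unit-cost word RAM (with addition, truncated subtraction, multiplication and integer division of words, indirect memory access, and conditional jumps) whose words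 have any number $b\ge c\log_2 L$ of bits, where $c$ is an absolute constant and $L$ is the length of the input, and which never overflows. The vertices of $G$ and the nodes of $\mathcal T$ are numbered from $0$. The input consists of the numbers of vertices and nodes, the number of edges of $G$, a list of the edges of $G$, a list of the edges of $\mathcal T$, and a list of the elements of each bag, preceded by its size; each of these lists is in arbitrary order. -/

import Mathlib

/-! ### The problem: sizes of closed neighbourhoods -/

/-- The closed `r`-neighbourhood of `v`: all vertices at distance at most `r` from `v`.
The extended distance is used, so vertices in other components are at distance `⊤`. -/
def closedNbhd {V : Type*} (G : SimpleGraph V) (r : ℕ) (v : V) : Set V :=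
  {u | G.edist v u ≤ r}

/-! ### Tree decompositions -/

/-- `(T, β)` is a tree decomposition of `G`. -/
structure IsTreeDecomposition {V ι : Type*} (G : SimpleGraph V) (T : SimpleGraph ι)
    (β : ι → Finset V) : Prop where
  isTree : T.IsTree
  exists_mem_bag : ∀ v : V, ∃ x, v ∈ β x
  exists_edge_bag : ∀ u v : V, G.Adj u v → ∃ x, u ∈ β x ∧ v ∈ β x
  connected : ∀ v : V, (T.induce {x | v ∈ β x}).Connected

/-- The width: the maximum over all bags of the size of the bag minus one
(`0` in the degenerate case that all bags are empty). -/
def decompWidth {V ι : Type*} [Fintype ι] (β : ι → Finset V) : ℕ :=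
  Finset.univ.sup fun x => (β x).card - 1

/-- The size of a decomposition: the number of nodes plus the total size of the bags. -/
def decompSize {V ι : Type*} [Fintype ι] (β : ι → Finset V) : ℕ :=
  ∑ x, (1 + (β x).card)

/-! ### The machine: a deterministic word RAM with unit cost instructions -/

namespace WordRAM

/-- Instructions. The arguments of type `ℕ` are register numbers, except for the constant `k` of
`const` and the targets of jumps, which are positions in the program. -/
inductive Instr where
  /-- `reg d := k` -/
  | const (d k : ℕ)
  /-- `reg d := reg a + reg b` -/
  | add (d a b : ℕ)
  /-- `reg d := reg a - reg b`, truncated at `0` -/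
  | sub (d a b : ℕ)
  /-- `reg d := reg a * reg b` -/
  | mul (d a b : ℕ)
  /-- `reg d := reg a / reg b`, rounded down -/
  | div (d a b : ℕ)
  /-- `reg d := mem (reg a)` -/
  | load (d a : ℕ)
  /-- `mem (reg a) := reg s` -/
  | store (a s : ℕ)
  /-- continue at position `target` -/
  | jump (target : ℕ)
  /-- continue at position `target` if `reg a = 0`, and at the next instruction otherwise -/
  | jumpZero (a target : ℕ)
  /-- stop -/
  | halt

/-- A program is a finite list of instructions; it can mention only finitely many registers. -/
abbrev Program := List Instr

/-- A configuration: program counter, registers, and random access memory. -/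
structure State where
  pc : ℕ
  reg : ℕ → ℕ
  mem : ℕ → ℕ

/-- Write `v` into register `d` and go on to the next instruction. This is possible only if `v`
fits into a word of `b` bits; otherwise the machine crashes. -/
def State.write (b : ℕ) (s : State) (d v : ℕ) : Option State :=
  if v < 2 ^ b then some ⟨s.pc + 1, Function.update s.reg d v, s.mem⟩ else none

/-- One step of the machine with words of `b` bits. The value `none` means that there is no next
configuration: the machine has halted, has left its program, or has crashed by an overflow. -/
def step (b : ℕ) (P : Program) (s : State) : Option State :=
  match P[s.pc]? with
  | some (.const d k) => s.write b d k
  | some (.add d x y) => s.write b d (s.reg x + s.reg y)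
  | some (.sub d x y) => s.write b d (s.reg x - s.reg y)
  | some (.mul d x y) => s.write b d (s.reg x * s.reg y)
  | some (.div d x y) => s.write b d (s.reg x / s.reg y)
  | some (.load d a) => s.write b d (s.mem (s.reg a))
  | some (.store a x) => some ⟨s.pc + 1, s.reg, Function.update s.mem (s.reg a) (s.reg x)⟩
  | some (.jump t) => some ⟨t, s.reg, s.mem⟩
  | some (.jumpZero a t) => some ⟨if s.reg a = 0 then t else s.pc + 1, s.reg, s.mem⟩
  | some .halt => none
  | none => none

/-- The configuration after exactly `t` steps, if the machine makes that many steps. -/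
def run (b : ℕ) (P : Program) : ℕ → State → Option State
  | 0, s => some s
  | t + 1, s => (step b P s).bind (run b P t)

/-- The initial configuration: the input occupies the memory cells from `0` on; all other cells
and all registers are `0`. -/
def init (input : List ℕ) : State := ⟨0, fun _ => 0, fun i => input.getD i 0⟩

/-- On words of `b` bits and on this input, the program reaches a `halt` instruction after at most
`time` steps, without overflow, with `out i` in memory cell `i` for all `i < n`. -/
def ComputesWithin (b : ℕ) (P : Program) (input : List ℕ) {n : ℕ} (out : Fin n → ℕ)
    (time : ℕ) : Prop :=
  ∃ t ≤ time, ∃ s : State, run b P t (init input) = some s ∧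
    P[s.pc]? = some .halt ∧ ∀ i : Fin n, s.mem i = out i

end WordRAM

/-! ### The encoding of the input -/

/-- `l` lists every edge of `G` exactly once, in any order and each in any of its two
orientations. -/
def ListsEdges {V : Type*} (G : SimpleGraph V) (l : List (V × V)) : Prop :=
  (l.map fun e => s(e.1, e.2)).Nodup ∧
    ∀ e : Sym2 V, e ∈ G.edgeSet ↔ e ∈ l.map fun e => s(e.1, e.2)

/-- `l` lists every element of every bag exactly once, in any order. -/
def ListsBags {V ι : Type*} (β : ι → Finset V) (l : ι → List V) : Prop :=
  ∀ x, (l x).Nodup ∧ ∀ v, v ∈ l x ↔ v ∈ β x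

/-- A list of pairs of labels, written as a sequence of numbers. -/
def pairsToWords {k : ℕ} (l : List (Fin k × Fin k)) : List ℕ :=
  l.flatMap fun e => [(e.1 : ℕ), (e.2 : ℕ)]

/-- The input word sequence: number `n` of vertices, number `N` of nodes, number of edges of the
graph, the edges of the graph, the edges of the tree, and for every node in turn the size of its
bag followed by the elements of the bag. -/
def inputWords {n N : ℕ} (es : List (Fin n × Fin n)) (ts : List (Fin N × Fin N))
    (bs : Fin N → List (Fin n)) : List ℕ :=
  [n, N, es.length] ++ pairsToWords es ++ pairsToWords ts ++
    (List.ofFn bs).flatMap fun l => l.length :: l.map fun v => (v : ℕ)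

/-! Root the tree by a traversal, rank the vertices by the first bag that contains them, and let `S
i` consist of the members of the first bag of `i` that have smaller rank. Since the nodes containing
a vertex are connected, `S i` contains all smaller neighbours of `i`, and the smaller of two
elements of `S i` lies in the set of the larger one. This is an elimination ordering of a chordal
supergraph with cliques of at most `w + 1` vertices (`IsRanking.isElimination`). The parent of `i`
is the largest element of `S i`, and `S i` separates the descendants of `i` from all other vertices
(`mem_or_desc_of_adj`).

Two vertices at distance at most two that are adjacent in the supergraph form, with a common
neighbour, a clique, so all three lie in one bag; such pairs are found by inspecting every bag. Any
other pair is separated by some `S i` that contains all common neighbours. Seen from `v`, this is `S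
v` itself for vertices that are not below `v`. A vertex `u` below `v` with `v ∉ S u` is assigned to
the unique `i` at which the path from `u` towards `v` enters the bags containing `v` (`Exits`). It
then remains to know how many vertices on one side of `S i` have a neighbour in a prescribed subset
of `S i`; `card_near` is the resulting identity.

With `k` the largest size of a bag, a proper colouring of the supergraph with `k` colours encodes
subsets of bags by masks below `2 ^ k` whose meaning does not change between a vertex and its
parent. The numbers `up`, `down` and `total`, for every vertex and every mask, obey the recurrences
`up_eq`, `down_add_up` and `total_eq`, evaluated from the leaves to the roots and then back. The
costly part are fewer than `k` restrictions of all masks per vertex, each tabulated in time `O(2 ^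
k)` by doubling, so the total is `O(n k 2 ^ k)` with `k ≤ w + 1`; the cubic work inside a bag is of
no larger order.

The tables are used only if `2 ^ k ≤ 2 n`, so that masks are legitimate array indices. Otherwise `n
< 2 ^ (k - 1) ≤ 2 ^ w`, and scanning all edges once per vertex is fast enough, because there are at
most `n (k - 1)` edges.

The program is written in a small structured language. `Exec.run_code` shows that its compiled form
takes exactly the number of steps recorded by `Exec`, and `wp` is a calculus of total correctness
with time. All indices are bounded by a constant multiple of the input length `L`, and all addresses
by a polynomial in `L`. As unused memory is zero, arrays of quadratic size need no initialisation.
-/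

/-! ### A structured language with two-dimensional arrays -/

namespace Loop

/-- Expressions. Array `j` is two-dimensional; `raw` reads the cells of the input area. -/
inductive Expr where
  | const (k : ℕ)
  | var (x : ℕ)
  | add (e f : Expr)
  | sub (e f : Expr)
  | get (j : ℕ) (e f : Expr)
  | raw (e : Expr)

/-- Commands. -/
inductive Cmd where
  | skip
  | assign (x : ℕ) (e : Expr)
  | put (j : ℕ) (e f g : Expr)
  | out (e f : Expr)
  | seq (c d : Cmd)
  | ite (e : Expr) (c d : Cmd)
  | loop (e : Expr) (c : Cmd)

instance : Add Expr := ⟨Expr.add⟩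
instance : Sub Expr := ⟨Expr.sub⟩
instance (k : ℕ) : OfNat Expr k := ⟨Expr.const k⟩

infixr:60 " ;; " => Cmd.seq
infix:62 " ::= " => Cmd.assign

/-- The contents of variables, arrays and input area. -/
structure Env where
  var : ℕ → ℕ
  arr : ℕ → ℕ → ℕ → ℕ
  cell : ℕ → ℕ

namespace Env

/-- Assignment to a variable. -/
def set (σ : Env) (x v : ℕ) : Env := { σ with var := fun y => if y = x then v else σ.var y }

/-- Assignment to an array entry. -/
def put (σ : Env) (j a b v : ℕ) : Env :=
  { σ with arr := fun j' a' b' => if j' = j ∧ a' = a ∧ b' = b then v else σ.arr j' a' b' }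

/-- Assignment to a cell of the input area. -/
def out (σ : Env) (i v : ℕ) : Env := { σ with cell := fun j => if j = i then v else σ.cell j }

variable (σ : Env) (x v j a b i : ℕ)

@[simp] theorem set_var (y : ℕ) : (σ.set x v).var y = if y = x then v else σ.var y := rfl
@[simp] theorem set_arr : (σ.set x v).arr = σ.arr := rfl
@[simp] theorem set_cell : (σ.set x v).cell = σ.cell := rfl
@[simp] theorem put_var : (σ.put j a b v).var = σ.var := rfl
@[simp] theorem put_cell : (σ.put j a b v).cell = σ.cell := rfl
@[simp] theorem put_arr (j' a' b' : ℕ) : (σ.put j a b v).arr j' a' b' =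
    if j' = j ∧ a' = a ∧ b' = b then v else σ.arr j' a' b' := rfl
@[simp] theorem out_var : (σ.out i v).var = σ.var := rfl
@[simp] theorem out_arr : (σ.out i v).arr = σ.arr := rfl
@[simp] theorem out_cell (y : ℕ) : (σ.out i v).cell y = if y = i then v else σ.cell y := rfl

end Env

/-- The value of an expression. -/
def Expr.eval (σ : Env) : Expr → ℕ
  | const k => k
  | var x => σ.var x
  | add e f => e.eval σ + f.eval σ
  | sub e f => e.eval σ - f.eval σ
  | get j e f => σ.arr j (e.eval σ) (f.eval σ)
  | raw e => σ.cell (e.eval σ)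

/-- The number of machine instructions that evaluate an expression. -/
def Expr.cost : Expr → ℕ
  | const _ => 1
  | var _ => 2
  | add e f => e.cost + f.cost + 1
  | sub e f => e.cost + f.cost + 1
  | get _ e f => e.cost + f.cost + 8
  | raw e => e.cost + 1

/-- No value that occurs during the evaluation exceeds the bound `B`, and arrays are used only
when variable `0` contains the bound. -/
def Expr.Safe (B : ℕ) (σ : Env) : Expr → Prop
  | const k => k < B
  | var _ => True
  | add e f => e.Safe B σ ∧ f.Safe B σ ∧ e.eval σ + f.eval σ ≤ B
  | sub e f => e.Safe B σ ∧ f.Safe B σ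
  | get j e f => e.Safe B σ ∧ f.Safe B σ ∧ j < 32 ∧ σ.var 0 = B ∧ e.eval σ < B ∧ f.eval σ < B
  | raw e => e.Safe B σ ∧ e.eval σ < B

section
variable (B : ℕ) (σ : Env) (e f : Expr) (k x j : ℕ)

@[simp] theorem eval_add : (e + f).eval σ = e.eval σ + f.eval σ := rfl
@[simp] theorem eval_sub : (e - f).eval σ = e.eval σ - f.eval σ := rfl
@[simp] theorem eval_ofNat : (no_index (OfNat.ofNat k : Expr)).eval σ = k := rfl
@[simp] theorem eval_const : (Expr.const k).eval σ = k := rfl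
@[simp] theorem eval_var : (Expr.var x).eval σ = σ.var x := rfl
@[simp] theorem eval_get : (Expr.get j e f).eval σ = σ.arr j (e.eval σ) (f.eval σ) := rfl
@[simp] theorem eval_raw : (Expr.raw e).eval σ = σ.cell (e.eval σ) := rfl
@[simp] theorem cost_add : (e + f).cost = e.cost + f.cost + 1 := rfl
@[simp] theorem cost_sub : (e - f).cost = e.cost + f.cost + 1 := rfl
@[simp] theorem cost_ofNat : (no_index (OfNat.ofNat k : Expr)).cost = 1 := rfl
@[simp] theorem cost_var : (Expr.var x).cost = 2 := rfl
@[simp] theorem cost_get : (Expr.get j e f).cost = e.cost + f.cost + 8 := rfl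
@[simp] theorem cost_raw : (Expr.raw e).cost = e.cost + 1 := rfl
@[simp] theorem safe_add : (e + f).Safe B σ ↔
    e.Safe B σ ∧ f.Safe B σ ∧ e.eval σ + f.eval σ ≤ B := Iff.rfl
@[simp] theorem safe_sub : (e - f).Safe B σ ↔ e.Safe B σ ∧ f.Safe B σ := Iff.rfl
@[simp] theorem safe_ofNat : (no_index (OfNat.ofNat k : Expr)).Safe B σ ↔ k < B := Iff.rfl
@[simp] theorem safe_var : (Expr.var x).Safe B σ ↔ True := Iff.rfl
@[simp] theorem safe_get : (Expr.get j e f).Safe B σ ↔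
    e.Safe B σ ∧ f.Safe B σ ∧ j < 32 ∧ σ.var 0 = B ∧ e.eval σ < B ∧ f.eval σ < B := Iff.rfl
@[simp] theorem safe_raw : (Expr.raw e).Safe B σ ↔ e.Safe B σ ∧ e.eval σ < B := Iff.rfl

end

/-- `Exec B c σ t σ'`: the command `c` leads from `σ` to `σ'` in `t` machine steps, and all values
stay below the bound `B`. -/
inductive Exec (B : ℕ) : Cmd → Env → ℕ → Env → Prop where
  | skip (σ) : Exec B .skip σ 0 σ
  | assign (σ x e) (h : e.Safe B σ) : Exec B (.assign x e) σ (e.cost + 2) (σ.set x (e.eval σ))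
  | put (σ j e f g) (hj : j < 32) (h0 : σ.var 0 = B) (he : e.Safe B σ) (hf : f.Safe B σ)
      (hg : g.Safe B σ) (he' : e.eval σ < B) (hf' : f.eval σ < B) :
      Exec B (.put j e f g) σ (e.cost + f.cost + g.cost + 8)
        (σ.put j (e.eval σ) (f.eval σ) (g.eval σ))
  | out (σ e f) (he : e.Safe B σ) (hf : f.Safe B σ) (he' : e.eval σ < B) :
      Exec B (.out e f) σ (e.cost + f.cost + 1) (σ.out (e.eval σ) (f.eval σ))
  | seq {c d σ t σ' t' σ''} (hc : Exec B c σ t σ') (hd : Exec B d σ' t' σ'') :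
      Exec B (.seq c d) σ (t + t') σ''
  | iteTrue {e c d σ t σ'} (he : e.Safe B σ) (h : e.eval σ ≠ 0) (hc : Exec B c σ t σ') :
      Exec B (.ite e c d) σ (e.cost + 2 + t) σ'
  | iteFalse {e c d σ t σ'} (he : e.Safe B σ) (h : e.eval σ = 0) (hc : Exec B d σ t σ') :
      Exec B (.ite e c d) σ (e.cost + 1 + t) σ'
  | loopDone {e c σ} (he : e.Safe B σ) (h : e.eval σ = 0) :
      Exec B (.loop e c) σ (e.cost + 1) σ
  | loopStep {e c σ t σ' t' σ''} (he : e.Safe B σ) (h : e.eval σ ≠ 0) (hc : Exec B c σ t σ')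
      (hl : Exec B (.loop e c) σ' t' σ'') : Exec B (.loop e c) σ (e.cost + 2 + t + t') σ''

/-! ### Compilation -/

open WordRAM (Instr Program State step run)

/-- With `a` in register `2 d + 1` and `b` in register `2 d + 3`, computes the address of entry
`(a, b)` of array `j` in register `2 d + 1`. Register `0` contains the bound. -/
def addressCode (d j : ℕ) : List Instr :=
  [.mul (2 * d + 1) (2 * d + 1) 0, .add (2 * d + 1) (2 * d + 1) (2 * d + 3),
    .const (2 * d + 3) 32, .mul (2 * d + 1) (2 * d + 1) (2 * d + 3), .const (2 * d + 3) j,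
    .add (2 * d + 1) (2 * d + 1) (2 * d + 3), .add (2 * d + 1) (2 * d + 1) 0]

/-- Code that computes the value of an expression in register `2 d + 1`, changing only registers
`2 d' + 1` with `d' ≥ d`. Variable `x` is kept in register `2 x`. -/
def Expr.code (d : ℕ) : Expr → List Instr
  | const k => [.const (2 * d + 1) k]
  -- The machine has no instruction that copies a register, so a scratch register with the value `0`
  -- is added.
  | var x => [.const (2 * d + 3) 0, .add (2 * d + 1) (2 * x) (2 * d + 3)]
  | add e f => e.code d ++ f.code (d + 1) ++ [.add (2 * d + 1) (2 * d + 1) (2 * d + 3)]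
  | sub e f => e.code d ++ f.code (d + 1) ++ [.sub (2 * d + 1) (2 * d + 1) (2 * d + 3)]
  | get j e f => e.code d ++ f.code (d + 1) ++ (addressCode d j ++ [.load (2 * d + 1) (2 * d + 1)])
  | raw e => e.code d ++ [.load (2 * d + 1) (2 * d + 1)]

@[simp] theorem Expr.length_code (e : Expr) (d : ℕ) : (e.code d).length = e.cost := by
  induction e generalizing d <;> simp_all [Expr.code, Expr.cost, addressCode] <;> omega

/-- The length of the code of a command. -/
def Cmd.len : Cmd → ℕ
  | skip => 0
  | assign _ e => e.cost + 2
  | put _ e f g => e.cost + f.cost + g.cost + 8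
  | out e f => e.cost + f.cost + 1
  | seq c d => c.len + d.len
  | ite e c d => e.cost + 2 + c.len + d.len
  | loop e c => e.cost + 2 + c.len

/-- The code of a command, to be placed at position `o`. -/
def Cmd.code (o : ℕ) : Cmd → List Instr
  | skip => []
  | assign x e => e.code 0 ++ [.const 3 0, .add (2 * x) 1 3]
  -- The value is computed at depth `1`, which leaves the address in register `1` intact.
  | put j e f g => e.code 0 ++ (f.code 1 ++ (addressCode 0 j ++ (g.code 1 ++ [.store 1 3])))
  | out e f => e.code 0 ++ (f.code 1 ++ [.store 1 3])
  | seq c d => c.code o ++ d.code (o + c.len)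
  | ite e c d => e.code 0 ++ (.jumpZero 1 (o + e.cost + 2 + c.len) ::
      (c.code (o + e.cost + 1) ++ (.jump (o + e.cost + 2 + c.len + d.len) ::
        d.code (o + e.cost + 2 + c.len))))
  | loop e c => e.code 0 ++ (.jumpZero 1 (o + e.cost + 2 + c.len) ::
      (c.code (o + e.cost + 1) ++ [.jump o]))

@[simp] theorem Cmd.length_code (c : Cmd) (o : ℕ) : (c.code o).length = c.len := by
  induction c generalizing o <;> simp_all [Cmd.code, Cmd.len, addressCode] <;> omega

/-! ### Correctness of the compilation. -/

/-- The program `P` contains the code `l` at position `o`. -/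
def CodeAt (P : Program) (o : ℕ) (l : List Instr) : Prop := ∀ i < l.length, P[o + i]? = l[i]?

theorem codeAt_append {P : Program} {o : ℕ} {l l' : List Instr} :
    CodeAt P o (l ++ l') ↔ CodeAt P o l ∧ CodeAt P (o + l.length) l' := by
  constructor
  · intro h
    refine ⟨fun i hi => ?_, fun i hi => ?_⟩
    · rw [h i (by simp; omega), List.getElem?_append_left hi]
    · rw [add_assoc, h (l.length + i) (by simp; omega), List.getElem?_append_right (by omega)]
      simp
  · rintro ⟨h, h'⟩ i hi
    by_cases hl : i < l.length
    · rw [h i hl, List.getElem?_append_left hl]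
    · rw [List.getElem?_append_right (by omega),
        ← h' (i - l.length) (by simp at hi; omega)]
      congr 1; omega

theorem codeAt_cons {P : Program} {o : ℕ} {a : Instr} {l : List Instr} :
    CodeAt P o (a :: l) ↔ P[o]? = some a ∧ CodeAt P (o + 1) l := by
  have := codeAt_append (P := P) (o := o) (l := [a]) (l' := l)
  rw [List.singleton_append] at this
  rw [this]
  refine and_congr ⟨fun h => by simpa using h 0 (by simp), fun h i hi => ?_⟩ (by simp)
  obtain rfl : i = 0 := by simpa using hi
  simpa using h

theorem run_add (b : ℕ) (P : Program) (t t' : ℕ) (s s' : State) (h : run b P t s = some s') :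
    run b P (t + t') s = run b P t' s' := by
  induction t generalizing s with
  | zero => simp only [run, Option.some.injEq] at h; simp [h]
  | succ t ih =>
    rw [Nat.succ_add, run]
    rw [run] at h
    obtain ⟨s₁, h₁, h₂⟩ := Option.bind_eq_some_iff.1 h
    rw [h₁, Option.bind_some, ih s₁ h₂]

theorem run_trans {b : ℕ} {P : Program} {t t' : ℕ} {s s' s'' : State}
    (h : run b P t s = some s') (h' : run b P t' s' = some s'') :
    run b P (t + t') s = some s'' := by rw [run_add b P t t' s s' h, h']

/-- All registers and memory cells fit into words. -/
structure Fits (b : ℕ) (s : State) : Prop where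
  reg : ∀ r, s.reg r < 2 ^ b
  mem : ∀ a, s.mem a < 2 ^ b

/-- The machine configuration `s` represents the environment `σ`. -/
structure Represents (b B : ℕ) (σ : Env) (s : State) : Prop extends Fits b s where
  var : ∀ x, s.reg (2 * x) = σ.var x
  cell : ∀ i < B, s.mem i = σ.cell i
  arr : ∀ j < 32, ∀ x < B, ∀ y < B, s.mem ((x * B + y) * 32 + j + B) = σ.arr j x y

/-- The number on the right is assumed to fit into a word, so forming an address never overflows. -/
theorem index_lt {B x y j : ℕ} (hx : x < B) (hy : y < B) (hj : j < 32) :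
    (x * B + y) * 32 + j + B < 64 * (B + 1) ^ 2 := by
  have : x * B + y < B * B := by nlinarith
  nlinarith

/-- The `32` arrays are interleaved: the remainder modulo `32` recovers `j`, and division by `B`
then recovers the two indices. Hence a write changes one array entry only. -/
theorem index_inj {B x y j x' y' j' : ℕ} (hy : y < B) (hj : j < 32)
    (hy' : y' < B) (hj' : j' < 32)
    (h : (x * B + y) * 32 + j + B = (x' * B + y') * 32 + j' + B) : j = j' ∧ x = x' ∧ y = y' := by
  have h1 : j = j' := by omega
  have h2 : x * B + y = x' * B + y' := by omega
  have h3 : y = y' := by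
    have := congrArg (· % B) h2
    simpa [Nat.mod_eq_of_lt hy, Nat.mod_eq_of_lt hy'] using this
  subst h1 h3
  refine ⟨rfl, ?_, rfl⟩
  exact Nat.eq_of_mul_eq_mul_right (by omega) (Nat.add_right_cancel h2)

theorem Fits.update {b : ℕ} {s : State} (h : Fits b s) {d v pc : ℕ} (hv : v < 2 ^ b) :
    Fits b ⟨pc, Function.update s.reg d v, s.mem⟩ :=
  ⟨fun r => by by_cases hr : r = d <;> simp [hr, hv, h.reg], h.mem⟩

theorem run_write {b : ℕ} {P : Program} {s : State} {d v : ℕ}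
    (h : step b P s = s.write b d v) (hv : v < 2 ^ b) :
    run b P 1 s = some ⟨s.pc + 1, Function.update s.reg d v, s.mem⟩ := by
  simp [run, h, State.write, hv]

section
variable {b B : ℕ} {P : Program}

theorem run_addressCode (hB : 64 * (B + 1) ^ 2 ≤ 2 ^ b) {s : State} {d j x y : ℕ}
    (hf : Fits b s) (h0 : s.reg 0 = B) (hx : s.reg (2 * d + 1) = x) (hy : s.reg (2 * d + 3) = y)
    (hxB : x < B) (hyB : y < B) (hj : j < 32) (hP : CodeAt P s.pc (addressCode d j)) :
    ∃ s', run b P 7 s = some s' ∧ s'.pc = s.pc + 7 ∧ s'.mem = s.mem ∧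
      s'.reg (2 * d + 1) = (x * B + y) * 32 + j + B ∧
      (∀ r, r % 2 = 0 ∨ r < 2 * d + 1 → s'.reg r = s.reg r) ∧ Fits b s' := by
  have hi := index_lt hxB hyB hj
  simp only [addressCode, codeAt_cons] at hP
  obtain ⟨h1, h2, h3, h4, h5, h6, h7, -⟩ := hP
  have e1 := run_write (b := b) (P := P) (s := s) (d := 2 * d + 1) (v := x * B)
    (by simp [step, h1, hx, h0]) (by omega)
  have f1 := hf.update (d := 2 * d + 1) (v := x * B) (pc := s.pc + 1) (by omega)
  generalize hs1 : (⟨s.pc + 1, Function.update s.reg (2 * d + 1) (x * B), s.mem⟩ : State) = s1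
    at e1 f1
  have e2 := run_write (b := b) (P := P) (s := s1) (d := 2 * d + 1) (v := x * B + y)
    (by simp [step, ← hs1, h2, hy]) (by omega)
  have f2 := f1.update (d := 2 * d + 1) (v := x * B + y) (pc := s1.pc + 1) (by omega)
  generalize hs2 : (⟨s1.pc + 1, Function.update s1.reg (2 * d + 1) (x * B + y), s1.mem⟩ : State)
    = s2 at e2 f2
  have e3 := run_write (b := b) (P := P) (s := s2) (d := 2 * d + 3) (v := 32)
    (by simp [step, ← hs2, ← hs1, h3]) (by nlinarith)
  have f3 := f2.update (d := 2 * d + 3) (v := 32) (pc := s2.pc + 1) (by nlinarith)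
  generalize hs3 : (⟨s2.pc + 1, Function.update s2.reg (2 * d + 3) 32, s2.mem⟩ : State)
    = s3 at e3 f3
  have e4 := run_write (b := b) (P := P) (s := s3) (d := 2 * d + 1) (v := (x * B + y) * 32)
    (by simp [step, ← hs3, ← hs2, ← hs1, h4]) (by omega)
  have f4 := f3.update (d := 2 * d + 1) (v := (x * B + y) * 32) (pc := s3.pc + 1) (by omega)
  generalize hs4 : (⟨s3.pc + 1, Function.update s3.reg (2 * d + 1) ((x * B + y) * 32), s3.mem⟩ :
    State) = s4 at e4 f4
  have e5 := run_write (b := b) (P := P) (s := s4) (d := 2 * d + 3) (v := j)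
    (by simp [step, ← hs4, ← hs3, ← hs2, ← hs1, h5]) (by omega)
  have f5 := f4.update (d := 2 * d + 3) (v := j) (pc := s4.pc + 1) (by omega)
  generalize hs5 : (⟨s4.pc + 1, Function.update s4.reg (2 * d + 3) j, s4.mem⟩ : State)
    = s5 at e5 f5
  have e6 := run_write (b := b) (P := P) (s := s5) (d := 2 * d + 1) (v := (x * B + y) * 32 + j)
    (by simp [step, ← hs5, ← hs4, ← hs3, ← hs2, ← hs1, h6]) (by omega)
  have f6 := f5.update (d := 2 * d + 1) (v := (x * B + y) * 32 + j) (pc := s5.pc + 1) (by omega)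
  generalize hs6 : (⟨s5.pc + 1, Function.update s5.reg (2 * d + 1) ((x * B + y) * 32 + j),
    s5.mem⟩ : State) = s6 at e6 f6
  have e7 := run_write (b := b) (P := P) (s := s6) (d := 2 * d + 1)
    (v := (x * B + y) * 32 + j + B)
    (by simp [step, ← hs6, ← hs5, ← hs4, ← hs3, ← hs2, ← hs1, h7, h0]) (by omega)
  have f7 := f6.update (d := 2 * d + 1) (v := (x * B + y) * 32 + j + B) (pc := s6.pc + 1)
    (by omega)
  refine ⟨_, run_trans e1 (run_trans e2 (run_trans e3 (run_trans e4 (run_trans e5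
    (run_trans e6 e7))))), ?_, ?_, ?_, ?_, f7⟩
  · simp [← hs6, ← hs5, ← hs4, ← hs3, ← hs2, ← hs1]
  · simp [← hs6, ← hs5, ← hs4, ← hs3, ← hs2, ← hs1]
  · simp
  · intro r hr
    have a1 : r ≠ 2 * d + 1 := by omega
    have a2 : r ≠ 2 * d + 3 := by omega
    simp [← hs6, ← hs5, ← hs4, ← hs3, ← hs2, ← hs1, a1, a2]

/-- Variables live in even registers and intermediate values in odd ones, so evaluating an
expression cannot disturb the environment. -/
theorem Represents.congr {σ : Env} {s s' : State} (h : Represents b B σ s) (hf : Fits b s')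
    (hm : s'.mem = s.mem) (hr : ∀ r, r % 2 = 0 → s'.reg r = s.reg r) : Represents b B σ s' :=
  ⟨hf, fun x => by rw [hr _ (by omega), h.var], fun i hi => by rw [hm, h.cell i hi],
    fun j hj x hx y hy => by rw [hm, h.arr j hj x hx y hy]⟩

/-- The odd registers act as a stack whose top is register `2 d + 1`. The clause about the registers
below the top keeps the left operand alive while the right one is evaluated one level higher. -/
theorem Expr.run_code (hB : 64 * (B + 1) ^ 2 ≤ 2 ^ b) {σ : Env} (e : Expr) (d : ℕ) {s : State}
    (hR : Represents b B σ s) (hs : e.Safe B σ) (hP : CodeAt P s.pc (e.code d)) :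
    ∃ s', run b P e.cost s = some s' ∧ s'.pc = s.pc + e.cost ∧ s'.mem = s.mem ∧
      s'.reg (2 * d + 1) = e.eval σ ∧
      (∀ r, r % 2 = 0 ∨ r < 2 * d + 1 → s'.reg r = s.reg r) ∧ Fits b s' := by
  have hBb : B < 2 ^ b := by nlinarith
  induction e generalizing d s with
  | const k =>
    simp only [Expr.code, codeAt_cons] at hP
    have hk : k < 2 ^ b := lt_trans hs hBb
    refine ⟨_, run_write (d := 2 * d + 1) (v := k) (by simp [step, hP.1]) hk, rfl, rfl,
      by simp [Expr.eval], fun r hr => ?_, hR.update hk⟩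
    simp only
    rw [Function.update_of_ne (by omega)]
  | var x =>
    simp only [Expr.code, codeAt_cons] at hP
    obtain ⟨h1, h2, -⟩ := hP
    have e1 := run_write (b := b) (P := P) (s := s) (d := 2 * d + 3) (v := 0)
      (by simp [step, h1]) (by omega)
    have f1 := hR.update (d := 2 * d + 3) (v := 0) (pc := s.pc + 1) (by omega)
    have hv : σ.var x < 2 ^ b := by rw [← hR.var]; exact hR.reg _
    have e2 := run_write (b := b) (P := P)
      (s := ⟨s.pc + 1, Function.update s.reg (2 * d + 3) 0, s.mem⟩)
      (d := 2 * d + 1) (v := σ.var x) (by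
        simp only [step, h2, Function.update_self]
        rw [Function.update_of_ne (by omega), hR.var, add_zero]) hv
    refine ⟨_, run_trans e1 e2, rfl, rfl, by simp [Expr.eval], fun r hr => ?_, f1.update hv⟩
    simp only
    rw [Function.update_of_ne (by omega), Function.update_of_ne (by omega)]
  | add e f ihe ihf =>
    simp only [Expr.code, codeAt_append, codeAt_cons, Expr.length_code, List.length_append] at hP
    obtain ⟨⟨h1, h2⟩, h3, -⟩ := hP
    obtain ⟨he, hf, hlt⟩ := hs
    obtain ⟨s1, r1, p1, m1, v1, g1, f1⟩ := ihe d hR he h1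
    obtain ⟨s2, r2, p2, m2, v2, g2, f2⟩ := ihf (d + 1) (hR.congr f1 m1 fun r hr => g1 r (.inl hr))
      hf (by rw [p1]; exact h2)
    have hv : e.eval σ + f.eval σ < 2 ^ b := by omega
    refine ⟨_, run_trans (run_trans r1 r2) (run_write (d := 2 * d + 1)
      (v := e.eval σ + f.eval σ) ?_ hv), ?_, by rw [m2, m1], by simp [Expr.eval], fun r hr => ?_,
      f2.update hv⟩
    · rw [← add_assoc, ← p1, ← p2] at h3
      rw [step, h3]
      simp only
      rw [← v1, ← v2, g2 (2 * d + 1) (by omega)]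
      rfl
    · simp only [Expr.cost]; omega
    · simp only
      rw [Function.update_of_ne (by omega), g2 r (by omega), g1 r hr]
  | sub e f ihe ihf =>
    simp only [Expr.code, codeAt_append, codeAt_cons, Expr.length_code, List.length_append] at hP
    obtain ⟨⟨h1, h2⟩, h3, -⟩ := hP
    obtain ⟨he, hf⟩ := hs
    obtain ⟨s1, r1, p1, m1, v1, g1, f1⟩ := ihe d hR he h1
    obtain ⟨s2, r2, p2, m2, v2, g2, f2⟩ := ihf (d + 1) (hR.congr f1 m1 fun r hr => g1 r (.inl hr))
      hf (by rw [p1]; exact h2)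
    have hv : e.eval σ - f.eval σ < 2 ^ b := by have := f1.reg (2 * d + 1); omega
    refine ⟨_, run_trans (run_trans r1 r2) (run_write (d := 2 * d + 1)
      (v := e.eval σ - f.eval σ) ?_ hv), ?_, by rw [m2, m1], by simp [Expr.eval], fun r hr => ?_,
      f2.update hv⟩
    · rw [← add_assoc, ← p1, ← p2] at h3
      rw [step, h3]
      simp only
      rw [← v1, ← v2, g2 (2 * d + 1) (by omega)]
      rfl
    · simp only [Expr.cost]; omega
    · simp only
      rw [Function.update_of_ne (by omega), g2 r (by omega), g1 r hr]
  | get j e f ihe ihf =>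
    simp only [Expr.code, codeAt_append, codeAt_cons, Expr.length_code, List.length_append] at hP
    obtain ⟨⟨h1, h2⟩, h3, h4, -⟩ := hP
    obtain ⟨he, hf, hj, h0, hx, hy⟩ := hs
    obtain ⟨s1, r1, p1, m1, v1, g1, f1⟩ := ihe d hR he h1
    have hR1 := hR.congr f1 m1 fun r hr => g1 r (.inl hr)
    obtain ⟨s2, r2, p2, m2, v2, g2, f2⟩ := ihf (d + 1) hR1 hf (by rw [p1]; exact h2)
    have hR2 := hR1.congr f2 m2 fun r hr => g2 r (.inl hr)
    obtain ⟨s3, r3, p3, m3, v3, g3, f3⟩ := run_addressCode hB (s := s2) (d := d) f2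
      (by rw [← h0, ← hR2.var]) (by rw [g2 _ (by omega), v1]) v2 hx hy hj
      (by rw [p2, p1, add_assoc]; exact h3)
    -- A value read from memory needs no bound of its own: every cell already fits into a word.
    have hv : σ.arr j (e.eval σ) (f.eval σ) < 2 ^ b := by
      rw [← hR.arr j hj _ hx _ hy]; exact hR.mem _
    refine ⟨_, run_trans (run_trans r1 r2) (run_trans r3 (run_write (d := 2 * d + 1)
      (v := σ.arr j (e.eval σ) (f.eval σ)) ?_ hv)), ?_, by rw [m3, m2, m1], by simp [Expr.eval],
      fun r hr => ?_, f3.update hv⟩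
    · have : s.pc + (e.cost + f.cost) + (addressCode d j).length = s3.pc := by
        simp [addressCode]; omega
      rw [this] at h4
      rw [step, h4]
      simp only
      rw [v3, m3, m2, m1, hR.arr j hj _ hx _ hy]
    · simp only [Expr.cost]; omega
    · simp only
      rw [Function.update_of_ne (by omega), g3 r (by omega), g2 r (by omega), g1 r hr]
  | raw e ihe =>
    simp only [Expr.code, codeAt_append, codeAt_cons, Expr.length_code] at hP
    obtain ⟨h1, h3, -⟩ := hP
    obtain ⟨he, hx⟩ := hs
    obtain ⟨s1, r1, p1, m1, v1, g1, f1⟩ := ihe d hR he h1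
    have hv : σ.cell (e.eval σ) < 2 ^ b := by
      rw [← hR.cell _ hx]; exact hR.mem _
    refine ⟨_, run_trans r1 (run_write (d := 2 * d + 1)
      (v := σ.cell (e.eval σ)) ?_ hv), ?_, by rw [m1], by simp [Expr.eval],
      fun r hr => ?_, f1.update hv⟩
    · rw [← p1] at h3
      rw [step, h3]
      simp only
      rw [v1, m1, hR.cell _ hx]
    · simp only [Expr.cost]; omega
    · simp only
      rw [Function.update_of_ne (by omega), g1 r hr]

/-- Induction on the execution, whose costs are exact numbers of instructions. An iteration of a
loop ends with a jump to the start of the code of the loop, so the remaining iterations are covered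
by the induction hypothesis for the same piece of code. -/
theorem Exec.run_code (hB : 64 * (B + 1) ^ 2 ≤ 2 ^ b) {σ σ' : Env} {c : Cmd} {t : ℕ}
    (h : Exec B c σ t σ') {s : State} (hR : Represents b B σ s) (hP : CodeAt P s.pc (c.code s.pc)) :
    ∃ s', run b P t s = some s' ∧ s'.pc = s.pc + c.len ∧ Represents b B σ' s' := by
  have hpos := Nat.two_pow_pos b
  induction h generalizing s with
  | skip => exact ⟨s, rfl, rfl, hR⟩
  | assign σ x e h =>
    simp only [Cmd.code, codeAt_append, codeAt_cons, Expr.length_code] at hP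
    obtain ⟨h1, h2, h3, -⟩ := hP
    obtain ⟨s1, r1, p1, m1, v1, g1, f1⟩ := e.run_code hB 0 hR h h1
    have hR1 := hR.congr f1 m1 fun r hr => g1 r (.inl hr)
    rw [← p1] at h2 h3
    have e1 := run_write (b := b) (P := P) (s := s1) (d := 3) (v := 0)
      (by simp [step, h2]) (by omega)
    have f2 := f1.update (d := 3) (v := 0) (pc := s1.pc + 1) (by omega)
    have hv : e.eval σ < 2 ^ b := by rw [← v1]; exact f1.reg _
    have e2 := run_write (b := b) (P := P)
      (s := ⟨s1.pc + 1, Function.update s1.reg 3 0, s1.mem⟩)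
      (d := 2 * x) (v := e.eval σ) (by
        simp only [step, h3, Function.update_self]
        rw [Function.update_of_ne (by omega)]
        simpa using congrArg _ v1) hv
    refine ⟨_, run_trans r1 (run_trans e1 e2), ?_, f2.update hv, fun y => ?_, ?_, ?_⟩
    · simp only [p1, Cmd.len]; omega
    · by_cases hy : y = x
      · subst hy; simp
      · simp only [Env.set_var, hy, if_false]
        rw [Function.update_of_ne (by omega), Function.update_of_ne (by omega), hR1.var]
    · simpa [m1] using hR.cell
    · simpa [m1] using hR.arr
  | put σ j e f g hj h0 he hf hg hx hy =>
    simp only [Cmd.code, codeAt_append, codeAt_cons, Expr.length_code] at hP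
    obtain ⟨h1, h2, h3, h4, h5, -⟩ := hP
    obtain ⟨s1, r1, p1, m1, v1, g1, f1⟩ := e.run_code hB 0 hR he h1
    have hR1 := hR.congr f1 m1 fun r hr => g1 r (.inl hr)
    obtain ⟨s2, r2, p2, m2, v2, g2, f2⟩ := f.run_code hB 1 hR1 hf (by rw [p1]; exact h2)
    have hR2 := hR1.congr f2 m2 fun r hr => g2 r (.inl hr)
    obtain ⟨s3, r3, p3, m3, v3, g3, f3⟩ := run_addressCode hB (s := s2) (d := 0) f2
      (by rw [← h0, ← hR2.var]) (by rw [g2 _ (by omega)]; exact v1) v2 hx hy hj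
      (by rw [p2, p1]; exact h3)
    have hR3 := hR2.congr f3 m3 fun r hr => g3 r (.inl hr)
    obtain ⟨s4, r4, p4, m4, v4, g4, f4⟩ := g.run_code hB 1 hR3 hg
      (by rw [p3, p2, p1]; simpa [addressCode] using h4)
    have hR4 := hR3.congr f4 m4 fun r hr => g4 r (.inl hr)
    have hpc : s.pc + e.cost + f.cost + (addressCode 0 j).length + g.cost = s4.pc := by
      simp [addressCode]; omega
    rw [hpc] at h5
    have hreg : s4.reg 1 = (e.eval σ * B + f.eval σ) * 32 + j + B := by
      rw [g4 1 (by omega)]; simpa using v3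
    refine ⟨⟨s4.pc + 1, s4.reg, Function.update s4.mem (s4.reg 1) (s4.reg 3)⟩,
      ?_, ?_,
      ⟨f4.reg, fun a => ?_⟩, fun x => ?_, fun i hi => ?_, fun j' hj' x hx' y hy' => ?_⟩
    · rw [show e.cost + f.cost + g.cost + 8 = e.cost + (f.cost + (7 + (g.cost + 1))) by omega]
      exact run_trans r1 (run_trans r2 (run_trans r3 (run_trans r4 (t' := 1)
        (by simp [run, step, h5]))))
    · simp only [← hpc, Cmd.len]; simp [addressCode]; omega
    · by_cases ha : a = s4.reg 1
      · simp [ha, f4.reg]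
      · simp [ha, f4.mem]
    · simpa using hR4.var x
    · simp only [hreg, Env.put_cell]
      -- Addresses of array entries are at least `B`, hence outside the input area.
      rw [Function.update_of_ne (by omega), hR4.cell i hi]
    · simp only [Env.put_arr]
      by_cases ha : (x * B + y) * 32 + j' + B = s4.reg 1
      · have := index_inj hy' hj' hy hj (ha.trans hreg)
        rw [ha, Function.update_self, if_pos this]
        exact v4
      · rw [Function.update_of_ne ha, hR4.arr j' hj' x hx' y hy', if_neg]
        rintro ⟨rfl, rfl, rfl⟩
        exact ha hreg.symm
  | out σ e f he hf hx =>
    simp only [Cmd.code, codeAt_append, codeAt_cons, Expr.length_code] at hP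
    obtain ⟨h1, h2, h5, -⟩ := hP
    obtain ⟨s1, r1, p1, m1, v1, g1, f1⟩ := e.run_code hB 0 hR he h1
    have hR1 := hR.congr f1 m1 fun r hr => g1 r (.inl hr)
    obtain ⟨s2, r2, p2, m2, v2, g2, f2⟩ := f.run_code hB 1 hR1 hf (by rw [p1]; exact h2)
    have hR2 := hR1.congr f2 m2 fun r hr => g2 r (.inl hr)
    have hpc : s.pc + e.cost + f.cost = s2.pc := by omega
    rw [hpc] at h5
    have hreg : s2.reg 1 = e.eval σ := by rw [g2 1 (by omega)]; simpa using v1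
    have hv2 : s2.reg 3 = f.eval σ := v2
    refine ⟨⟨s2.pc + 1, s2.reg, Function.update s2.mem (s2.reg 1) (s2.reg 3)⟩,
      run_trans (run_trans r1 r2) (t' := 1) ?_, ?_,
      ⟨f2.reg, fun a => ?_⟩, fun x => ?_, fun i hi => ?_, fun j' hj' x hx' y hy' => ?_⟩
    · simp [run, step, h5]
    · simp only [← hpc, Cmd.len]; omega
    · by_cases ha : a = s2.reg 1
      · simp [ha, f2.reg]
      · simp [ha, f2.mem]
    · simpa using hR2.var x
    · simp only [hreg, hv2, Env.out_cell, Function.update_apply, hR2.cell i hi]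
    · simp only [hreg, Env.out_arr]
      rw [Function.update_of_ne (by omega), hR2.arr j' hj' x hx' y hy']
  | @seq c d _ _ σ₁ _ _ hc hd ihc ihd =>
    simp only [Cmd.code, codeAt_append, Cmd.length_code] at hP
    obtain ⟨s1, r1, p1, R1⟩ := ihc hR hP.1
    obtain ⟨s2, r2, p2, R2⟩ := ihd R1 (by rw [p1]; exact hP.2)
    exact ⟨s2, run_trans r1 r2, by simp only [p2, p1, Cmd.len]; omega, R2⟩
  | @iteTrue e c d σ t σ' he h hc ih =>
    simp only [Cmd.code, codeAt_append, codeAt_cons, Expr.length_code, Cmd.length_code] at hP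
    obtain ⟨h1, h2, h3, h4, h5⟩ := hP
    obtain ⟨s1, r1, p1, m1, v1, g1, f1⟩ := e.run_code hB 0 hR he h1
    have hR1 := hR.congr f1 m1 fun r hr => g1 r (.inl hr)
    rw [← p1] at h2 h3 h4
    have e1 : run b P 1 s1 = some ⟨s1.pc + 1, s1.reg, s1.mem⟩ := by
      have : s1.reg 1 ≠ 0 := by rw [show s1.reg 1 = _ from v1]; exact h
      simp [run, step, h2, this]
    obtain ⟨s2, r2, p2, R2⟩ := ih (s := ⟨s1.pc + 1, s1.reg, s1.mem⟩)
      (hR1.congr ⟨f1.reg, f1.mem⟩ rfl fun _ _ => rfl) h3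
    refine ⟨⟨s.pc + e.cost + 2 + c.len + d.len, s2.reg, s2.mem⟩,
      ?_, ?_,
      R2.congr ⟨R2.reg, R2.mem⟩ rfl fun _ _ => rfl⟩
    · simp only at p2
      rw [← p2] at h4
      rw [show e.cost + 2 + t = e.cost + (1 + (t + 1)) by omega]
      exact run_trans r1 (run_trans e1 (run_trans r2 (t' := 1) (by simp [run, step, h4]; exact p1)))
    · simp only [Cmd.len]; omega
  | @iteFalse e c d σ t σ' he h hc ih =>
    simp only [Cmd.code, codeAt_append, codeAt_cons, Expr.length_code, Cmd.length_code] at hP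
    obtain ⟨h1, h2, h3, h4, h5⟩ := hP
    obtain ⟨s1, r1, p1, m1, v1, g1, f1⟩ := e.run_code hB 0 hR he h1
    have hR1 := hR.congr f1 m1 fun r hr => g1 r (.inl hr)
    rw [← p1] at h2
    have e1 : run b P 1 s1 = some ⟨s.pc + e.cost + 2 + c.len, s1.reg, s1.mem⟩ := by
      have : s1.reg 1 = 0 := by rw [show s1.reg 1 = _ from v1]; exact h
      simp [run, step, h2, this]; exact p1
    obtain ⟨s2, r2, p2, R2⟩ := ih (s := ⟨s.pc + e.cost + 2 + c.len, s1.reg, s1.mem⟩)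
      (hR1.congr ⟨f1.reg, f1.mem⟩ rfl fun _ _ => rfl)
      (by convert h5 using 1; simp only; omega)
    refine ⟨s2, by rw [add_assoc]; exact run_trans r1 (run_trans e1 r2), ?_, R2⟩
    simp only [Cmd.len] at p2 ⊢; omega
  | @loopDone e c σ he h =>
    simp only [Cmd.code, codeAt_append, codeAt_cons, Expr.length_code, Cmd.length_code] at hP
    obtain ⟨h1, h2, h3, h4, -⟩ := hP
    obtain ⟨s1, r1, p1, m1, v1, g1, f1⟩ := e.run_code hB 0 hR he h1
    have hR1 := hR.congr f1 m1 fun r hr => g1 r (.inl hr)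
    rw [← p1] at h2
    refine ⟨⟨s.pc + e.cost + 2 + c.len, s1.reg, s1.mem⟩, run_trans r1 (t' := 1) ?_, ?_,
      hR1.congr ⟨f1.reg, f1.mem⟩ rfl fun _ _ => rfl⟩
    · have : s1.reg 1 = 0 := by rw [show s1.reg 1 = _ from v1]; exact h
      simp [run, step, h2, this]; exact p1
    · simp only [Cmd.len]; omega
  | @loopStep e c σ t σ' t' σ'' he h hc hl ih ihl =>
    have hP' := hP
    simp only [Cmd.code, codeAt_append, codeAt_cons, Expr.length_code, Cmd.length_code] at hP
    obtain ⟨h1, h2, h3, h4, -⟩ := hP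
    obtain ⟨s1, r1, p1, m1, v1, g1, f1⟩ := e.run_code hB 0 hR he h1
    have hR1 := hR.congr f1 m1 fun r hr => g1 r (.inl hr)
    rw [← p1] at h2 h3 h4
    have e1 : run b P 1 s1 = some ⟨s1.pc + 1, s1.reg, s1.mem⟩ := by
      have : s1.reg 1 ≠ 0 := by rw [show s1.reg 1 = _ from v1]; exact h
      simp [run, step, h2, this]
    obtain ⟨s2, r2, p2, R2⟩ := ih (s := ⟨s1.pc + 1, s1.reg, s1.mem⟩)
      (hR1.congr ⟨f1.reg, f1.mem⟩ rfl fun _ _ => rfl) h3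
    have e2 : run b P 1 s2 = some ⟨s.pc, s2.reg, s2.mem⟩ := by
      simp only at p2
      rw [← p2] at h4
      simp [run, step, h4]
    obtain ⟨s3, r3, p3, R3⟩ := ihl (s := ⟨s.pc, s2.reg, s2.mem⟩)
      (R2.congr ⟨R2.reg, R2.mem⟩ rfl fun _ _ => rfl) hP'
    refine ⟨s3, ?_, p3, R3⟩
    rw [show e.cost + 2 + t + t' = e.cost + (1 + (t + (1 + t'))) by omega]
    exact run_trans r1 (run_trans e1 (run_trans r2 (run_trans e2 r3)))

end

end Loop

/-! ### Program logic -/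

namespace Loop

/-- Whether a command can assign to variable `x`. -/
def Cmd.modVar (x : ℕ) : Cmd → Bool
  | assign y _ => x == y
  | seq c d => c.modVar x || d.modVar x
  | ite _ c d => c.modVar x || d.modVar x
  | loop _ c => c.modVar x
  | _ => false

/-- Whether a command can assign to array `j`. -/
def Cmd.modArr (j : ℕ) : Cmd → Bool
  | put i _ _ _ => j == i
  | seq c d => c.modArr j || d.modArr j
  | ite _ c d => c.modArr j || d.modArr j
  | loop _ c => c.modArr j
  | _ => false

/-- Whether a command can write into the input area. -/
def Cmd.modCell : Cmd → Bool
  | out _ _ => true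
  | seq c d => c.modCell || d.modCell
  | ite _ c d => c.modCell || d.modCell
  | loop _ c => c.modCell
  | _ => false

/-- `σ'` agrees with `σ` on everything that `c` cannot modify. -/
structure Frame (c : Cmd) (σ σ' : Env) : Prop where
  var : ∀ x, c.modVar x = false → σ'.var x = σ.var x
  arr : ∀ j, c.modArr j = false → σ'.arr j = σ.arr j
  cell : c.modCell = false → σ'.cell = σ.cell

theorem Frame.refl (c : Cmd) (σ : Env) : Frame c σ σ :=
  ⟨fun _ _ => rfl, fun _ _ => rfl, fun _ => rfl⟩

theorem Frame.trans {c d e : Cmd} {σ σ' σ'' : Env} (h : Frame c σ σ') (h' : Frame d σ' σ'')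
    (hv : ∀ x, e.modVar x = false → c.modVar x = false ∧ d.modVar x = false)
    (ha : ∀ x, e.modArr x = false → c.modArr x = false ∧ d.modArr x = false)
    (hc : e.modCell = false → c.modCell = false ∧ d.modCell = false) : Frame e σ σ'' :=
  ⟨fun x hx => (h'.var x (hv x hx).2).trans (h.var x (hv x hx).1),
    fun x hx => (h'.arr x (ha x hx).2).trans (h.arr x (ha x hx).1),
    fun hx => (h'.cell (hc hx).2).trans (h.cell (hc hx).1)⟩

theorem Frame.mono {c e : Cmd} {σ σ' : Env} (h : Frame c σ σ')
    (hv : ∀ x, e.modVar x = false → c.modVar x = false)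
    (ha : ∀ x, e.modArr x = false → c.modArr x = false)
    (hc : e.modCell = false → c.modCell = false) : Frame e σ σ' :=
  ⟨fun x hx => h.var x (hv x hx), fun x hx => h.arr x (ha x hx), fun hx => h.cell (hc hx)⟩

/-- Which data survive a command is a syntactic question that `decide` or `rfl` settles, so
specifications and invariants have to mention only what changes. -/
theorem Exec.frame {B t : ℕ} {c : Cmd} {σ σ' : Env} (h : Exec B c σ t σ') : Frame c σ σ' := by
  induction h with
  | skip | loopDone => exact .refl _ _
  | assign =>
    refine ⟨fun x hx => ?_, fun _ _ => rfl, fun _ => rfl⟩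
    simp only [Cmd.modVar, beq_eq_false_iff_ne] at hx
    simp [hx]
  | put =>
    refine ⟨fun _ _ => rfl, fun j hj => ?_, fun _ => rfl⟩
    simp only [Cmd.modArr, beq_eq_false_iff_ne] at hj
    funext x y
    simp [hj]
  | out => exact ⟨fun _ _ => rfl, fun _ _ => rfl, fun h => by simp [Cmd.modCell] at h⟩
  | seq _ _ h1 h2 =>
    exact h1.trans h2 (by simp [Cmd.modVar]) (by simp [Cmd.modArr]) (by simp [Cmd.modCell])
  | iteTrue _ _ _ h | iteFalse _ _ _ h =>
    exact h.mono (by simp +contextual [Cmd.modVar]) (by simp +contextual [Cmd.modArr])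
      (by simp +contextual [Cmd.modCell])
  | loopStep _ _ _ _ h1 h2 =>
    exact h1.trans h2 (by simp [Cmd.modVar]) (by simp [Cmd.modArr]) (by simp [Cmd.modCell])

/-- Started in `σ`, the command terminates without exceeding the bound, with a running time and a
final environment that satisfy `Q`. -/
def wp (B : ℕ) (c : Cmd) (Q : ℕ → Env → Prop) (σ : Env) : Prop :=
  ∃ t σ', Exec B c σ t σ' ∧ Q t σ'

variable {B : ℕ} {c d : Cmd} {e f g : Expr} {σ : Env} {Q Q' : ℕ → Env → Prop} {x y j : ℕ}

/-- The continuation also receives the frame condition, which carries all facts about untouched data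
across a command. -/
theorem wp.mono (h : wp B c Q σ) (hQ : ∀ t τ, Q t τ → Frame c σ τ → Q' t τ) : wp B c Q' σ :=
  let ⟨t, τ, ht, hτ⟩ := h
  ⟨t, τ, ht, hQ t τ hτ ht.frame⟩

@[simp] theorem wp_skip : wp B .skip Q σ ↔ Q 0 σ := by
  constructor
  · rintro ⟨_, _, ⟨⟩, h⟩
    exact h
  · exact fun h => ⟨_, _, .skip _, h⟩

@[simp] theorem wp_assign : wp B (x ::= e) Q σ ↔ e.Safe B σ ∧ Q (e.cost + 2) (σ.set x (e.eval σ)) := by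
  constructor
  · rintro ⟨_, _, ⟨⟩, h⟩
    exact ⟨‹_›, h⟩
  · exact fun h => ⟨_, _, .assign _ _ _ h.1, h.2⟩

@[simp] theorem wp_put : wp B (.put j e f g) Q σ ↔ (j < 32 ∧ σ.var 0 = B ∧ e.Safe B σ ∧ f.Safe B σ ∧
    g.Safe B σ ∧ e.eval σ < B ∧ f.eval σ < B) ∧
      Q (e.cost + f.cost + g.cost + 8) (σ.put j (e.eval σ) (f.eval σ) (g.eval σ)) := by
  constructor
  · rintro ⟨_, _, ⟨⟩, h⟩
    exact ⟨⟨‹_›, ‹_›, ‹_›, ‹_›, ‹_›, ‹_›, ‹_›⟩, h⟩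
  · rintro ⟨⟨h1, h2, h3, h4, h5, h6, h7⟩, h⟩
    exact ⟨_, _, .put _ _ _ _ _ h1 h2 h3 h4 h5 h6 h7, h⟩

@[simp] theorem wp_out : wp B (.out e f) Q σ ↔ (e.Safe B σ ∧ f.Safe B σ ∧ e.eval σ < B) ∧
    Q (e.cost + f.cost + 1) (σ.out (e.eval σ) (f.eval σ)) := by
  constructor
  · rintro ⟨_, _, ⟨⟩, h⟩
    exact ⟨⟨‹_›, ‹_›, ‹_›⟩, h⟩
  · rintro ⟨⟨h1, h2, h3⟩, h⟩
    exact ⟨_, _, .out _ _ _ h1 h2 h3, h⟩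

@[simp] theorem wp_seq : wp B (c ;; d) Q σ ↔
    wp B c (fun t τ => wp B d (fun t' τ' => Q (t + t') τ') τ) σ := by
  constructor
  · rintro ⟨_, _, ⟨⟩, h⟩
    exact ⟨_, _, ‹_›, _, _, ‹_›, h⟩
  · rintro ⟨t, τ, h, t', τ', h', hQ⟩
    exact ⟨_, _, .seq h h', hQ⟩

@[simp] theorem wp_ite : wp B (.ite e c d) Q σ ↔ e.Safe B σ ∧
    (e.eval σ ≠ 0 → wp B c (fun t τ => Q (e.cost + 2 + t) τ) σ) ∧
    (e.eval σ = 0 → wp B d (fun t τ => Q (e.cost + 1 + t) τ) σ) := by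
  constructor
  · rintro ⟨_, _, h, hQ⟩
    cases h with
    | iteTrue he h hc => exact ⟨he, fun _ => ⟨_, _, hc, hQ⟩, fun h' => absurd h' h⟩
    | iteFalse he h hc => exact ⟨he, fun h' => absurd h h', fun _ => ⟨_, _, hc, hQ⟩⟩
  · rintro ⟨he, h1, h2⟩
    by_cases h : e.eval σ = 0
    · obtain ⟨t, τ, hc, hQ⟩ := h2 h
      exact ⟨_, _, .iteFalse he h hc, hQ⟩
    · obtain ⟨t, τ, hc, hQ⟩ := h1 h
      exact ⟨_, _, .iteTrue he h hc, hQ⟩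

/-- `for x < e do c`, where `y` holds the bound. -/
def Cmd.forTo (x y : ℕ) (e : Expr) (c : Cmd) : Cmd :=
  y ::= e ;; x ::= 0 ;; .loop (.var y - .var x) (c ;; x ::= .var x + 1)

/-- Besides its body, an iteration costs `13`: the successful test takes `7` steps and the increment
`6`. The last, failing test takes `6`. Thus `s` is the time spent in the bodies alone. The property
`F` is meant for the frame condition relative to the state before the loop. -/
theorem wp_loop_range {N : ℕ} (I : ℕ → ℕ → Env → Prop) (hxy : x ≠ y) (hcx : c.modVar x = false)
    (hcy : c.modVar y = false) (hNB : N + 1 < B) (F : Env → Prop)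
    (hF : ∀ τ τ', F τ → Frame (c ;; x ::= .var x + 1) τ τ' → F τ')
    (step : ∀ i < N, ∀ t τ, τ.var x = i → τ.var y = N → F τ → I i t τ →
      wp B c (fun t' τ' => I (i + 1) (t + t') (τ'.set x (i + 1))) τ)
    (i : ℕ) (hi : i ≤ N) (t : ℕ) (τ : Env) (hx : τ.var x = i) (hy : τ.var y = N) (hFτ : F τ)
    (hI : I i t τ) :
    wp B (.loop (.var y - .var x) (c ;; x ::= .var x + 1))
      (fun t' τ' => ∃ s, t' + 13 * i + t = s + 13 * N + 6 ∧ I N s τ' ∧ τ'.var x = N) τ := by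
  induction h : N - i generalizing i t τ with
  | zero =>
    obtain rfl : i = N := by omega
    exact ⟨_, _, .loopDone (by simp) (by simp [hx, hy]), t, by simp; omega, hI, hx⟩
  | succ k ih =>
    obtain ⟨t', τ', hc, hI'⟩ := step i (by omega) t τ hx hy hFτ hI
    have fr := hc.frame
    have hx' : τ'.var x = i := by rw [fr.var x hcx, hx]
    have ha : Exec B (x ::= .var x + 1) τ' 6 (τ'.set x (i + 1)) := by
      have := Exec.assign (B := B) τ' x (.var x + 1) (by simp [hx']; omega)
      simpa [hx'] using this
    have hs := hc.seq ha
    obtain ⟨s, τ'', hl, r, hr, hQ⟩ := ih (i + 1) (by omega) _ _ (by simp)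
      (by simp [hxy.symm, fr.var y hcy, hy]) (hF _ _ hFτ hs.frame) hI' (by omega)
    refine ⟨_, _, .loopStep (by simp) (by simp [hx, hy]; omega) hs hl, r, ?_, hQ⟩
    simp only [cost_sub, cost_var]
    omega

/-- The invariant sees the time used by the bodies so far, which permits amortised bounds when the
cost of an iteration depends on the data. The `11` consists of `2` and `3` for the two initial
assignments and `6` for the last test. -/
theorem wp_forTo (I : ℕ → ℕ → Env → Prop) (N : ℕ) (hxy : x ≠ y) (hcx : c.modVar x = false)
    (hcy : c.modVar y = false) (hNB : N + 1 < B) (he : e.Safe B σ) (hN : e.eval σ = N)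
    (init : I 0 0 ((σ.set y N).set x 0))
    (step : ∀ i < N, ∀ t τ, τ.var x = i → τ.var y = N → Frame (.forTo x y e c) σ τ → I i t τ →
      wp B c (fun t' τ' => I (i + 1) (t + t') (τ'.set x (i + 1))) τ)
    (post : ∀ t τ, I N t τ → Frame (.forTo x y e c) σ τ → Q (e.cost + 11 + 13 * N + t) τ) :
    wp B (.forTo x y e c) Q σ := by
  have h1 : Exec B (y ::= e) σ (e.cost + 2) (σ.set y N) := hN ▸ .assign _ _ _ he
  have h2 : Exec B (x ::= 0) (σ.set y N) 3 ((σ.set y N).set x 0) :=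
    .assign _ _ _ (by simp; omega)
  have hf : Frame (.forTo x y e c) σ ((σ.set y N).set x 0) :=
    h1.frame.trans h2.frame (by simp +contextual [Cmd.modVar, Cmd.forTo])
      (by simp +contextual [Cmd.modArr]) (by simp +contextual [Cmd.modCell])
  obtain ⟨t, τ, hl, s, hs, hI, -⟩ := wp_loop_range I hxy hcx hcy hNB (Frame (.forTo x y e c) σ)
    (fun τ τ' h h' => h.trans h' (by simp +contextual [Cmd.modVar, Cmd.forTo])
      (by simp +contextual [Cmd.modArr, Cmd.forTo]) (by simp +contextual [Cmd.modCell, Cmd.forTo]))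
    step 0 (Nat.zero_le _) 0 _ (by simp) (by simp [hxy.symm]) hf init
  have hall : Exec B (.forTo x y e c) σ _ τ := h1.seq (h2.seq hl)
  refine ⟨_, _, hall, ?_⟩
  convert post s τ hI hall.frame using 1
  omega

/-- The rule for loops with a uniform bound on the time of an iteration. -/
theorem wp_for (I : ℕ → Env → Prop) (N T : ℕ) (hxy : x ≠ y) (hcx : c.modVar x = false)
    (hcy : c.modVar y = false) (hNB : N + 1 < B) (he : e.Safe B σ) (hN : e.eval σ = N)
    (init : I 0 ((σ.set y N).set x 0))
    (step : ∀ i < N, ∀ τ, τ.var x = i → τ.var y = N → Frame (.forTo x y e c) σ τ → I i τ →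
      wp B c (fun t τ' => t ≤ T ∧ I (i + 1) (τ'.set x (i + 1))) τ)
    (post : ∀ t τ, t ≤ e.cost + 11 + N * (T + 13) → I N τ → Frame (.forTo x y e c) σ τ → Q t τ) :
    wp B (.forTo x y e c) Q σ := by
  refine wp_forTo (fun i t τ => t ≤ i * T ∧ I i τ) N hxy hcx hcy hNB he hN ⟨by simp, init⟩ ?_ ?_
  · intro i hi t τ hx hy hf hI
    refine (step i hi τ hx hy hf hI.2).mono fun t' τ' h _ => ⟨?_, h.2⟩
    linarith [hI.1, h.1]
  · intro t τ hI hf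
    refine post _ _ ?_ hI.2 hf
    linarith [hI.1]

end Loop

/-! ### Counting along an elimination ordering -/

namespace Elim

/-- The vertices of a graph are `0, …, n - 1`, and `A` is its reflexive adjacency relation. To every
vertex `i` belongs a set `S i` of smaller vertices that contains its smaller neighbours, so that
these sets define a chordal graph. -/
structure IsElimination (n : ℕ) (A : ℕ → ℕ → Prop) (S : ℕ → Finset ℕ) : Prop where
  refl : ∀ i < n, A i i
  symm : ∀ i j, A i j → A j i
  lt_of_adj : ∀ i j, A i j → i < n
  lt : ∀ i < n, ∀ j ∈ S i, j < i
  mem_of_adj : ∀ i j, A i j → j < i → j ∈ S i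
  chordal : ∀ i < n, ∀ j ∈ S i, ∀ j' ∈ S i, j < j' → j ∈ S j'

/-- The set `S i` together with `i` itself. -/
def bag (S : ℕ → Finset ℕ) (i : ℕ) : Finset ℕ := insert i (S i)

/-- The parent of a vertex in the elimination tree. -/
def par (S : ℕ → Finset ℕ) (i : ℕ) : ℕ := (S i).sup id

/-- `c` is a child of `i` in the elimination tree. -/
def Child (S : ℕ → Finset ℕ) (c i : ℕ) : Prop := (S c).Nonempty ∧ par S c = i

/-- `u` is a descendant of `i`, or `i` itself. -/
def Desc (S : ℕ → Finset ℕ) (i u : ℕ) : Prop := Relation.ReflTransGen (Child S) u i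

/-- `u` has a neighbour in `X` whose colour belongs to the set encoded by `M`. -/
def Hit (A : ℕ → ℕ → Prop) (col : ℕ → ℕ) (X : Finset ℕ) (u M : ℕ) : Prop :=
  ∃ z ∈ X, A u z ∧ M.testBit (col z)

open Classical in
/-- The number of descendants of `i` that hit the colour set `M` in `S i`. -/
noncomputable def up (n : ℕ) (A : ℕ → ℕ → Prop) (S : ℕ → Finset ℕ) (col : ℕ → ℕ) (i M : ℕ) : ℕ :=
  ((Finset.range n).filter fun u => Desc S i u ∧ Hit A col (S i) u M).card

open Classical in
/-- The number of vertices neither in `S i` nor below it that hit the colour set `M` in `S i`. -/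
noncomputable def down (n : ℕ) (A : ℕ → ℕ → Prop) (S : ℕ → Finset ℕ) (col : ℕ → ℕ) (i M : ℕ) : ℕ :=
  ((Finset.range n).filter fun u => ¬ Desc S i u ∧ u ∉ S i ∧ Hit A col (S i) u M).card

open Classical in
/-- The number of vertices outside the bag of `i` that hit the colour set `M` in this bag. -/
noncomputable def total (n : ℕ) (A : ℕ → ℕ → Prop) (S : ℕ → Finset ℕ) (col : ℕ → ℕ) (i M : ℕ) : ℕ :=
  ((Finset.range n).filter fun u => u ∉ bag S i ∧ Hit A col (bag S i) u M).card

/-- Distance at most two. -/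
def Near (A : ℕ → ℕ → Prop) (a b : ℕ) : Prop := ∃ z, A a z ∧ A z b

/-- The two vertices lie in a common bag and have distance at most two. -/
def LocalNear (n : ℕ) (A : ℕ → ℕ → Prop) (S : ℕ → Finset ℕ) (a b : ℕ) : Prop :=
  ∃ x < n, ∃ z ∈ bag S x, a ∈ bag S x ∧ b ∈ bag S x ∧ A a z ∧ A z b

/-- `col` is a proper colouring of every bag. -/
def Proper (n : ℕ) (S : ℕ → Finset ℕ) (col : ℕ → ℕ) : Prop :=
  ∀ i < n, ∀ z ∈ bag S i, ∀ z' ∈ bag S i, col z = col z' → z = z'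

variable {n : ℕ} {A : ℕ → ℕ → Prop} {S : ℕ → Finset ℕ} {col : ℕ → ℕ}

theorem par_mem {c : ℕ} (h : (S c).Nonempty) : par S c ∈ S c := by
  obtain ⟨a, ha, h'⟩ := Finset.exists_mem_eq_sup (S c) h id
  rw [par, h']
  exact ha

theorem Child.mem {c i : ℕ} (h : Child S c i) : i ∈ S c := h.2 ▸ par_mem h.1

theorem le_par {c j : ℕ} (h : j ∈ S c) : j ≤ par S c := Finset.le_sup (f := id) h

theorem Child.unique {c i j : ℕ} (h : Child S c i) (h' : Child S c j) : i = j := h.2 ▸ h'.2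

theorem mem_bag {i j : ℕ} : j ∈ bag S i ↔ j = i ∨ j ∈ S i := by simp [bag]

theorem mem_bag_self (i : ℕ) : i ∈ bag S i := by simp [bag]

/-- By `chordal`, the smaller of two elements of a bag belongs to the set of the larger one. So it
suffices that each vertex differs in colour from its own set, which is what greedy colouring
provides. -/
theorem proper_of_ne (hE : IsElimination n A S) (h : ∀ i < n, ∀ j ∈ S i, col j ≠ col i) :
    Proper n S col := by
  have key : ∀ i < n, ∀ z ∈ bag S i, ∀ z' ∈ bag S i, z < z' → col z ≠ col z' := by
    intro i hi z hz z' hz' hlt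
    rcases mem_bag.1 hz' with rfl | hz'
    · rcases mem_bag.1 hz with rfl | hz
      · omega
      · exact h _ hi _ hz
    · have hz'i := hE.lt i hi z' hz'
      rcases mem_bag.1 hz with rfl | hz
      · omega
      · exact h _ (by omega) _ (hE.chordal i hi z hz z' hz' hlt)
  intro i hi z hz z' hz' hc
  rcases lt_trichotomy z z' with h' | h' | h'
  · exact absurd hc (key i hi z hz z' hz' h')
  · exact h'
  · exact absurd hc.symm (key i hi z' hz' z hz h')

/-! ### The elimination tree and its separators. -/

section
variable (hE : IsElimination n A S)
include hE

theorem Child.lt {c i : ℕ} (hc : c < n) (h : Child S c i) : i < c := hE.lt c hc _ h.mem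

theorem Desc.le {i u : ℕ} (hu : u < n) (h : Desc S i u) : i ≤ u := by
  induction h using Relation.ReflTransGen.head_induction_on with
  | refl => exact le_rfl
  | head h _ ih =>
    have := h.lt hE hu
    exact (ih (by omega)).trans this.le

/-- Elements of `S u` other than the parent belong to the set of the parent. -/
theorem mem_of_child {c i j : ℕ} (hc : c < n) (h : Child S c i) (hj : j ∈ S c) :
    j = i ∨ j ∈ S i := by
  rcases (le_par hj).eq_or_lt with h' | h'
  · left; rw [h', h.2]
  · right
    rw [h.2] at h'
    exact hE.chordal c hc j hj i h.mem h'

theorem subset_bag {c i : ℕ} (hc : c < n) (h : Child S c i) : S c ⊆ bag S i :=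
  fun _ hj => mem_bag.2 (mem_of_child hE hc h hj)

/-- An element of `S u` is the parent of `u` or is inherited by the set of the parent, so climbing
from `u` eventually meets it. -/
theorem desc_of_mem {u j : ℕ} (hu : u < n) (hj : j ∈ S u) : Desc S j u := by
  induction u using Nat.strong_induction_on with
  | _ u ih =>
    have hc : Child S u (par S u) := ⟨⟨j, hj⟩, rfl⟩
    rcases mem_of_child hE hu hc hj with h | h
    · rw [h]; exact .single hc
    · have := hc.lt hE hu
      exact .head hc (ih _ this (by omega) h)

/-- On the way from `u` up to `i`, the element `j` is inherited from set to set, unless the path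
meets `j` itself, which is then below `i`. -/
theorem mem_or_desc {i u j : ℕ} (hu : u < n) (h : Desc S i u) (hj : j ∈ S u) :
    j ∈ S i ∨ Desc S i j := by
  induction h using Relation.ReflTransGen.head_induction_on with
  | refl => exact .inl hj
  | head h h' ih =>
    have := h.lt hE hu
    rcases mem_of_child hE hu h hj with rfl | hj
    · exact .inr h'
    · exact ih (by omega) hj

/-- This is the separation property of `S i`. A smaller neighbour of `u` lies in `S u`, and
`mem_or_desc` applies; a larger one has `u` in its set and therefore lies below `u`. -/
theorem mem_or_desc_of_adj {i u z : ℕ} (h : Desc S i u) (hz : A u z) :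
    z ∈ S i ∨ Desc S i z := by
  have hu := hE.lt_of_adj _ _ hz
  have hz' := hE.lt_of_adj _ _ (hE.symm _ _ hz)
  rcases lt_trichotomy z u with h' | rfl | h'
  · exact mem_or_desc hE hu h (hE.mem_of_adj _ _ hz h')
  · exact .inr h
  · have := desc_of_mem hE hz' (hE.mem_of_adj _ _ (hE.symm _ _ hz) h')
    exact .inr (this.trans h)

omit hE in
theorem desc_total {a b u : ℕ} (ha : Desc S a u) (hb : Desc S b u) : Desc S b a ∨ Desc S a b :=
  Relation.ReflTransGen.total_of_right_unique (fun _ _ _ h h' => Child.unique h h') ha hb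

omit hE in
theorem Desc.eq_or {i u : ℕ} (h : Desc S i u) : u = i ∨ ∃ c, Child S c i ∧ Desc S c u := by
  rcases Relation.ReflTransGen.cases_tail h with h | ⟨c, h, h'⟩
  · exact .inl h.symm
  · exact .inr ⟨c, h', h⟩

theorem Desc.lt_of_child {c i u : ℕ} (hu : u < n) (hc : Child S c i) (h : Desc S c u) : i < u := by
  have := Desc.le hE hu h
  have := hc.lt hE (by omega)
  omega

/-- Ancestors of `u` are comparable. If `c'` were strictly below `c`, its parent `i` would be `c` or
lie below `c`, although `i < c`. -/
theorem child_unique {c c' i u : ℕ} (hu : u < n) (hc : Child S c i) (hc' : Child S c' i)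
    (h : Desc S c u) (h' : Desc S c' u) : c = c' := by
  have key : ∀ c c', Child S c i → Child S c' i → Desc S c u → Desc S c' u → Desc S c c' →
      c = c' := by
    intro c c' hc hc' h h' hd
    have h1 := Desc.le hE hu h
    have h2 := Desc.le hE hu h'
    rcases Relation.ReflTransGen.cases_head hd with h3 | ⟨d, h3, h4⟩
    · exact h3.symm
    · obtain rfl := h3.unique hc'
      have := Desc.le hE (by have := hc'.lt hE (by omega); omega) h4
      have := hc.lt hE (by omega)
      omega
  rcases desc_total h h' with h3 | h3
  · exact (key c' c hc' hc h' h h3).symm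
  · exact key c c' hc hc' h h' h3

/-- A descendant of a child `c` of `i` meets the bag of `i` in `S c` only. -/
theorem mem_of_adj_bag {c i u z : ℕ} (hu : u < n) (hc : Child S c i) (h : Desc S c u)
    (hz : A u z) (hzi : z ∈ bag S i) : z ∈ S c := by
  rcases mem_or_desc_of_adj hE h hz with h' | h'
  · exact h'
  · exfalso
    have hz' := hE.lt_of_adj _ _ (hE.symm _ _ hz)
    have h1 := Desc.lt_of_child hE hz' hc h'
    have h2 := Desc.lt_of_child hE hu hc h
    rcases mem_bag.1 hzi with rfl | h3
    · omega
    · have := hE.lt i (by omega) z h3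
      omega

theorem hit_bag_iff {c i u M : ℕ} (hu : u < n) (hc : Child S c i) (h : Desc S c u) :
    Hit A col (bag S i) u M ↔ Hit A col (S c) u M := by
  constructor
  · rintro ⟨z, hz, ha, hM⟩
    exact ⟨z, mem_of_adj_bag hE hu hc h ha hz, ha, hM⟩
  · rintro ⟨z, hz, ha, hM⟩
    have := Desc.le hE hu h
    exact ⟨z, subset_bag hE (by omega) hc hz, ha, hM⟩

/-! ### Recurrences for the tables. -/

open Classical in
/-- Proper descendants of `i` are counted by the children of `i`. -/
theorem card_desc (p : ℕ → Prop) (i : ℕ) :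
    ((Finset.range n).filter fun u => (Desc S i u ∧ u ≠ i) ∧ p u).card =
      ∑ c ∈ (Finset.range n).filter fun c => Child S c i,
        ((Finset.range n).filter fun u => Desc S c u ∧ p u).card := by
  rw [← Finset.card_biUnion]
  · congr 1
    ext u
    simp only [Finset.mem_filter, Finset.mem_range, Finset.mem_biUnion]
    constructor
    · rintro ⟨hu, ⟨h, hne⟩, hp⟩
      rcases h.eq_or with h | ⟨c, hc, h⟩
      · exact absurd h hne
      · have := Desc.le hE hu h
        exact ⟨c, ⟨by omega, hc⟩, hu, h, hp⟩
    · rintro ⟨c, ⟨-, hc⟩, hu, h, hp⟩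
      have := Desc.lt_of_child hE hu hc h
      exact ⟨hu, ⟨h.tail hc, by omega⟩, hp⟩
  · intro c hc c' hc' hne
    simp only [Finset.coe_filter, Finset.mem_range, Set.mem_ofPred_eq] at hc hc'
    rw [Function.onFun, Finset.disjoint_left]
    intro u hu hu'
    simp only [Finset.mem_filter, Finset.mem_range] at hu hu'
    exact hne (child_unique hE hu.1 hc.2 hc'.2 hu.2.1 hu'.2.1)

-- A descendant of `i` is `i` or lies below exactly one child `c`. For a vertex below `c`, all
-- neighbours in `S i` lie in `S c`, and the only element of `S c` that may be outside `S i` is `i`;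
-- deleting the colour of `i` from the mask excludes it.
open Classical in
theorem up_eq (hcol : Proper n S col) {i M M' : ℕ} (hi : i < n)
    (hM : ∀ c, M'.testBit c = true ↔ M.testBit c = true ∧ c ≠ col i) :
    up n A S col i M = (∑ c ∈ (Finset.range n).filter fun c => Child S c i, up n A S col c M') +
      if Hit A col (S i) i M then 1 else 0 := by
  have h1 : up n A S col i M = ((Finset.range n).filter fun u =>
      (Desc S i u ∧ u ≠ i) ∧ Hit A col (S i) u M).card +
      ((Finset.range n).filter fun u => u = i ∧ Hit A col (S i) u M).card := by
    rw [up, ← Finset.card_union_of_disjoint]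
    · congr 1
      ext u
      simp only [Finset.mem_filter, Finset.mem_range, Finset.mem_union]
      by_cases hu : u = i
      · subst hu
        simp [Desc, Relation.ReflTransGen.refl]
      · simp [hu]
    · rw [Finset.disjoint_left]
      simp only [Finset.mem_filter]
      tauto
  rw [h1, card_desc hE]
  congr 1
  · refine Finset.sum_congr rfl fun c hc => ?_
    simp only [Finset.mem_filter, Finset.mem_range] at hc
    rw [up]
    congr 1
    refine Finset.filter_congr fun u hu => and_congr_right fun h => ?_
    rw [Finset.mem_range] at hu
    constructor
    · rintro ⟨z, hz, ha, hb⟩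
      have hzi : z ∈ bag S i := mem_bag.2 (.inr hz)
      refine ⟨z, mem_of_adj_bag hE hu hc.2 h ha hzi, ha, (hM _).2 ⟨hb, fun h' => ?_⟩⟩
      have := hcol i hi z hzi i (mem_bag_self i) h'
      have := hE.lt i hi z hz
      omega
    · rintro ⟨z, hz, ha, hb⟩
      rw [hM] at hb
      rcases mem_of_child hE hc.1 hc.2 hz with rfl | hz
      · exact absurd rfl hb.2
      · exact ⟨z, hz, ha, hb.1⟩
  · by_cases h : Hit A col (S i) i M
    · rw [if_pos h, Finset.card_eq_one]
      refine ⟨i, ?_⟩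
      ext u
      simp only [Finset.mem_filter, Finset.mem_range, Finset.mem_singleton]
      constructor
      · exact fun h => h.2.1
      · rintro rfl
        exact ⟨hi, rfl, h⟩
    · rw [if_neg h, Finset.card_eq_zero, Finset.filter_eq_empty_iff]
      rintro u - ⟨rfl, h'⟩
      exact h h'

-- A vertex outside the bag lies below a child of `i`, or it is neither below `i` nor in `S i`. In
-- the second case it is not adjacent to `i`, so the colour of `i` may be deleted from the mask.
open Classical in
theorem total_eq (hcol : Proper n S col) {i M M' : ℕ} (hi : i < n)
    (hM : ∀ c, M'.testBit c = true ↔ M.testBit c = true ∧ c ≠ col i) :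
    total n A S col i M = (∑ c ∈ (Finset.range n).filter fun c => Child S c i, up n A S col c M) +
      down n A S col i M' := by
  have h1 : total n A S col i M = ((Finset.range n).filter fun u =>
      (Desc S i u ∧ u ≠ i) ∧ Hit A col (bag S i) u M).card +
      ((Finset.range n).filter fun u => (¬ Desc S i u ∧ u ∉ S i) ∧ Hit A col (bag S i) u M).card
      := by
    rw [total, ← Finset.card_union_of_disjoint]
    · congr 1
      ext u
      simp only [Finset.mem_filter, Finset.mem_range, Finset.mem_union, mem_bag, not_or]
      have h2 : u < n → Desc S i u → u ∉ S i := by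
        intro hu h h'
        have := Desc.le hE hu h
        have := hE.lt i hi u h'
        omega
      have h3 : ¬ Desc S i u → u ≠ i := by
        rintro h rfl
        exact h .refl
      tauto
    · rw [Finset.disjoint_left]
      simp only [Finset.mem_filter]
      tauto
  rw [h1, card_desc hE]
  congr 1
  · refine Finset.sum_congr rfl fun c hc => ?_
    simp only [Finset.mem_filter, Finset.mem_range] at hc
    rw [up]
    congr 1
    refine Finset.filter_congr fun u hu => and_congr_right fun h => ?_
    exact hit_bag_iff hE (Finset.mem_range.1 hu) hc.2 h
  · rw [down]
    congr 1
    refine Finset.filter_congr fun u hu => ?_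
    rw [Finset.mem_range] at hu
    rw [and_assoc]
    refine and_congr_right fun h => and_congr_right fun h' => ?_
    constructor
    · rintro ⟨z, hz, ha, hb⟩
      rcases mem_bag.1 hz with rfl | hz'
      · exfalso
        rcases mem_or_desc_of_adj hE (i := z) .refl (hE.symm _ _ ha) with h'' | h''
        · exact h' h''
        · exact h h''
      · refine ⟨z, hz', ha, (hM _).2 ⟨hb, fun h' => ?_⟩⟩
        have := hcol i hi z hz i (mem_bag_self i) h'
        have := hE.lt i hi z hz'
        omega
    · rintro ⟨z, hz, ha, hb⟩
      exact ⟨z, mem_bag.2 (.inr hz), ha, ((hM _).1 hb).1⟩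

-- Both sides count the vertices outside `S i` that hit the mask in `S i`. As `p ∈ S i`, such a
-- vertex is outside the bag of `p` or belongs to `S p`, but not to `S i`. Restricting the mask to
-- the colours of `S i` makes the table of `p`, which concerns its whole bag, answer for `S i`
-- alone; here the colouring of that bag must be proper.
open Classical in
theorem down_add_up (hcol : Proper n S col) {i p M M' : ℕ} (hi : i < n) (hp : Child S i p)
    (hM : ∀ c, M'.testBit c = true ↔ M.testBit c = true ∧ ∃ z ∈ S i, col z = c) :
    down n A S col i M + up n A S col i M = total n A S col p M' +
      ((S p).filter fun u => u ∉ S i ∧ Hit A col (S i) u M).card := by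
  have hpn : p < n := (hp.lt hE hi).trans hi
  have h1 : down n A S col i M + up n A S col i M =
      ((Finset.range n).filter fun u => u ∉ S i ∧ Hit A col (S i) u M).card := by
    rw [up, down, ← Finset.card_union_of_disjoint]
    · congr 1
      ext u
      simp only [Finset.mem_filter, Finset.mem_range, Finset.mem_union]
      have h2 : u < n → Desc S i u → u ∉ S i := by
        intro hu h h'
        have := Desc.le hE hu h
        have := hE.lt i hi u h'
        omega
      tauto
    · rw [Finset.disjoint_left]
      simp only [Finset.mem_filter]
      tauto
  have h2 : ∀ u, Hit A col (bag S p) u M' ↔ Hit A col (S i) u M := by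
    intro u
    constructor
    · rintro ⟨z, hz, ha, hb⟩
      obtain ⟨hb, z', hz', hc⟩ := (hM _).1 hb
      obtain rfl := hcol p hpn z' (subset_bag hE hi hp hz') z hz hc
      exact ⟨z', hz', ha, hb⟩
    · rintro ⟨z, hz, ha, hb⟩
      exact ⟨z, subset_bag hE hi hp hz, ha, (hM _).2 ⟨hb, z, hz, rfl⟩⟩
  rw [h1, total, ← Finset.card_union_of_disjoint]
  · congr 1
    ext u
    simp only [Finset.mem_filter, Finset.mem_range, Finset.mem_union, mem_bag, h2]
    have h3 : u ∈ S p → u < n := fun h => (hE.lt p hpn u h).trans hpn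
    have h4 : u = p → u ∈ S i := by rintro rfl; exact hp.mem
    have h5 : u ∈ S i → u = p ∨ u ∈ S p := mem_of_child hE hi hp
    tauto
  · rw [Finset.disjoint_left]
    simp only [Finset.mem_filter, mem_bag]
    tauto

/-- The two vertices and a common neighbour are pairwise equal or related by `S`, so the bag of the
largest of the three contains the other two. -/
theorem localNear_of_near {a b : ℕ} (h : Near A a b) (hab : a ∈ S b ∨ b ∈ S a ∨ a = b) :
    LocalNear n A S a b := by
  obtain ⟨z, haz, hzb⟩ := h
  have ha := hE.lt_of_adj _ _ haz
  have hb := hE.lt_of_adj _ _ (hE.symm _ _ hzb)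
  have hz := hE.lt_of_adj _ _ hzb
  have fill : ∀ {x y}, A x y → x = y ∨ x ∈ S y ∨ y ∈ S x := by
    intro x y h
    rcases lt_trichotomy x y with h' | h' | h'
    · exact .inr (.inl (hE.mem_of_adj _ _ (hE.symm _ _ h) h'))
    · exact .inl h'
    · exact .inr (.inr (hE.mem_of_adj _ _ h h'))
  have conv : ∀ {x y}, x < n → y ≤ x → (x = y ∨ x ∈ S y ∨ y ∈ S x) → y < n → y ∈ bag S x := by
    intro x y hx hle h hy
    rcases h with rfl | h | h
    · exact mem_bag_self _
    · have := hE.lt y hy x h; omega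
    · exact mem_bag.2 (.inr h)
  have sw : ∀ {x y}, (x = y ∨ x ∈ S y ∨ y ∈ S x) → (y = x ∨ y ∈ S x ∨ x ∈ S y) := by
    intro x y h
    rcases h with h | h | h
    · exact .inl h.symm
    · exact .inr (.inr h)
    · exact .inr (.inl h)
  have hab : a = b ∨ a ∈ S b ∨ b ∈ S a := by
    rcases hab with h | h | h
    · exact .inr (.inl h)
    · exact .inr (.inr h)
    · exact .inl h
  by_cases h1 : z ≤ a ∧ b ≤ a
  · exact ⟨a, ha, z, conv ha h1.1 (fill haz) hz, mem_bag_self _, conv ha h1.2 hab hb, haz, hzb⟩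
  by_cases h2 : z ≤ b ∧ a ≤ b
  · exact ⟨b, hb, z, conv hb h2.1 (sw (fill hzb)) hz, conv hb h2.2 (sw hab) ha, mem_bag_self _,
      haz, hzb⟩
  exact ⟨z, hz, z, mem_bag_self _, conv hz (by omega) (sw (fill haz)) ha,
    conv hz (by omega) (fill hzb) hb, haz, hzb⟩

theorem fill_of_mem_bag {x a b : ℕ} (hx : x < n) (ha : a ∈ bag S x) (hb : b ∈ bag S x) :
    a ∈ S b ∨ b ∈ S a ∨ a = b := by
  rcases lt_trichotomy a b with h | h | h
  · left
    rcases mem_bag.1 hb with rfl | hb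
    · rcases mem_bag.1 ha with rfl | ha
      · omega
      · exact ha
    · rcases mem_bag.1 ha with rfl | ha
      · have := hE.lt _ hx _ hb; omega
      · exact hE.chordal x hx a ha b hb h
  · exact .inr (.inr h)
  · right; left
    rcases mem_bag.1 ha with rfl | ha
    · rcases mem_bag.1 hb with rfl | hb
      · omega
      · exact hb
    · rcases mem_bag.1 hb with rfl | hb
      · have := hE.lt _ hx _ ha; omega
      · exact hE.chordal x hx b hb a ha h

/-! ### Counting the pairs without a common bag. -/

/-- A vertex below `i` and a vertex that is neither below `i` nor in `S i` can have common
neighbours in `S i` only. -/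
theorem near_iff_hit (hcol : Proper n S col) {i u v M : ℕ} (hi : i < n) (hu : Desc S i u)
    (hv : ¬ Desc S i v) (hv' : v ∉ S i)
    (hM : ∀ c, M.testBit c = true ↔ ∃ z ∈ S i, A v z ∧ col z = c) :
    Near A v u ↔ Hit A col (S i) u M := by
  constructor
  · rintro ⟨z, hvz, hzu⟩
    rcases mem_or_desc_of_adj hE hu (hE.symm _ _ hzu) with h | h
    · exact ⟨z, h, hE.symm _ _ hzu, (hM _).2 ⟨z, h, hvz, rfl⟩⟩
    · rcases mem_or_desc_of_adj hE h (hE.symm _ _ hvz) with h' | h'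
      · exact absurd h' hv'
      · exact absurd h' hv
  · rintro ⟨z, hz, huz, hb⟩
    obtain ⟨z', hz', hvz', hc⟩ := (hM _).1 hb
    obtain rfl := hcol i hi z' (mem_bag.2 (.inr hz')) z (mem_bag.2 (.inr hz)) hc
    exact ⟨z', hvz', hE.symm _ _ huz⟩

/-- The mirror image of `near_iff_hit`: the vertex whose neighbours define the mask is now the one
below `i`. -/
theorem near_iff_hit' (hcol : Proper n S col) {i u v M : ℕ} (hi : i < n) (hv : Desc S i v)
    (hu : ¬ Desc S i u) (hu' : u ∉ S i)
    (hM : ∀ c, M.testBit c = true ↔ ∃ z ∈ S i, A v z ∧ col z = c) :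
    Near A v u ↔ Hit A col (S i) u M := by
  constructor
  · rintro ⟨z, hvz, hzu⟩
    rcases mem_or_desc_of_adj hE hv hvz with h | h
    · exact ⟨z, h, hE.symm _ _ hzu, (hM _).2 ⟨z, h, hvz, rfl⟩⟩
    · rcases mem_or_desc_of_adj hE h hzu with h' | h'
      · exact absurd h' hu'
      · exact absurd h' hu
  · rintro ⟨z, hz, huz, hb⟩
    obtain ⟨z', hz', hvz', hc⟩ := (hM _).1 hb
    obtain rfl := hcol i hi z' (mem_bag.2 (.inr hz')) z (mem_bag.2 (.inr hz)) hc
    exact ⟨z', hvz', hE.symm _ _ huz⟩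

/-- `i` has parent `p`, and `v` belongs to the set of `p`, but not to that of `i`. -/
def Exits (S : ℕ → Finset ℕ) (v i : ℕ) : Prop :=
  (S i).Nonempty ∧ v ∈ S (par S i) ∧ v ∉ S i

theorem Exits.lt {v i : ℕ} (hi : i < n) (h : Exits S v i) : v < i := by
  have h1 := hE.lt i hi _ (par_mem h.1)
  have := hE.lt _ (h1.trans hi) v h.2.1
  omega

/-- A proper descendant `u` of `v` whose set does not contain `v` lies below exactly one vertex at
which the ascending path from `u` enters the bags that contain `v`. -/
theorem exists_exits {v u : ℕ} (hu : u < n) (h : Desc S v u) (hne : u ≠ v) (hm : v ∉ S u) :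
    ∃ i < n, Exits S v i ∧ Desc S i u := by
  induction h using Relation.ReflTransGen.head_induction_on with
  | refl => exact absurd rfl hne
  | @head u c h h' ih =>
    have hlt := h.lt hE hu
    by_cases hc : v ∈ S c
    · exact ⟨u, hu, ⟨h.1, h.2 ▸ hc, hm⟩, .refl⟩
    · by_cases hcv : c = v
      · exact absurd (hcv ▸ h.mem) hm
      · obtain ⟨i, hi, hx, hd⟩ := ih (by omega) hcv hc
        exact ⟨i, hi, hx, .head h hd⟩

/-- The vertices whose bags contain `v` are connected in the elimination tree. In `mem_or_desc`, the
alternative that `v` lies below `i` is ruled out by `v < i`. -/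
theorem mem_of_desc_of_mem {v i c : ℕ} (hc : c < n) (h : Desc S i c) (hv : v ∈ S c)
    (hvi : v < i) : v ∈ S i := by
  rcases mem_or_desc hE hc h hv with h' | h'
  · exact h'
  · have := Desc.le hE (n := n) (by have := hE.lt c hc v hv; omega) h'
    omega

/-- Two such vertices above `u` are comparable. The parent of the lower one has `v` in its set, and
by `mem_of_desc_of_mem` so has the upper one, contrary to the definition of `Exits`. -/
theorem exits_unique {v u i i' : ℕ} (hu : u < n) (hi : Exits S v i) (hi' : Exits S v i')
    (h : Desc S i u) (h' : Desc S i' u) : i = i' := by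
  have key : ∀ i i', Exits S v i → Exits S v i' → Desc S i u → Desc S i' u → Desc S i i' →
      i = i' := by
    intro i i' hi hi' h h' hd
    have hin := Desc.le hE hu h
    have hin' := Desc.le hE hu h'
    rcases Relation.ReflTransGen.cases_head hd with h3 | ⟨c, h3, h4⟩
    · exact h3.symm
    · have hc : v ∈ S c := h3.2 ▸ hi'.2.1
      have := h3.lt hE (by omega)
      exact absurd (mem_of_desc_of_mem hE (by omega) h4 hc (hi.lt hE (by omega))) hi.2.2
  rcases desc_total h h' with h3 | h3
  · exact (key i' i hi' hi h' h h3).symm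
  · exact key i i' hi hi' h h' h3

open Classical in
/-- The number of vertices at distance at most two, from the tables. -/
theorem card_near (hcol : Proper n S col) {v : ℕ} (hv : v < n) (m : ℕ → ℕ)
    (hm : ∀ i < n, ∀ c, (m i).testBit c = true ↔ ∃ z ∈ S i, A v z ∧ col z = c) :
    ((Finset.range n).filter fun u => Near A v u).card =
      ((Finset.range n).filter fun u => LocalNear n A S v u).card + down n A S col v (m v) +
        ∑ i ∈ (Finset.range n).filter fun i => Exits S v i, up n A S col i (m i) := by
  -- Proper descendants of `v` that share no bag with it, grouped by the exit above them. Since `v <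
  -- i`, the vertex `v` is not below `i`, and `S i` separates the pair.
  have h3 : ((Finset.range n).filter fun u => (Desc S v u ∧ u ≠ v ∧ v ∉ S u) ∧ Near A v u).card =
      ∑ i ∈ (Finset.range n).filter fun i => Exits S v i, up n A S col i (m i) := by
    simp only [up]
    rw [← Finset.card_biUnion]
    · congr 1
      ext u
      simp only [Finset.mem_filter, Finset.mem_range, Finset.mem_biUnion]
      constructor
      · rintro ⟨hu, ⟨h, hne, hmem⟩, hp⟩
        obtain ⟨i, hi, hx, hd⟩ := exists_exits hE hu h hne hmem
        refine ⟨i, ⟨hi, hx⟩, hu, hd, (near_iff_hit hE hcol hi hd ?_ hx.2.2 (hm i hi)).1 hp⟩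
        intro h'
        have := Desc.le hE hv h'
        have := hx.lt hE hi
        omega
      · rintro ⟨i, ⟨hi, hx⟩, hu, h, hp⟩
        have hvi := hx.lt hE hi
        have hiu := Desc.le hE hu h
        have hpar : Child S i (par S i) := ⟨hx.1, rfl⟩
        have hpi := hpar.lt hE hi
        refine ⟨hu, ⟨h.trans (.head hpar (desc_of_mem hE (by omega) hx.2.1)), by omega,
          fun h' => hx.2.2 (mem_of_desc_of_mem hE hu h h' hvi)⟩,
          (near_iff_hit hE hcol hi h ?_ hx.2.2 (hm i hi)).2 hp⟩
        intro h'
        have := Desc.le hE hv h'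
        omega
    · intro c hc c' hc' hne
      simp only [Finset.coe_filter, Finset.mem_range, Set.mem_ofPred_eq] at hc hc'
      rw [Function.onFun, Finset.disjoint_left]
      intro u hu hu'
      simp only [Finset.mem_filter, Finset.mem_range] at hu hu'
      exact hne (exits_unique hE hu.1 hc.2 hc'.2 hu.2.1 hu'.2.1)
  -- Vertices that `S v` separates from `v` itself.
  have h2 : ((Finset.range n).filter fun u => (¬ Desc S v u ∧ u ∉ S v) ∧ Near A v u).card =
      down n A S col v (m v) := by
    rw [down]
    congr 1
    refine Finset.filter_congr fun u hu => ?_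
    rw [and_assoc]
    exact and_congr_right fun h => and_congr_right fun h' =>
      near_iff_hit' hE hcol hv .refl h h' (hm v hv)
  -- The three classes are disjoint because vertices of a common bag are equal or related by `S`,
  -- and they are exhaustive by `localNear_of_near`.
  rw [← h2, ← h3, ← Finset.card_union_of_disjoint, ← Finset.card_union_of_disjoint]
  · congr 1
    ext u
    simp only [Finset.mem_filter, Finset.mem_range, Finset.mem_union]
    constructor
    · rintro ⟨hu, h⟩
      by_cases hf : v ∈ S u ∨ u ∈ S v ∨ v = u
      · exact .inl (.inl ⟨hu, localNear_of_near hE h hf⟩)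
      · by_cases hd : Desc S v u
        · exact .inr ⟨hu, ⟨hd, by tauto, by tauto⟩, h⟩
        · exact .inl (.inr ⟨hu, ⟨hd, by tauto⟩, h⟩)
    · rintro ((⟨hu, x, hx, z, hz, h1, h2, h3, h4⟩ | h) | h)
      · exact ⟨hu, z, h3, h4⟩
      · exact ⟨h.1, h.2.2⟩
      · exact ⟨h.1, h.2.2⟩
  · rw [Finset.disjoint_left]
    simp only [Finset.mem_filter, Finset.mem_range, Finset.mem_union]
    rintro u (⟨hu, x, hx, z, hz, h1, h2, -, -⟩ | h) h'
    · have := fill_of_mem_bag hE hx h1 h2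
      have h5 : u ∈ S v → ¬ Desc S v u := fun h6 h7 => by
        have := hE.lt v hv u h6
        have := Desc.le hE hu h7
        omega
      have := h'.2.1
      tauto
    · tauto
  · rw [Finset.disjoint_left]
    simp only [Finset.mem_filter, Finset.mem_range]
    rintro u ⟨hu, x, hx, z, hz, h1, h2, -, -⟩ h'
    have := fill_of_mem_bag hE hx h1 h2
    have h5 : v ∈ S u → Desc S v u := desc_of_mem hE hu
    have h6 : v = u → Desc S v u := by rintro rfl; exact .refl
    tauto

end

end Elim

/-! ### From a tree decomposition to an elimination ordering -/

namespace Elim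

/-! ### Parents in a tree that is ordered by a traversal. -/

section tree

variable {ι : Type*} {T : SimpleGraph ι} {pos : ι → ℕ} {par : ι → ι}

/-- If every node other than those in position `0` has a neighbour that precedes it, then every edge
of the tree leads from a node to its chosen neighbour. -/
theorem eq_parent_of_adj (hT : T.IsTree) (hpos : Function.Injective pos)
    (hpar : ∀ x, pos x ≠ 0 → T.Adj x (par x) ∧ pos (par x) < pos x) {a b : ι} (hab : T.Adj a b) :
    (b = par a ∧ pos a ≠ 0) ∨ (a = par b ∧ pos b ≠ 0) := by
  by_contra hcon
  rw [not_or] at hcon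
  -- Every edge of a tree is a bridge. If `a` and `b` were not joined by a chosen edge, all chosen
  -- edges would survive the deletion and still connect all nodes, by induction on the position.
  have hb := (SimpleGraph.isAcyclic_iff_forall_adj_isBridge.1 hT.isAcyclic) hab
  rw [SimpleGraph.isBridge_iff] at hb
  set T' := T.deleteEdges {s(a, b)}
  have key : ∀ k, ∀ x y, pos x ≤ k → pos y ≤ k → T'.Reachable x y := by
    intro k
    induction k with
    | zero =>
      intro x y hx hy
      obtain rfl : x = y := hpos (by omega)
      exact .refl _
    | succ k ih =>
      have step : ∀ x, pos x ≤ k + 1 → ∃ x', pos x' ≤ k ∧ T'.Reachable x x' := by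
        intro x hx
        by_cases h : pos x = 0
        · exact ⟨x, by omega, .refl _⟩
        · obtain ⟨h1, h2⟩ := hpar x h
          refine ⟨par x, by omega, SimpleGraph.Adj.reachable ?_⟩
          refine SimpleGraph.deleteEdges_adj.2 ⟨h1, ?_⟩
          intro h3
          rw [Set.mem_singleton_iff, Sym2.eq_iff] at h3
          rcases h3 with ⟨rfl, h3⟩ | ⟨rfl, h3⟩
          · exact hcon.1 ⟨h3.symm, h⟩
          · exact hcon.2 ⟨h3.symm, h⟩
      intro x y hx hy
      obtain ⟨x', hx', hxr⟩ := step x hx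
      obtain ⟨y', hy', hyr⟩ := step y hy
      exact hxr.trans ((ih x' y' hx' hy').trans hyr.symm)
  exact hb (key (max (pos a) (pos b)) a b (le_max_left _ _) (le_max_right _ _))

/-- A connected set of nodes that contains `y` and an earlier node contains the parent of `y`. -/
theorem parent_mem (hT : T.IsTree) (hpos : Function.Injective pos)
    (hpar : ∀ x, pos x ≠ 0 → T.Adj x (par x) ∧ pos (par x) < pos x) {C : Set ι}
    (hC : (T.induce C).Connected) {y z : ι} (hy : y ∈ C) (hz : z ∈ C) (hlt : pos z < pos y) :
    par y ∈ C := by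
  let R : ι → ι → Prop := fun a b => pos a ≠ 0 ∧ par a = b
  -- The nodes of `C` that are `y` or below `y`. All of them come no earlier than `y`, so a walk in
  -- `C` from `y` to `z` leaves `D`. A step to a child stays in `D`, and so does a step to the
  -- parent from a node other than `y`; hence the walk leaves from `y` to its parent.
  let D : Set C := {a | Relation.ReflTransGen R a.1 y}
  obtain ⟨w⟩ := hC.preconnected ⟨y, hy⟩ ⟨z, hz⟩
  have hzD : (⟨z, hz⟩ : C) ∉ D := by
    intro h
    have : ∀ a, Relation.ReflTransGen R a y → pos y ≤ pos a := by
      intro a h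
      induction h using Relation.ReflTransGen.head_induction_on with
      | refl => exact le_rfl
      | @head a b h _ ih =>
        have := (hpar a h.1).2
        rw [h.2] at this
        omega
    exact absurd (this z h) (by omega)
  obtain ⟨d, -, h1, h2⟩ := w.exists_boundary_dart D .refl hzD
  have hadj : T.Adj d.fst.1 d.snd.1 := d.adj
  rcases eq_parent_of_adj hT hpos hpar hadj with ⟨h3, h4⟩ | ⟨h3, h4⟩
  · rcases Relation.ReflTransGen.cases_head h1 with h5 | ⟨e, h5, h6⟩
    · rw [← h5, ← h3]
      exact d.snd.2
    · refine absurd ?_ h2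
      change Relation.ReflTransGen R d.snd.1 y
      rwa [h3, h5.2]
  · refine absurd ?_ h2
    change Relation.ReflTransGen R d.snd.1 y
    exact .head ⟨h4, h3.symm⟩ h1

end tree

/-! ### Ranking the vertices by their first bags. -/

section order

variable {n : ℕ} {ι : Type*} {G : SimpleGraph (Fin n)} {T : SimpleGraph ι} {β : ι → Finset (Fin n)}

/-- The reflexive adjacency relation of a graph after renumbering its vertices. -/
def rankAdj (G : SimpleGraph (Fin n)) (rk : Fin n → ℕ) (i j : ℕ) : Prop :=
  ∃ u v, rk u = i ∧ rk v = j ∧ (u = v ∨ G.Adj u v)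

/-- The vertices are numbered by `rk` in such an order that the first bags `top v` containing them
appear in the order given by `pos`. -/
structure IsRanking (β : ι → Finset (Fin n)) (pos : ι → ℕ) (rk : Fin n → ℕ) (top : Fin n → ι)
    (S : ℕ → Finset ℕ) : Prop where
  inj : Function.Injective rk
  lt : ∀ v, rk v < n
  mem_top : ∀ v, v ∈ β (top v)
  pos_top : ∀ v x, v ∈ β x → pos (top v) ≤ pos x
  mono : ∀ u v, rk u ≤ rk v → pos (top u) ≤ pos (top v)
  mem_iff : ∀ v j, j ∈ S (rk v) ↔ ∃ u ∈ β (top v), rk u = j ∧ j < rk v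

variable {pos : ι → ℕ} {rk : Fin n → ℕ} {top : Fin n → ι} {S : ℕ → Finset ℕ}

theorem IsRanking.surj (hr : IsRanking β pos rk top S) {i : ℕ} (hi : i < n) : ∃ v, rk v = i := by
  let f : Fin n → Fin n := fun v => ⟨rk v, hr.lt v⟩
  have hf : Function.Injective f := fun a b h => hr.inj (congrArg Fin.val h)
  obtain ⟨v, hv⟩ := Finite.surjective_of_injective hf ⟨i, hi⟩
  exact ⟨v, congrArg Fin.val hv⟩

/-- Climb from `y` to the first node of `v`. Until it is reached, the current node comes strictly
later than the first nodes of both vertices, so by `parent_mem` neither vertex is lost. -/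
theorem IsRanking.mem_of_mem (hr : IsRanking β pos rk top S) (hD : IsTreeDecomposition G T β)
    (hpos : Function.Injective pos)
    (hpar : ∀ x, pos x ≠ 0 → ∃ y, T.Adj x y ∧ pos y < pos x) {u v : Fin n}
    (huv : pos (top u) ≤ pos (top v)) {y : ι} (hu : u ∈ β y) (hv : v ∈ β y) : u ∈ β (top v) := by
  classical
  choose! par hpar using hpar
  induction h : pos y using Nat.strong_induction_on generalizing y with
  | _ k ih =>
    by_cases hy : y = top v
    · exact hy ▸ hu
    · have h1 : pos (top v) < pos y :=
        lt_of_le_of_ne (hr.pos_top v y hv) fun h => hy (hpos h).symm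
      have h2 := hpar y (by omega)
      refine ih (pos (par y)) (by omega) ?_ ?_ rfl
      · exact parent_mem hD.isTree hpos hpar (hD.connected u) hu (hr.mem_top u)
          (by omega : pos (top u) < pos y)
      · exact parent_mem hD.isTree hpos hpar (hD.connected v) hv (hr.mem_top v) h1

/-- The two essential fields both follow from `mem_of_mem`: the ends of an edge, and two elements of
one set, lie in a common bag, so the earlier vertex lies in the first bag of the later one. -/
theorem IsRanking.isElimination (hr : IsRanking β pos rk top S) (hD : IsTreeDecomposition G T β)
    (hpos : Function.Injective pos)
    (hpar : ∀ x, pos x ≠ 0 → ∃ y, T.Adj x y ∧ pos y < pos x) :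
    IsElimination n (rankAdj G rk) S where
  refl i hi := by
    obtain ⟨v, rfl⟩ := hr.surj hi
    exact ⟨v, v, rfl, rfl, .inl rfl⟩
  symm := by
    rintro _ _ ⟨u, v, rfl, rfl, h⟩
    exact ⟨v, u, rfl, rfl, h.imp Eq.symm fun h => h.symm⟩
  lt_of_adj := by
    rintro _ _ ⟨u, v, rfl, rfl, h⟩
    exact hr.lt u
  lt i hi j hj := by
    obtain ⟨v, rfl⟩ := hr.surj hi
    obtain ⟨u, -, -, h⟩ := (hr.mem_iff v j).1 hj
    exact h
  mem_of_adj := by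
    rintro _ _ ⟨u, v, rfl, rfl, h⟩ hlt
    rcases h with rfl | h
    · omega
    · obtain ⟨x, hu, hv⟩ := hD.exists_edge_bag u v h
      exact (hr.mem_iff u _).2 ⟨v, hr.mem_of_mem hD hpos hpar (hr.mono _ _ hlt.le) hv hu, rfl, hlt⟩
  chordal i hi j hj j' hj' hlt := by
    obtain ⟨v, rfl⟩ := hr.surj hi
    obtain ⟨u, hu, rfl, -⟩ := (hr.mem_iff v j).1 hj
    obtain ⟨u', hu', rfl, -⟩ := (hr.mem_iff v j').1 hj'
    exact (hr.mem_iff u' _).2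
      ⟨u, hr.mem_of_mem hD hpos hpar (hr.mono _ _ hlt.le) hu hu', rfl, hlt⟩

theorem edist_le_two {V : Type*} (G : SimpleGraph V) (u v : V) :
    G.edist u v ≤ 2 ↔ ∃ z, (u = z ∨ G.Adj u z) ∧ (z = v ∨ G.Adj z v) := by
  constructor
  · intro h
    obtain ⟨p, hp⟩ := SimpleGraph.exists_walk_of_edist_ne_top
      (ne_top_of_le_ne_top (by simp) h)
    rw [← hp] at h
    have h2 : p.length ≤ 2 := by exact_mod_cast h
    match p, h2 with
    | .nil, _ => exact ⟨u, .inl rfl, .inl rfl⟩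
    | .cons h .nil, _ => exact ⟨u, .inl rfl, .inr h⟩
    | .cons h (.cons h' .nil), _ => exact ⟨_, .inr h, .inr h'⟩
    | .cons _ (.cons _ (.cons _ _)), h2 => simp at h2
  · rintro ⟨z, h, h'⟩
    have one : ∀ a b : V, (a = b ∨ G.Adj a b) → G.edist a b ≤ 1 := by
      rintro a b (rfl | h)
      · simp
      · exact (SimpleGraph.edist_eq_one_iff_adj.2 h).le
    exact (SimpleGraph.edist_triangle).trans
      ((add_le_add (one u z h) (one z v h')).trans (by norm_num))

open Classical in
theorem IsRanking.ncard_closedNbhd (hr : IsRanking β pos rk top S) (v : Fin n) :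
    (closedNbhd G 2 v).ncard =
      ((Finset.range n).filter fun u => Near (rankAdj G rk) (rk v) u).card := by
  rw [← Set.ncard_image_of_injective _ hr.inj, ← Set.ncard_coe_finset]
  congr 1
  ext i
  simp only [Set.mem_image, closedNbhd, Finset.coe_filter, Finset.mem_range]
  constructor
  · rintro ⟨u, hu, rfl⟩
    refine ⟨hr.lt u, ?_⟩
    obtain ⟨z, h, h'⟩ := (edist_le_two G v u).1 (by simpa using hu)
    exact ⟨rk z, ⟨v, z, rfl, rfl, h⟩, ⟨z, u, rfl, rfl, h'⟩⟩
  · rintro ⟨hi, z, ⟨v', z', h1, rfl, h⟩, z'', u, h3, rfl, h'⟩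
    obtain rfl := hr.inj h1
    obtain rfl := hr.inj h3
    have := (edist_le_two G v' u).2 ⟨z'', h, h'⟩
    exact ⟨u, by simpa using this, rfl⟩

/-- Each edge is charged to its end of larger rank, whose set contains the other end. This bounds
the number of edges in terms of the width, which the quadratic algorithm relies on. -/
theorem IsRanking.length_edges_le (hr : IsRanking β pos rk top S)
    (hE : IsElimination n (rankAdj G rk) S) {es : List (Fin n × Fin n)} (hes : ListsEdges G es) :
    es.length ≤ ∑ i ∈ Finset.range n, (S i).card := by
  classical
  calc es.length = (es.map fun e => s(e.1, e.2)).toFinset.card := by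
        rw [List.toFinset_card_of_nodup hes.1, List.length_map]
    _ = ((es.map fun e => s(e.1, e.2)).toFinset.image (Sym2.map rk)).card :=
        (Finset.card_image_of_injective _ (Sym2.map.injective hr.inj)).symm
    _ ≤ (((Finset.range n).sigma S).image fun p => s(p.1, p.2)).card := by
        refine Finset.card_le_card fun e he => ?_
        obtain ⟨e, he', rfl⟩ := Finset.mem_image.1 he
        clear he
        induction e using Sym2.ind with
        | _ u v =>
          have h : G.Adj u v := (hes.2 s(u, v)).2 (List.mem_toFinset.1 he')
          rw [Sym2.map_mk, Finset.mem_image]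
          rcases lt_trichotomy (rk u) (rk v) with h' | h' | h'
          · have := hE.mem_of_adj _ _ ⟨v, u, rfl, rfl, .inr h.symm⟩ h'
            exact ⟨⟨rk v, rk u⟩, by simpa [hr.lt] using this, Sym2.eq_swap⟩
          · exact absurd (hr.inj h') h.ne
          · have := hE.mem_of_adj _ _ ⟨u, v, rfl, rfl, .inr h⟩ h'
            exact ⟨⟨rk u, rk v⟩, by simpa [hr.lt] using this, rfl⟩
    _ ≤ ((Finset.range n).sigma S).card := Finset.card_image_le
    _ = _ := Finset.card_sigma _ _

end order

end Elim

/-! ### Reading the input -/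

namespace Loop

prefix:max "†" => Expr.var

-- The bound has to be variable `0`, because register `0` enters every computation of an address.
notation "v_B" => 0
notation "v_n" => 1
notation "v_N" => 2
notation "v_m" => 3
notation "v_k" => 4
notation "v_pos" => 5
notation "v_bags" => 6
notation "v_P" => 7
notation "v_big" => 8
notation "v_r" => 9
notation "v_i" => 10
notation "v_j" => 11
notation "v_l" => 12
notation "v_c" => 13
notation "v_M" => 14
notation "v_iEnd" => 15
notation "v_jEnd" => 16
notation "v_lEnd" => 17
notation "v_cEnd" => 18
notation "v_MEnd" => 19
notation "v_a" => 20
notation "v_b" => 21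
notation "v_s" => 22
notation "v_x" => 23
notation "v_cnt" => 24
notation "v_max" => 25
notation "v_p" => 26
notation "v_u" => 27
notation "v_z" => 28

-- A table with a single index occupies row `0` of its array.
notation "a_start" => 0
notation "a_deg" => 1
notation "a_nb" => 2
notation "a_queue" => 3
notation "a_seen" => 4
notation "a_rank" => 5
notation "a_S" => 6
notation "a_size" => 7
notation "a_par" => 8
notation "a_in" => 9
notation "a_adj" => 10
notation "a_pow" => 11
notation "a_near" => 12
notation "a_ans" => 13
notation "a_used" => 14
notation "a_col" => 15
notation "a_nbf" => 16
notation "a_nbp" => 17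
notation "a_rmf" => 18
notation "a_rm" => 19
notation "a_T" => 20
notation "a_W" => 21
notation "a_scf" => 22
notation "a_pr" => 23
notation "a_fl" => 24
notation "a_tmp" => 25
notation "a_Y" => 26

/-- Determines the largest size of a bag and the length of the input, and sets the bound. -/
def scan : Cmd :=
  -- The first bag is at `3 + 2 m + 2 (N - 1)`, which equals this sum since a tree has at least one
  -- node.
  v_N ::= .raw 1 ;; v_m ::= .raw 2 ;; v_bags ::= 1 + †v_m + †v_m + †v_N + †v_N ;;
  v_pos ::= †v_bags ;; v_k ::= 0 ;;
  .forTo v_i v_iEnd †v_N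
    (v_s ::= .raw †v_pos ;; v_pos ::= †v_pos + †v_s + 1 ;;
      .ite (†v_s - †v_k) (v_k ::= †v_s) .skip) ;;
  -- Six doublings multiply the length of the input by `64`; the language has no product, and the
  -- factor leaves room for all later sums.
  v_B ::= †v_pos + †v_pos ;; v_B ::= †v_B + †v_B ;; v_B ::= †v_B + †v_B ;; v_B ::= †v_B + †v_B ;;
  v_B ::= †v_B + †v_B ;; v_B ::= †v_B + †v_B

/-- Before the bound is in place arrays are unusable, so this stage works with variables and input
cells only. -/
theorem wp_scan {B N m : ℕ} {off len : ℕ → ℕ} {σ : Env} (hN : σ.cell 1 = N) (hm : σ.cell 2 = m)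
    (h0 : off 0 = 1 + m + m + N + N) (hoff : ∀ x < N, off (x + 1) = off x + len x + 1)
    (hcell : ∀ x < N, σ.cell (off x) = len x) (hB : B = 64 * off N)
    (hmono : ∀ x ≤ N, off x ≤ off N) :
    wp B scan (fun t τ => t ≤ 100 * (N + 1) ∧ τ.var v_N = N ∧ τ.var v_m = m ∧
      τ.var v_bags = off 0 ∧ τ.var v_k = (Finset.range N).sup len ∧ τ.var v_B = B) σ := by
  have h1 := hmono 0 (by omega)
  simp only [scan, wp_seq, wp_assign]
  refine ⟨by simp; omega, by simp; omega, by simp [hN, hm]; omega, by simp, by simp; omega, ?_⟩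
  refine wp_for (fun i τ => τ.var v_pos = off i ∧ τ.var v_k = (Finset.range i).sup len) N 50
    (by decide) (by decide) (by decide) (by omega) (by simp) (by simp [hN])
    (by simp [hN, hm, h0]) ?_ ?_
  · rintro i hi τ - - hf ⟨hp, hk⟩
    have hc := hf.cell (by decide)
    have h2 := hmono (i + 1) (by omega)
    have h3 := hoff i hi
    have h4 := hcell i hi
    have h5 : len i ≤ (Finset.range (i + 1)).sup len ∧
        (Finset.range i).sup len ≤ (Finset.range (i + 1)).sup len ∧
        ((Finset.range (i + 1)).sup len = len i ∨
          (Finset.range (i + 1)).sup len = (Finset.range i).sup len) := by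
      rw [Finset.range_add_one, Finset.sup_insert]
      exact ⟨le_sup_left, le_sup_right, (le_total (len i) ((Finset.range i).sup len)).symm.imp
        sup_eq_left.2 sup_eq_right.2⟩
    simp [hp, hk, hc, h4]
    generalize (Finset.range i).sup len = s at h5 ⊢
    generalize (Finset.range (i + 1)).sup len = s' at h5 ⊢
    omega
  · rintro t τ ht ⟨hp, hk⟩ hf
    have e1 := hf.var v_N (by decide)
    have e2 := hf.var v_m (by decide)
    have e3 := hf.var v_bags (by decide)
    simp [hN, hm] at e1 e2 e3
    simp at ht
    simp [hp, e1, e2, e3, hk, h0]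
    omega

/-- Stores the positions of the bags in the input. -/
def starts : Cmd :=
  v_pos ::= †v_bags ;;
  .forTo v_i v_iEnd †v_N (.put a_start 0 †v_i †v_pos ;; v_pos ::= †v_pos + .raw †v_pos + 1)

theorem wp_starts {B N : ℕ} {off len : ℕ → ℕ} {σ : Env} (hN : σ.var v_N = N)
    (h0 : σ.var v_bags = off 0) (hoff : ∀ x < N, off (x + 1) = off x + len x + 1)
    (hcell : ∀ x < N, σ.cell (off x) = len x) (hB : 16 * off N ≤ B) (hvB : σ.var v_B = B)
    (hmono : ∀ x ≤ N, off x ≤ off N) (hNo : N < off N) :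
    wp B starts (fun t τ => t ≤ 100 * (N + 1) ∧ ∀ x < N, τ.arr a_start 0 x = off x) σ := by
  simp only [starts, wp_seq, wp_assign]
  refine ⟨by simp, ?_⟩
  refine wp_for (fun i τ => τ.var v_pos = off i ∧ ∀ x < i, τ.arr a_start 0 x = off x) N 50
    (by decide) (by decide) (by decide) (by omega) (by simp) (by simp [hN])
    (by simp [h0]) ?_ ?_
  · rintro i hi τ hvi - hf ⟨hp, hk⟩
    have hc := hf.cell (by decide)
    have hv0 := hf.var v_B (by decide)
    have h2 := hmono (i + 1) (by omega)
    have h3 := hoff i hi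
    have h4 := hcell i hi
    simp at hv0
    simp [hp, hc, h4, hv0, hvB, hvi]
    refine ⟨by omega, by omega, by omega, fun x hx => ?_⟩
    split_ifs with h
    · rw [h]
    · exact hk x (by omega)
  · rintro t τ ht ⟨hp, hk⟩ hf
    simp at ht
    refine ⟨by simp; omega, hk⟩

/-- The lists of neighbours contain the pairs related by `R`, and `s` entries. -/
structure NbLists (N : ℕ) (R : ℕ → ℕ → Prop) (s : ℕ) (σ : Env) : Prop where
  mem : ∀ a b, (∃ j < σ.arr a_deg 0 a, σ.arr a_nb a j = b) ↔ R a b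
  sum : ∑ a ∈ Finset.range N, σ.arr a_deg 0 a = s
  le : ∀ a, σ.arr a_deg 0 a ≤ s

theorem NbLists.append {N s : ℕ} {R : ℕ → ℕ → Prop} {σ : Env} (h : NbLists N R s σ) {u v : ℕ}
    (hu : u < N) : NbLists N (fun a b => R a b ∨ a = u ∧ b = v) (s + 1)
      ((σ.put a_nb u (σ.arr a_deg 0 u) v).put a_deg 0 u (σ.arr a_deg 0 u + 1)) where
  mem a b := by
    rw [← h.mem]
    by_cases ha : a = u
    · subst ha
      simp only [Env.put_arr]
      constructor
      · rintro ⟨j, hj, h'⟩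
        by_cases hj' : j = σ.arr a_deg 0 a
        · right; simpa [hj', eq_comm] using h'
        · left
          simp [hj'] at h' hj
          exact ⟨j, by omega, h'⟩
      · rintro (⟨j, hj, h'⟩ | ⟨-, rfl⟩)
        · exact ⟨j, by simp; omega, by simp [hj.ne, h']⟩
        · exact ⟨σ.arr a_deg 0 a, by simp, by simp⟩
    · simp [ha]
  sum := by
    have : ∀ a, (((σ.put a_nb u (σ.arr a_deg 0 u) v).put a_deg 0 u
        (σ.arr a_deg 0 u + 1)).arr a_deg 0 a) = σ.arr a_deg 0 a + if a = u then 1 else 0 := by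
      intro a
      by_cases ha : a = u <;> simp [ha]
    simp only [this, Finset.sum_add_distrib, h.sum]
    simp [hu]
  le a := by
    have := h.le a
    by_cases ha : a = u
    · subst ha; simpa using this
    · simp [ha]; omega

theorem NbLists.congr {N s : ℕ} {R R' : ℕ → ℕ → Prop} {σ σ' : Env} (h : NbLists N R s σ)
    (hR : ∀ a b, R a b ↔ R' a b) (h1 : σ'.arr a_deg = σ.arr a_deg)
    (h2 : σ'.arr a_nb = σ.arr a_nb) : NbLists N R' s σ' :=
  ⟨fun a b => by rw [h1, h2, h.mem, hR], by rw [h1, h.sum], by rw [h1]; exact h.le⟩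

/-- Builds the lists of neighbours of the tree. -/
def treeLists : Cmd :=
  v_pos ::= 3 + †v_m + †v_m ;;
  .forTo v_i v_iEnd (†v_N - 1)
    (v_a ::= .raw †v_pos ;; v_b ::= .raw (†v_pos + 1) ;; v_pos ::= †v_pos + 2 ;;
      .put a_nb †v_a (.get a_deg 0 †v_a) †v_b ;;
      .put a_deg 0 †v_a (.get a_deg 0 †v_a + 1) ;;
      .put a_nb †v_b (.get a_deg 0 †v_b) †v_a ;;
      .put a_deg 0 †v_b (.get a_deg 0 †v_b + 1))

theorem wp_treeLists {B N m : ℕ} {xe ye : ℕ → ℕ} {σ : Env} (hN : σ.var v_N = N)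
    (hm : σ.var v_m = m) (hvB : σ.var v_B = B) (hB : 16 * (1 + 2 * m + 2 * N) ≤ B)
    (hx : ∀ e < N - 1, xe e < N ∧ ye e < N ∧ σ.cell (3 + 2 * m + 2 * e) = xe e ∧
      σ.cell (4 + 2 * m + 2 * e) = ye e) (h0 : ∀ a, σ.arr a_deg 0 a = 0) :
    wp B treeLists (fun t τ => t ≤ 200 * (N + 1) ∧
      NbLists N (fun a b => ∃ e < N - 1, a = xe e ∧ b = ye e ∨ a = ye e ∧ b = xe e)
        (2 * (N - 1)) τ) σ := by
  simp only [treeLists, wp_seq, wp_assign]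
  refine ⟨by simp [hm]; omega, ?_⟩
  refine wp_for (fun i τ => τ.var v_pos = 3 + 2 * m + 2 * i ∧
    NbLists N (fun a b => ∃ e < i, a = xe e ∧ b = ye e ∨ a = ye e ∧ b = xe e) (2 * i) τ) (N - 1) 180
    (by decide) (by decide) (by decide) (by omega) (by simp; omega) (by simp [hN])
    (by simp [hm]; exact ⟨by omega, by simp [h0], by simp [h0], by simp [h0]⟩) ?_ ?_
  · rintro i hi τ hvi - hf ⟨hp, hk⟩
    have hc := hf.cell (by decide)
    have hv0 := hf.var v_B (by decide)
    obtain ⟨hx1, hy1, hx2, hy2⟩ := hx i hi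
    have hy2' : σ.cell (3 + 2 * m + 2 * i + 1) = ye i := by
      rw [← hy2]; congr 1; omega
    have h1 := hk.append hx1 (v := ye i)
    have h2 := h1.append hy1 (v := xe i)
    have b1 := hk.le (xe i)
    have b2 := h1.le (ye i)
    simp at hv0 hc
    simp [hp, hc, hx2, hy2', hv0, hvB] at b2 ⊢
    and_intros
    all_goals first | omega | skip
    refine h2.congr (fun a b => ?_) ?_ ?_
    · constructor
      · rintro ((⟨e, he, h⟩ | h) | h)
        · exact ⟨e, by omega, h⟩
        · exact ⟨i, by omega, .inl h⟩
        · exact ⟨i, by omega, .inr h⟩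
      · rintro ⟨e, he, h⟩
        rcases Nat.lt_succ_iff_lt_or_eq.1 (Nat.lt_succ_of_le he) with he | rfl
        · exact .inl (.inl ⟨e, he, h⟩)
        · rcases h with h | h
          · exact .inl (.inr h)
          · exact .inr h
    · funext a b; simp
    · funext a b; simp
  · rintro t τ ht ⟨hp, hk⟩ hf
    simp at ht
    refine ⟨by simp; omega, hk⟩

end Loop

/-! ### Traversal of the tree -/

namespace Loop

theorem image_range_eq {N : ℕ} {q : ℕ → ℕ} (hlt : ∀ j < N, q j < N)
    (hinj : ∀ i < N, ∀ j < N, q i = q j → i = j) :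
    (Finset.range N).image q = Finset.range N := by
  refine Finset.eq_of_subset_of_card_le (fun x hx => ?_) ?_
  · obtain ⟨j, hj, rfl⟩ := Finset.mem_image.1 hx
    exact Finset.mem_range.2 (hlt j (Finset.mem_range.1 hj))
  · rw [Finset.card_image_of_injOn]
    intro i hi j hj h
    exact hinj i (by simpa using hi) j (by simpa using hj) h

/-- Turns an amortised bound in the order of the traversal into a sum over all nodes. -/
theorem sum_range_comp {N : ℕ} {q : ℕ → ℕ} (hlt : ∀ j < N, q j < N)
    (hinj : ∀ i < N, ∀ j < N, q i = q j → i = j) (f : ℕ → ℕ) :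
    ∑ j ∈ Finset.range N, f (q j) = ∑ x ∈ Finset.range N, f x := by
  conv_rhs => rw [← image_range_eq hlt hinj]
  rw [Finset.sum_image]
  intro i hi j hj h
  exact hinj i (by simpa using hi) j (by simpa using hj) h

/-- `q 0, …, q (l - 1)` are distinct nodes, each of which except for the first one is related to an
earlier one. -/
structure IsTraversal (N : ℕ) (R : ℕ → ℕ → Prop) (q : ℕ → ℕ) (l : ℕ) : Prop where
  lt : ∀ j < l, q j < N
  inj : ∀ i < l, ∀ j < l, q i = q j → i = j
  pred : ∀ j < l, j ≠ 0 → ∃ i < j, R (q j) (q i)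

/-- A queue with the set of its elements. -/
structure IsQueue (N : ℕ) (R : ℕ → ℕ → Prop) (q seen : ℕ → ℕ) (l : ℕ) : Prop
    extends IsTraversal N R q l where
  pos : 0 < l
  zero : q 0 = 0
  seen : ∀ x, seen x ≠ 0 ↔ ∃ j < l, q j = x

theorem IsTraversal.le {N l : ℕ} {R : ℕ → ℕ → Prop} {q : ℕ → ℕ} (h : IsTraversal N R q l) :
    l ≤ N := by
  have := Finset.card_le_card_of_injOn (s := Finset.range l) (t := Finset.range N) q
    (fun j hj => by simpa using h.lt j (by simpa using hj))
    (fun i hi j hj => h.inj i (by simpa using hi) j (by simpa using hj))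
  simpa using this

theorem IsQueue.push {N l a i : ℕ} {R : ℕ → ℕ → Prop} {q seen q' seen' : ℕ → ℕ}
    (h : IsQueue N R q seen l) (ha : a < N) (hs : seen a = 0) (hi : i < l) (hR : R a (q i))
    (hq' : ∀ j, q' j = if j = l then a else q j)
    (hs' : ∀ x, seen' x = if x = a then 1 else seen x) : IsQueue N R q' seen' (l + 1) := by
  have hne : ∀ j < l, q j ≠ a := fun j hj h' => (h.seen a).2 ⟨j, hj, h'⟩ hs
  have hold : ∀ j < l, q' j = q j := fun j hj => by rw [hq', if_neg hj.ne]
  have hnew : q' l = a := by rw [hq', if_pos rfl]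
  have cases : ∀ j, j < l + 1 → j < l ∨ j = l := fun j hj => by omega
  refine ⟨⟨fun j hj => ?_, fun j hj k hk he => ?_, fun j hj h0 => ?_⟩, by omega, ?_, fun x => ?_⟩
  · rcases cases j hj with hj | rfl
    · rw [hold j hj]; exact h.lt j hj
    · rwa [hnew]
  · rcases cases j hj with hj | rfl <;> rcases cases k hk with hk | rfl
    · rw [hold j hj, hold k hk] at he
      exact h.inj j hj k hk he
    · rw [hold j hj, hnew] at he
      exact absurd he (hne j hj)
    · rw [hold k hk, hnew] at he
      exact absurd he.symm (hne k hk)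
    · rfl
  · rcases cases j hj with hj | rfl
    · obtain ⟨k, hk, hR⟩ := h.pred j hj h0
      exact ⟨k, hk, by rwa [hold j hj, hold k (by omega)]⟩
    · exact ⟨i, hi, by rwa [hnew, hold i hi]⟩
  · rw [hold 0 h.pos, h.zero]
  · rw [hs']
    by_cases hx : x = a
    · subst hx
      simp only [if_true, ne_eq, one_ne_zero, not_false_eq_true, true_iff]
      exact ⟨l, by omega, hnew⟩
    · rw [if_neg hx, h.seen]
      constructor
      · rintro ⟨j, hj, h'⟩
        exact ⟨j, by omega, by rw [hold j hj, h']⟩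
      · rintro ⟨j, hj, h'⟩
        rcases cases j hj with hj | rfl
        · exact ⟨j, hj, by rw [← hold j hj, h']⟩
        · exact absurd (h'.symm.trans hnew) hx

/-- Breadth-first search in the tree, from node `0`. -/
def bfs : Cmd :=
  .put a_queue 0 0 0 ;; .put a_seen 0 0 1 ;; v_cnt ::= 1 ;;
  .forTo v_i v_iEnd †v_N
    (v_x ::= .get a_queue 0 †v_i ;;
      .forTo v_j v_jEnd (.get a_deg 0 †v_x)
        (v_a ::= .get a_nb †v_x †v_j ;;
          .ite (.get a_seen 0 †v_a) .skip
            (.put a_seen 0 †v_a 1 ;; .put a_queue 0 †v_cnt †v_a ;; v_cnt ::= †v_cnt + 1)))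

/-- Handling a node takes time proportional to its degree. Each node occurs once in the queue, and
the degrees add up to `s`. -/
theorem wp_bfs {B N s : ℕ} {R : ℕ → ℕ → Prop} {σ : Env} (hN : σ.var v_N = N)
    (hvB : σ.var v_B = B) (hB : 16 * (1 + N + s) ≤ B) (hN0 : 0 < N) (hL : NbLists N R s σ)
    (hR : ∀ a b, R a b → a < N ∧ b < N ∧ R b a)
    (hconn : ∀ D : Set ℕ, 0 ∈ D → (∀ a ∈ D, ∀ b, R a b → b ∈ D) → ∀ x < N, x ∈ D)
    (hseen : ∀ x, σ.arr a_seen 0 x = 0) :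
    wp B bfs (fun t τ => t ≤ 200 * (N + s) ∧ IsTraversal N R (τ.arr a_queue 0) N) σ := by
  simp only [bfs, wp_seq, wp_assign, wp_put]
  refine ⟨by simp [hvB]; omega, by simp [hvB]; omega, by simp; omega, ?_⟩
  refine wp_forTo (fun i t τ => IsQueue N R (τ.arr a_queue 0) (τ.arr a_seen 0) (τ.var v_cnt) ∧
    i ≤ τ.var v_cnt ∧ (∀ j < i, ∀ y, R (τ.arr a_queue 0 j) y → τ.arr a_seen 0 y ≠ 0) ∧
    t ≤ ∑ j ∈ Finset.range i, (60 + 100 * σ.arr a_deg 0 (τ.arr a_queue 0 j))) N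
    (by decide) (by decide) (by decide) (by omega) (by simp) (by simp [hN]) ?_ ?_ ?_
  · refine ⟨⟨⟨?_, ?_, ?_⟩, ?_, ?_, ?_⟩, ?_, ?_, ?_⟩
    · intro j hj; simp at hj; subst hj; simpa using hN0
    · intro i hi j hj; simp at hi hj; omega
    · intro j hj; simp at hj; omega
    · simp
    · simp
    · intro x; by_cases hx : x = 0 <;> simp [hx, hseen, eq_comm]
    · simp
    · simp
    · simp
  · rintro i hi t τ hvi - hf ⟨hq, hil, hcl, ht⟩
    -- No test for an empty queue is needed: if the queue were exhausted here, its elements would be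
    -- closed under `R` and contain `0`, so it would already have all `N` nodes.
    have hlt : i < τ.var v_cnt := by
      by_contra hcon
      obtain hil : i = τ.var v_cnt := by omega
      have hall := hconn {x | ∃ j < i, τ.arr a_queue 0 j = x}
        ⟨0, by have := hq.pos; omega, hq.zero⟩ (by
          rintro _ ⟨j, hj, rfl⟩ b hb
          have := (hq.seen b).1 (hcl j hj b hb)
          rwa [← hil] at this)
      have : N ≤ i := by
        have h1 : Finset.range N ⊆ (Finset.range i).image (τ.arr a_queue 0) := by
          intro x hx
          obtain ⟨j, hj, h⟩ := hall x (Finset.mem_range.1 hx)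
          exact Finset.mem_image.2 ⟨j, Finset.mem_range.2 hj, h⟩
        simpa using (Finset.card_le_card h1).trans Finset.card_image_le
      omega
    have hv0 := hf.var v_B (by decide)
    have hdeg : ∀ x, τ.arr a_deg 0 x = σ.arr a_deg 0 x := fun x => by
      rw [hf.arr a_deg (by decide)]; simp
    have hnb : ∀ x j, τ.arr a_nb x j = σ.arr a_nb x j := fun x j => by
      rw [hf.arr a_nb (by decide)]; simp
    have hle := hL.le (τ.arr a_queue 0 i)
    simp at hv0
    simp only [wp_seq, wp_assign]
    have hx : τ.arr a_queue 0 i < N := hq.lt i hlt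
    refine ⟨by simp [hv0, hvB, hvi]; omega, ?_⟩
    refine wp_for (fun j τ' => IsQueue N R (τ'.arr a_queue 0) (τ'.arr a_seen 0) (τ'.var v_cnt) ∧
      i < τ'.var v_cnt ∧ (∀ l ≤ i, τ'.arr a_queue 0 l = τ.arr a_queue 0 l) ∧
      (∀ y, τ.arr a_seen 0 y ≠ 0 → τ'.arr a_seen 0 y ≠ 0) ∧
      ∀ l < j, τ'.arr a_seen 0 (τ.arr a_nb (τ.arr a_queue 0 i) l) ≠ 0)
      (σ.arr a_deg 0 (τ.arr a_queue 0 i)) 80 (by decide) (by decide) (by decide) (by omega)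
      (by simp [hv0, hvB, hvi]; omega) (by simp [hvi, hdeg]) ?_ ?_ ?_
    · simpa [hlt] using hq
    · rintro j hj τ' hvj - hf' ⟨hq', hlt', hqq, hss, hnn⟩
      have hx' := hf'.var v_x (by decide)
      have hv0' := hf'.var v_B (by decide)
      have hnb' : τ'.arr a_nb = τ.arr a_nb := by rw [hf'.arr a_nb (by decide)]; rfl
      simp [hvi] at hx' hv0'
      have hRa : R (τ.arr a_queue 0 i) (τ.arr a_nb (τ.arr a_queue 0 i) j) :=
        (hL.mem _ _).1 ⟨j, hj, (hnb _ _).symm⟩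
      have haN := (hR _ _ hRa).2.1
      have hqN := hq'.le
      simp [hx', hv0', hvB, hv0, hvj, hnb']
      set a := τ.arr a_nb (τ.arr a_queue 0 i) j
      refine ⟨by omega, by omega, fun h => ?_, fun h => ?_⟩
      · refine ⟨hq', hlt', hqq, hss, fun l hl => ?_⟩
        rcases Nat.lt_succ_iff_lt_or_eq.1 (Nat.lt_succ_of_le hl) with hl | rfl
        · exact hnn l hl
        · exact h
      · and_intros
        all_goals first | omega | skip
        · refine hq'.push haN h hlt' ?_ ?_ ?_
          · rw [hqq i le_rfl]; exact (hR _ _ hRa).2.2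
          · intro l; simp
          · intro x; simp
        · intro l hl
          rw [if_neg (by omega), hqq l hl]
        · intro y h1
          split_ifs
          · simp
          · exact hss y h1
        · intro l hl
          split_ifs with h1
          · simp
          · rcases Nat.lt_succ_iff_lt_or_eq.1 (Nat.lt_succ_of_le hl) with hl | rfl
            · exact hnn l hl
            · exact absurd rfl h1
    · rintro t' τ' ht' ⟨hq', hlt', hqq, hss, hnn⟩ hf'
      have ha : ∀ j, (τ'.set v_i (i + 1)).arr a_queue 0 j = τ'.arr a_queue 0 j := fun _ => rfl
      refine ⟨hq', hlt', ?_, ?_⟩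
      · intro j hj y hy
        simp only [Env.set_arr] at hy ⊢
        rw [hqq j (by omega)] at hy
        rcases Nat.lt_succ_iff_lt_or_eq.1 hj with hj | rfl
        · exact hss y (hcl j hj y hy)
        · obtain ⟨l, hl, rfl⟩ := (hL.mem _ _).2 hy
          rw [← hnb]
          exact hnn l hl
      · rw [Finset.sum_range_succ]
        simp only [Env.set_arr]
        rw [hqq i le_rfl, Finset.sum_congr rfl fun j hj => by
          rw [hqq j (by have := Finset.mem_range.1 hj; omega)]]
        simp at ht' ⊢
        omega
  · rintro t τ ⟨hq, hl, -, ht⟩ hf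
    have h := hq.toIsTraversal
    have hlN := h.le
    rw [show τ.var v_cnt = N by omega] at h
    refine ⟨?_, h⟩
    rw [sum_range_comp h.lt h.inj fun x => 60 + 100 * σ.arr a_deg 0 x, Finset.sum_add_distrib,
      ← Finset.mul_sum, hL.sum] at ht
    simp at ht ⊢
    omega

end Loop

/-! ### The elimination ordering -/

namespace Loop

/-- Row `r` of the arrays describes the set `X`. -/
structure Row (X : Finset ℕ) (r : ℕ) (σ : Env) : Prop where
  size : σ.arr a_size 0 r = X.card
  image : (Finset.range X.card).image (σ.arr a_S r) = X
  self : σ.arr a_S r X.card = r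
  par : X.Nonempty → σ.arr a_par 0 r = X.sup id
  mem : ∀ u, σ.arr a_in r u ≠ 0 ↔ u ∈ X

theorem Row.congr {X : Finset ℕ} {r : ℕ} {σ τ : Env} (h : Row X r σ)
    (h1 : τ.arr a_size 0 r = σ.arr a_size 0 r) (h2 : τ.arr a_S r = σ.arr a_S r)
    (h3 : τ.arr a_par 0 r = σ.arr a_par 0 r) (h4 : τ.arr a_in r = σ.arr a_in r) : Row X r τ :=
  ⟨h1.trans h.size, h2 ▸ h.image, h2 ▸ h.self, fun hX => h3.trans (h.par hX), h4 ▸ h.mem⟩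

/-- Collects the ranks of the elements of the current bag that already have a rank. -/
def collect : Cmd :=
  v_cnt ::= 0 ;; v_max ::= 0 ;;
  .forTo v_l v_lEnd †v_s
    (v_u ::= .get a_rank 0 (.raw (†v_x + 1 + †v_l)) ;;
      .ite †v_u
        (.put a_S †v_r †v_cnt (†v_u - 1) ;; v_cnt ::= †v_cnt + 1 ;;
          .put a_in †v_r (†v_u - 1) 1 ;;
          .ite (†v_u - †v_max) (v_max ::= †v_u) .skip)
        .skip)

/-- The ranks, counted from `0`, of the first `l` elements of a list. -/
def rankSet (rank el : ℕ → ℕ) (l : ℕ) : Finset ℕ :=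
  ((Finset.range l).filter fun j => rank (el j) ≠ 0).image fun j => rank (el j) - 1

theorem rankSet_succ_of_eq {rank el : ℕ → ℕ} {l : ℕ} (h : rank (el l) = 0) :
    rankSet rank el (l + 1) = rankSet rank el l := by
  simp [rankSet, Finset.range_add_one, Finset.filter_insert, h]

theorem rankSet_succ_of_ne {rank el : ℕ → ℕ} {l : ℕ} (h : rank (el l) ≠ 0) :
    rankSet rank el (l + 1) = insert (rank (el l) - 1) (rankSet rank el l) := by
  simp [rankSet, Finset.range_add_one, Finset.filter_insert, h]

theorem mem_rankSet {rank el : ℕ → ℕ} {l u : ℕ} :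
    u ∈ rankSet rank el l ↔ ∃ j < l, rank (el j) = u + 1 := by
  simp only [rankSet, Finset.mem_image, Finset.mem_filter, Finset.mem_range]
  constructor
  · rintro ⟨j, ⟨hj, h⟩, rfl⟩
    exact ⟨j, hj, by omega⟩
  · rintro ⟨j, hj, h⟩
    exact ⟨j, ⟨hj, by omega⟩, by omega⟩

theorem card_rankSet_le (rank el : ℕ → ℕ) (l : ℕ) : (rankSet rank el l).card ≤ l :=
  Finset.card_image_le.trans ((Finset.card_filter_le _ _).trans (by simp))

theorem image_range_succ {f g : ℕ → ℕ} {c a : ℕ} {X : Finset ℕ}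
    (h : (Finset.range c).image f = X) (hg : ∀ j, g j = if j = c then a else f j) :
    (Finset.range (c + 1)).image g = insert a X := by
  rw [Finset.range_add_one, Finset.image_insert, hg c, if_pos rfl, ← h]
  congr 1
  refine Finset.image_congr fun j hj => ?_
  have : j < c := by simpa using hj
  rw [hg, if_neg this.ne]

/-- Ranks are stored increased by one, with `0` for unranked vertices. The maximum is taken of these
shifted values, so that its initial value `0` is right for the empty set. -/
theorem wp_collect {B n r st sz : ℕ} {el : ℕ → ℕ} {σ : Env} (hvB : σ.var v_B = B)
    (hr : σ.var v_r = r) (hx : σ.var v_x = st) (hs : σ.var v_s = sz)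
    (hcell : ∀ l < sz, σ.cell (st + 1 + l) = el l) (hinj : ∀ l < sz, ∀ j < sz, el l = el j → l = j)
    (hB : 16 * (n + st + sz + 2) ≤ B) (hrn : r < n) (hel : ∀ l < sz, el l < n)
    (hrank : ∀ v, σ.arr a_rank 0 v ≤ n)
    (hrinj : ∀ u v, σ.arr a_rank 0 u ≠ 0 → σ.arr a_rank 0 u = σ.arr a_rank 0 v → u = v)
    (hin : ∀ u, σ.arr a_in r u = 0) :
    wp B collect (fun t τ => t ≤ 100 * (sz + 1) ∧
      τ.var v_cnt = (rankSet (σ.arr a_rank 0) el sz).card ∧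
      τ.var v_max = (rankSet (σ.arr a_rank 0) el sz).sup Nat.succ ∧
      (Finset.range (τ.var v_cnt)).image (τ.arr a_S r) = rankSet (σ.arr a_rank 0) el sz ∧
      (∀ u, τ.arr a_in r u ≠ 0 ↔ u ∈ rankSet (σ.arr a_rank 0) el sz) ∧
      ∀ r' ≠ r, τ.arr a_S r' = σ.arr a_S r' ∧ τ.arr a_in r' = σ.arr a_in r') σ := by
  simp only [collect, wp_seq, wp_assign]
  refine ⟨by simp; omega, by simp; omega, ?_⟩
  refine wp_for (fun l τ => τ.var v_cnt = (rankSet (σ.arr a_rank 0) el l).card ∧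
      τ.var v_max = (rankSet (σ.arr a_rank 0) el l).sup Nat.succ ∧
      (Finset.range (τ.var v_cnt)).image (τ.arr a_S r) = rankSet (σ.arr a_rank 0) el l ∧
      (∀ u, τ.arr a_in r u ≠ 0 ↔ u ∈ rankSet (σ.arr a_rank 0) el l) ∧
      ∀ r' ≠ r, τ.arr a_S r' = σ.arr a_S r' ∧ τ.arr a_in r' = σ.arr a_in r') sz 80
    (by decide) (by decide) (by decide) (by omega) (by simp) (by simp [hs]) ?_ ?_ ?_
  · simp [rankSet, hin]
  · rintro l hl τ hvl - hf ⟨h1, h2, h3, h4, h5⟩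
    have hv0 := hf.var v_B (by decide)
    have hvr := hf.var v_r (by decide)
    have hvx := hf.var v_x (by decide)
    have hrk := hf.arr a_rank (by decide)
    have hc := hf.cell (by decide)
    simp [hvB, hr, hx] at hv0 hvr hvx hrk hc
    have hcl := hcell l hl
    have hell := hel l hl
    have hle := card_rankSet_le (σ.arr a_rank 0) el l
    have hrl := hrank (el l)
    simp [hv0, hvr, hvx, hrk, hc, hvl, hcl, h1, h2]
    refine ⟨by omega, fun h => ?_, fun h => ?_⟩
    · have hnew : σ.arr a_rank 0 (el l) - 1 ∉ rankSet (σ.arr a_rank 0) el l := by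
        rw [mem_rankSet]
        rintro ⟨j, hj, he⟩
        have := hrinj (el j) (el l) (by omega) (by omega)
        have := hinj j (by omega) l hl this
        omega
      have hsucc := rankSet_succ_of_ne (el := el) h
      have hcard : (rankSet (σ.arr a_rank 0) el (l + 1)).card =
          (rankSet (σ.arr a_rank 0) el l).card + 1 := by
        rw [hsucc, Finset.card_insert_of_notMem hnew]
      have hsup : (rankSet (σ.arr a_rank 0) el (l + 1)).sup Nat.succ =
          max (σ.arr a_rank 0 (el l)) ((rankSet (σ.arr a_rank 0) el l).sup Nat.succ) := by
        rw [hsucc, Finset.sup_insert]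
        congr 1
        exact Nat.succ_pred_eq_of_ne_zero h
      have hS : ∀ g : ℕ → ℕ, (∀ j, g j = if j = (rankSet (σ.arr a_rank 0) el l).card then
          σ.arr a_rank 0 (el l) - 1 else τ.arr a_S r j) →
          (Finset.range ((rankSet (σ.arr a_rank 0) el l).card + 1)).image g =
            rankSet (σ.arr a_rank 0) el (l + 1) := by
        intro g hg
        rw [hsucc]
        exact image_range_succ (by rw [← h1]; exact h3) hg
      have hmem : ∀ u, (¬(if u = σ.arr a_rank 0 (el l) - 1 then 1 else τ.arr a_in r u) = 0) ↔
          u ∈ rankSet (σ.arr a_rank 0) el (l + 1) := by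
        intro u
        rw [hsucc, Finset.mem_insert, ← h4]
        by_cases hu : u = σ.arr a_rank 0 (el l) - 1 <;> simp [hu]
      have hrest : ∀ g g' : ℕ → ℕ → ℕ,
          (∀ r' j, r' ≠ r → g r' j = τ.arr a_S r' j) →
          (∀ r' j, r' ≠ r → g' r' j = τ.arr a_in r' j) →
          ∀ r', ¬ r' = r → g r' = σ.arr a_S r' ∧ g' r' = σ.arr a_in r' := by
        intro g g' hg hg' r' hr'
        rw [← (h5 r' hr').1, ← (h5 r' hr').2]
        exact ⟨funext fun j => hg r' j hr', funext fun j => hg' r' j hr'⟩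
      and_intros
      all_goals first | omega | intro hm
      · refine ⟨hcard.symm, ?_, hS _ fun j => by simp, hmem, hrest _ _ ?_ ?_⟩
        · rw [hsup, max_eq_left]; omega
        · intro r' j hr'; simp [hr']
        · intro r' j hr'; simp [hr']
      · refine ⟨hcard.symm, ?_, hS _ fun j => by simp, hmem, hrest _ _ ?_ ?_⟩
        · rw [hsup, max_eq_right]; omega
        · intro r' j hr'; simp [hr']
        · intro r' j hr'; simp [hr']
    · rw [rankSet_succ_of_eq h]
      exact ⟨rfl, rfl, h1 ▸ h3, h4, h5⟩
  · rintro t τ ht hI hf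
    simp at ht
    exact ⟨by simp; omega, hI⟩

/-- Gives the next rank to vertex `v_a`. -/
def insertVertex : Cmd :=
  collect ;; .put a_S †v_r †v_cnt †v_r ;; .put a_size 0 †v_r †v_cnt ;;
    .put a_par 0 †v_r (†v_max - 1) ;; v_r ::= †v_r + 1 ;; .put a_rank 0 †v_a †v_r

theorem sup_succ {X : Finset ℕ} (hX : X.Nonempty) : X.sup Nat.succ - 1 = X.sup id := by
  obtain ⟨a, ha, h⟩ := Finset.exists_mem_eq_sup X hX Nat.succ
  rw [h, Nat.succ_sub_one]
  refine le_antisymm (Finset.le_sup (f := id) ha) (Finset.sup_le fun b hb => ?_)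
  have : Nat.succ b ≤ Nat.succ a := h ▸ Finset.le_sup (f := Nat.succ) hb
  exact Nat.succ_le_succ_iff.1 this

/-- The row is collected before the vertex receives its own rank, so it holds earlier vertices only.
The vertex itself is stored behind the last entry, and thus the row lists the whole bag when read
one step further. -/
theorem wp_insertVertex {B n r st sz v : ℕ} {el : ℕ → ℕ} {σ : Env} (hvB : σ.var v_B = B)
    (hr : σ.var v_r = r) (hx : σ.var v_x = st) (hs : σ.var v_s = sz) (hv : σ.var v_a = v)
    (hcell : ∀ l < sz, σ.cell (st + 1 + l) = el l) (hinj : ∀ l < sz, ∀ j < sz, el l = el j → l = j)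
    (hB : 16 * (n + st + sz + 2) ≤ B) (hrn : r < n) (hel : ∀ l < sz, el l < n) (hvn : v < n)
    (hrank : ∀ v, σ.arr a_rank 0 v ≤ n)
    (hrinj : ∀ u v, σ.arr a_rank 0 u ≠ 0 → σ.arr a_rank 0 u = σ.arr a_rank 0 v → u = v)
    (hin : ∀ u, σ.arr a_in r u = 0) :
    wp B insertVertex (fun t τ => t ≤ 100 * (sz + 2) ∧ τ.var v_r = r + 1 ∧
      (∀ u, τ.arr a_rank 0 u = if u = v then r + 1 else σ.arr a_rank 0 u) ∧
      Row (rankSet (σ.arr a_rank 0) el sz) r τ ∧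
      ∀ r' ≠ r, τ.arr a_S r' = σ.arr a_S r' ∧ τ.arr a_in r' = σ.arr a_in r' ∧
        τ.arr a_size 0 r' = σ.arr a_size 0 r' ∧ τ.arr a_par 0 r' = σ.arr a_par 0 r') σ := by
  rw [insertVertex, wp_seq]
  refine (wp_collect hvB hr hx hs hcell hinj hB hrn hel hrank hrinj hin).mono ?_
  rintro t τ ⟨ht, h1, h2, h3, h4, h5⟩ hf
  have hv0 := hf.var v_B (by decide)
  have hvr := hf.var v_r (by decide)
  have hva := hf.var v_a (by decide)
  have hrk := hf.arr a_rank (by decide)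
  have hsz := hf.arr a_size (by decide)
  have hpa := hf.arr a_par (by decide)
  have hle := card_rankSet_le (σ.arr a_rank 0) el sz
  rw [h1] at h3
  simp [hv0, hvr, hvB, hr, hva, hv, h1, h2, hrk, hsz, hpa]
  and_intros
  all_goals first | omega | skip
  · constructor
    · simp
    · conv_rhs => rw [← h3]
      refine Finset.image_congr fun j hj => ?_
      have : j < (rankSet (σ.arr a_rank 0) el sz).card := by simpa using hj
      simp [this.ne]
    · simp
    · intro hX
      simpa using sup_succ hX
    · simpa using h4
  · intro r' hr'
    refine ⟨?_, ?_, fun h => absurd h hr', fun h => absurd h hr'⟩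
    · rw [← (h5 r' hr').1]
      funext j
      simp [hr']
    · rw [← (h5 r' hr').2]
      funext j
      simp [hr']

/-- The bag of the `i`-th node in the order `q` is the first one that contains `v`. -/
def TopAt (q len : ℕ → ℕ) (el : ℕ → ℕ → ℕ) (i v : ℕ) : Prop :=
  (∃ j < len (q i), el (q i) j = v) ∧ ∀ i' < i, ∀ j < len (q i'), el (q i') j ≠ v

theorem TopAt.unique {q len : ℕ → ℕ} {el : ℕ → ℕ → ℕ} {i i' v : ℕ} (h : TopAt q len el i v)
    (h' : TopAt q len el i' v) : i = i' := by
  obtain ⟨⟨j, hj, he⟩, h2⟩ := h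
  obtain ⟨⟨j', hj', he'⟩, h2'⟩ := h'
  rcases lt_trichotomy i i' with h | h | h
  · exact absurd he (h2' i h j hj)
  · exact h
  · exact absurd he' (h2 i' h j' hj')

/-- The vertices satisfying `D` have received ranks, in the order of their first bags, which are
among the first `i + 1` bags. -/
structure Ordered (n : ℕ) (q len : ℕ → ℕ) (el : ℕ → ℕ → ℕ) (i : ℕ) (D : ℕ → Prop) (σ : Env) :
    Prop where
  card : ((Finset.range n).filter fun v => σ.arr a_rank 0 v ≠ 0).card = σ.var v_r
  dom : ∀ v, σ.arr a_rank 0 v ≠ 0 ↔ D v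
  le : ∀ v, σ.arr a_rank 0 v ≤ σ.var v_r
  inj : ∀ u v, σ.arr a_rank 0 u ≠ 0 → σ.arr a_rank 0 u = σ.arr a_rank 0 v → u = v
  row : ∀ v, σ.arr a_rank 0 v ≠ 0 → ∃ a ≤ i, TopAt q len el a v ∧
    Row ((rankSet (σ.arr a_rank 0) (el (q a)) (len (q a))).filter (· < σ.arr a_rank 0 v - 1))
      (σ.arr a_rank 0 v - 1) σ
  mono : ∀ u v a b, σ.arr a_rank 0 u ≠ 0 → σ.arr a_rank 0 u ≤ σ.arr a_rank 0 v →
    TopAt q len el a u → TopAt q len el b v → a ≤ b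
  fresh : ∀ r ≥ σ.var v_r, ∀ u, σ.arr a_in r u = 0

theorem Ordered.congr {n i i' : ℕ} {q len : ℕ → ℕ} {el : ℕ → ℕ → ℕ} {D D' : ℕ → Prop} {σ τ : Env}
    (h : Ordered n q len el i D σ) (hi : i ≤ i') (hD : ∀ v, D v ↔ D' v)
    (hr : τ.var v_r = σ.var v_r) (ha : τ.arr = σ.arr) : Ordered n q len el i' D' τ := by
  obtain ⟨h1, h2, h3, h4, h5, h6, h7⟩ := h
  refine ⟨?_, ?_, ?_, ?_, ?_, ?_, ?_⟩
  · rw [ha, hr]; exact h1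
  · rw [ha]; exact fun v => (h2 v).trans (hD v)
  · rw [ha, hr]; exact h3
  · rw [ha]; exact h4
  · rw [ha]
    intro v hv
    obtain ⟨a, hai, ht, hR⟩ := h5 v hv
    exact ⟨a, hai.trans hi, ht, hR.congr (by rw [ha]) (by rw [ha]) (by rw [ha]) (by rw [ha])⟩
  · rw [ha]; exact h6
  · rw [ha, hr]; exact h7

/-- Rows are described by the current ranks, but filtered by smaller rank. The new rank exceeds all
existing ones, so the filter removes the new vertex from every older row, and the description of
that row stays valid. Monotonicity persists because the new vertex has the latest first bag so far.
-/
theorem Ordered.insert {n i v : ℕ} {q len : ℕ → ℕ} {el : ℕ → ℕ → ℕ} {D D' : ℕ → Prop} {σ τ : Env}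
    (h : Ordered n q len el i D σ) (hD : ∀ u, D' u ↔ D u ∨ u = v) (hv : ¬ D v) (hvn : v < n)
    (htop : TopAt q len el i v) (hr : τ.var v_r = σ.var v_r + 1)
    (hrank : ∀ u, τ.arr a_rank 0 u = if u = v then σ.var v_r + 1 else σ.arr a_rank 0 u)
    (hrow : Row (rankSet (σ.arr a_rank 0) (el (q i)) (len (q i))) (σ.var v_r) τ)
    (hrest : ∀ r' ≠ σ.var v_r, τ.arr a_S r' = σ.arr a_S r' ∧ τ.arr a_in r' = σ.arr a_in r' ∧
        τ.arr a_size 0 r' = σ.arr a_size 0 r' ∧ τ.arr a_par 0 r' = σ.arr a_par 0 r') :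
    Ordered n q len el i D' τ := by
  have hv0 : σ.arr a_rank 0 v = 0 := by
    by_contra hc
    exact hv ((h.dom v).1 hc)
  have hrv : τ.arr a_rank 0 v = σ.var v_r + 1 := by rw [hrank, if_pos rfl]
  have hold : ∀ u, u ≠ v → τ.arr a_rank 0 u = σ.arr a_rank 0 u := fun u hu => by
    rw [hrank, if_neg hu]
  have htopi : ∀ u a, σ.arr a_rank 0 u ≠ 0 → TopAt q len el a u → a ≤ i := by
    intro u a hu ha
    obtain ⟨b, hb, hb', -⟩ := h.row u hu
    exact (ha.unique hb') ▸ hb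
  refine ⟨?_, fun u => ?_, fun u => ?_, fun u w hu he => ?_, fun u hu => ?_,
    fun u w a b hu hle hta htb => ?_, fun r hr' u => ?_⟩
  · have : ((Finset.range n).filter fun u => τ.arr a_rank 0 u ≠ 0) =
        Insert.insert v ((Finset.range n).filter fun u => σ.arr a_rank 0 u ≠ 0) := by
      ext u
      simp only [Finset.mem_filter, Finset.mem_range, Finset.mem_insert]
      by_cases hu : u = v
      · subst hu; simp [hrv, hvn]
      · simp [hu, hold u hu]
    rw [this, Finset.card_insert_of_notMem (by simp [hv0]), h.card, hr]
  · rw [hD, ← h.dom]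
    by_cases hu : u = v
    · subst hu; simp [hrv]
    · simp [hu, hold u hu]
  · rw [hr]
    by_cases hu : u = v
    · subst hu; omega
    · rw [hold u hu]; have := h.le u; omega
  · by_cases hu' : u = v <;> by_cases hw : w = v
    · rw [hu', hw]
    · subst hu'
      rw [hrv, hold w hw] at he
      have := h.le w
      omega
    · subst hw
      rw [hrv, hold u hu'] at he
      have := h.le u
      omega
    · rw [hold u hu'] at hu he
      rw [hold w hw] at he
      exact h.inj u w hu he
  · by_cases hu' : u = v
    · subst hu'
      refine ⟨i, le_rfl, htop, ?_⟩
      rw [hrv, Nat.add_sub_cancel]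
      convert hrow using 1
      ext c
      simp only [Finset.mem_filter, mem_rankSet]
      constructor
      · rintro ⟨⟨j, hj, he⟩, hc⟩
        refine ⟨j, hj, ?_⟩
        rwa [hold] at he
        intro h'
        rw [h', hrv] at he
        omega
      · rintro ⟨j, hj, he⟩
        have := h.le (el (q i) j)
        refine ⟨⟨j, hj, ?_⟩, by omega⟩
        rwa [hold]
        rintro h'
        rw [h', hv0] at he
        omega
    · rw [hold u hu'] at hu ⊢
      obtain ⟨a, ha, hta, hR⟩ := h.row u hu
      refine ⟨a, ha, hta, ?_⟩
      have hlu := h.le u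
      obtain ⟨e1, e2, e3, e4⟩ := hrest (σ.arr a_rank 0 u - 1) (by omega)
      have := hR.congr e3 e1 e4 e2
      convert this using 1
      ext c
      simp only [Finset.mem_filter, mem_rankSet]
      refine and_congr_left fun hc => exists_congr fun j => and_congr_right fun hj => ?_
      by_cases h' : el (q a) j = v
      · rw [h', hrv, hv0]; omega
      · rw [hold _ h']
  · by_cases hw : w = v
    · subst hw
      rw [htb.unique htop]
      by_cases hu' : u = w
      · subst hu'
        rw [hta.unique htop]
      · rw [hold u hu'] at hu
        exact htopi u a hu hta
    · by_cases hu' : u = v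
      · subst hu'
        rw [hrv, hold w hw] at hle
        have := h.le w
        omega
      · rw [hold u hu'] at hu hle
        rw [hold w hw] at hle
        exact h.mono u w a b hu hle hta htb
  · rw [(hrest r (by omega)).2.1]
    exact h.fresh r (by omega) u

/-- Ranks the vertices in the order in which they appear in the bags of the traversal. -/
def order : Cmd :=
  v_r ::= 0 ;;
  .forTo v_i v_iEnd †v_N
    (v_x ::= .get a_start 0 (.get a_queue 0 †v_i) ;; v_s ::= .raw †v_x ;;
      .forTo v_j v_jEnd †v_s
        (v_a ::= .raw (†v_x + 1 + †v_j) ;; .ite (.get a_rank 0 †v_a) .skip insertVertex))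

/-- An entry of a bag costs constant time, except that the first occurrence of a vertex triggers a
scan of the whole bag. There are at most `n` first occurrences, each of cost `O(K)`. -/
theorem wp_order {B N n K : ℕ} {q off len : ℕ → ℕ} {el : ℕ → ℕ → ℕ} {σ : Env}
    (hvB : σ.var v_B = B) (hN : σ.var v_N = N) (hqN : ∀ i < N, q i < N)
    (hq : ∀ i < N, σ.arr a_queue 0 i = q i) (hqinj : ∀ i < N, ∀ j < N, q i = q j → i = j)
    (hstart : ∀ x < N, σ.arr a_start 0 x = off x)
    (hcell : ∀ x < N, σ.cell (off x) = len x)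
    (hel : ∀ x < N, ∀ j < len x, σ.cell (off x + 1 + j) = el x j ∧ el x j < n)
    (hinj : ∀ x < N, ∀ l < len x, ∀ j < len x, el x l = el x j → l = j)
    (hB : ∀ x < N, 16 * (n + N + off x + len x + 2) ≤ B) (hK : ∀ x < N, len x ≤ K) (hN0 : 0 < N)
    (h0 : ∀ v, σ.arr a_rank 0 v = 0) (h1 : ∀ r u, σ.arr a_in r u = 0) :
    wp B order (fun t τ => t ≤ 100 * (∑ x ∈ Finset.range N, (len x + 1)) + 100 * (K + 3) * n + 100 ∧
      Ordered n q len el N (fun v => ∃ i < N, ∃ j < len (q i), el (q i) j = v) τ) σ := by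
  have hB0 := hB 0 hN0
  simp only [order, wp_seq, wp_assign]
  refine ⟨by simp; omega, ?_⟩
  refine wp_forTo (fun i t τ =>
    Ordered n q len el i (fun v => ∃ a < i, ∃ j < len (q a), el (q a) j = v) τ ∧
    t ≤ 60 * (∑ x ∈ Finset.range i, (len (q x) + 1)) + 100 * (K + 3) * τ.var v_r) N
    (by decide) (by decide) (by decide) (by omega) (by simp) (by simp [hN]) ?_ ?_ ?_
  · refine ⟨⟨?_, ?_, ?_, ?_, ?_, ?_, ?_⟩, ?_⟩ <;> simp [h0, h1]
  · rintro i hi t τ hvi - hf ⟨hO, ht⟩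
    have hv0 := hf.var v_B (by decide)
    have hst := hf.arr a_start (by decide)
    have hqu := hf.arr a_queue (by decide)
    have hc := hf.cell (by decide)
    simp [hvB] at hv0 hst hqu hc
    have hqi := hqN i hi
    have hBi := hB _ hqi
    simp only [wp_seq, wp_assign]
    refine ⟨by simp [hv0, hvi, hqu, hq i hi]; omega, ?_, ?_⟩
    · simp [hvi, hqu, hq i hi, hst, hstart _ hqi]
      omega
    refine wp_forTo (fun j t' τ' =>
      Ordered n q len el i (fun v => (∃ a < i, ∃ j < len (q a), el (q a) j = v) ∨
        ∃ l < j, el (q i) l = v) τ' ∧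
      t + t' ≤ 60 * (∑ x ∈ Finset.range i, (len (q x) + 1)) + 100 * (K + 3) * τ'.var v_r + 40 * j)
      (len (q i)) (by decide) (by decide) (by decide) (by omega) (by simp)
      (by simp [hvi, hqu, hq i hi, hst, hstart _ hqi, hc, hcell _ hqi]) ?_ ?_ ?_
    · exact ⟨hO.congr le_rfl (by simp) (by simp) rfl, by simpa using ht⟩
    · rintro j hj t' τ' hvj - hf' ⟨hO', ht'⟩
      have hx' := hf'.var v_x (by decide)
      have hs' := hf'.var v_s (by decide)
      have hv0' := hf'.var v_B (by decide)
      have hc' := hf'.cell (by decide)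
      simp [hvi, hqu, hq i hi, hst, hstart _ hqi, hc, hcell _ hqi, hv0] at hx' hs' hv0' hc'
      obtain ⟨hcj, hjn⟩ := hel _ hqi j hj
      have hrle : τ'.var v_r ≤ n := by
        rw [← hO'.card]
        simpa using Finset.card_filter_le (Finset.range n) fun v => τ'.arr a_rank 0 v ≠ 0
      simp only [wp_seq, wp_assign, wp_ite, wp_skip]
      refine ⟨by simp [hx', hvj]; omega, by simp [hv0', hx', hvj, hc', hcj]; omega, ?_, ?_⟩
      · intro hne
        simp [hx', hvj, hc', hcj] at hne
        refine ⟨hO'.congr le_rfl (fun v => ⟨Or.imp_right fun ⟨l, hl, h⟩ => ⟨l, by omega, h⟩, ?_⟩)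
          (by simp) rfl, ?_⟩
        · rintro (h | ⟨l, hl, rfl⟩)
          · exact .inl h
          · rcases Nat.lt_succ_iff_lt_or_eq.1 hl with hl | rfl
            · exact .inr ⟨l, hl, rfl⟩
            · exact (hO'.dom _).1 hne
        · simp; omega
      · intro he
        simp [hx', hvj, hc', hcj] at he
        have hD := mt (hO'.dom (el (q i) j)).2 (by simpa using he)
        have hlt : τ'.var v_r < n := by
          rw [← hO'.card]
          calc _ < (Finset.range n).card := Finset.card_lt_card ?_
            _ = n := by simp
          refine Finset.filter_ssubset.2 ⟨el (q i) j, by simpa using hjn, by simpa using he⟩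
        refine (wp_insertVertex (n := n) (r := τ'.var v_r) (st := off (q i)) (sz := len (q i))
          (v := el (q i) j) (el := el (q i)) (by simpa using hv0') (by simp) (by simpa using hx')
          (by simpa using hs') (by simp [hx', hvj, hc', hcj]) ?_ (hinj _ hqi) (by omega) hlt
          (fun l hl => (hel _ hqi l hl).2) hjn ?_ ?_ ?_).mono ?_
        · intro l hl
          simpa [hc'] using (hel _ hqi l hl).1
        · intro v
          exact (hO'.le v).trans hrle
        · exact hO'.inj
        · exact hO'.fresh _ le_rfl
        · rintro t'' τ'' ⟨ht'', hr'', hrk'', hrow'', hrest''⟩ hf''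
          simp only [Env.set_arr] at hrk'' hrow'' hrest''
          refine ⟨(hO'.insert (v := el (q i) j) ?_ hD hjn ⟨⟨j, hj, rfl⟩, ?_⟩ hr'' hrk'' hrow''
            hrest'').congr le_rfl (fun _ => Iff.rfl) (by simp) rfl, ?_⟩
          · intro u
            rw [or_assoc]
            refine or_congr_right ⟨fun ⟨l, hl, h⟩ => ?_, ?_⟩
            · rcases Nat.lt_succ_iff_lt_or_eq.1 hl with hl | rfl
              · exact .inl ⟨l, hl, h⟩
              · exact .inr h.symm
            · rintro (⟨l, hl, h⟩ | h)
              · exact ⟨l, by omega, h⟩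
              · exact ⟨j, by omega, h.symm⟩
          · intro a ha l hl h
            exact hD (.inl ⟨a, ha, l, hl, h⟩)
          · have := hK _ hqi
            have h3 : τ''.var v_r = τ'.var v_r + 1 := hr''
            simp [h3]
            linarith
    · rintro t' τ' ⟨hO', ht'⟩ hf'
      refine ⟨hO'.congr (by omega) (fun v => ?_) (by simp) rfl, ?_⟩
      · constructor
        · rintro (⟨a, ha, h⟩ | h)
          · exact ⟨a, by omega, h⟩
          · exact ⟨i, by omega, h⟩
        · rintro ⟨a, ha, h⟩
          rcases Nat.lt_succ_iff_lt_or_eq.1 ha with ha | rfl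
          · exact .inl ⟨a, ha, h⟩
          · exact .inr h
      · rw [Finset.sum_range_succ]
        simp
        linarith
  · rintro t τ ⟨hO, ht⟩ hf
    have hrle : τ.var v_r ≤ n := by
      rw [← hO.card]
      simpa using Finset.card_filter_le (Finset.range n) fun v => τ.arr a_rank 0 v ≠ 0
    rw [sum_range_comp hqN hqinj fun x => len x + 1] at ht
    refine ⟨?_, hO⟩
    have h2 : 100 * (K + 3) * τ.var v_r ≤ 100 * (K + 3) * n := Nat.mul_le_mul_left _ hrle
    have h3 : N ≤ ∑ x ∈ Finset.range N, (len x + 1) := by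
      rw [Finset.sum_add_distrib]; simp
    simp only [cost_ofNat, cost_var]
    linarith

end Loop

/-! ### Adjacency matrix, powers of two, and the quadratic algorithm -/

namespace Loop

/-- Computes the reflexive adjacency matrix of the renumbered graph. -/
def adjacency : Cmd :=
  .forTo v_i v_iEnd †v_n (.put a_adj †v_i †v_i 1) ;; v_pos ::= 3 ;;
  .forTo v_i v_iEnd †v_m
    (v_a ::= .get a_rank 0 (.raw †v_pos) - 1 ;; v_b ::= .get a_rank 0 (.raw (†v_pos + 1)) - 1 ;;
      v_pos ::= †v_pos + 2 ;; .put a_adj †v_a †v_b 1 ;; .put a_adj †v_b †v_a 1)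

/-- The input contains the list of the edges between `xe e` and `ye e`, where `xe` and `ye` are the
ranks of the end vertices. -/
structure EdgeList (n m : ℕ) (xe ye : ℕ → ℕ) (σ : Env) : Prop where
  lt : ∀ e < m, xe e < n ∧ ye e < n
  cell : ∀ e < m, σ.cell (3 + 2 * e) < n ∧ σ.cell (3 + 2 * e + 1) < n
  fst : ∀ e < m, σ.arr a_rank 0 (σ.cell (3 + 2 * e)) = xe e + 1
  snd : ∀ e < m, σ.arr a_rank 0 (σ.cell (3 + 2 * e + 1)) = ye e + 1

theorem EdgeList.congr {n m : ℕ} {xe ye : ℕ → ℕ} {σ τ : Env} (h : EdgeList n m xe ye σ)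
    (h1 : τ.arr a_rank = σ.arr a_rank) (h2 : τ.cell = σ.cell) : EdgeList n m xe ye τ :=
  ⟨h.lt, h2 ▸ h.cell, h1 ▸ h2 ▸ h.fst, h1 ▸ h2 ▸ h.snd⟩

/-- `a` and `b` are the ends of one of the first `m` edges. -/
def Joined (m : ℕ) (xe ye : ℕ → ℕ) (a b : ℕ) : Prop :=
  ∃ e < m, a = xe e ∧ b = ye e ∨ a = ye e ∧ b = xe e

theorem joined_succ {m : ℕ} {xe ye : ℕ → ℕ} {a b : ℕ} : Joined (m + 1) xe ye a b ↔
    Joined m xe ye a b ∨ a = xe m ∧ b = ye m ∨ a = ye m ∧ b = xe m := by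
  constructor
  · rintro ⟨e, he, h⟩
    rcases Nat.lt_succ_iff_lt_or_eq.1 he with he | rfl
    · exact .inl ⟨e, he, h⟩
    · exact .inr h
  · rintro (⟨e, he, h⟩ | h)
    · exact ⟨e, by omega, h⟩
    · exact ⟨m, by omega, h⟩

/-- The matrix has quadratic size, but only linearly many entries are written; the others are `0`
from the start, by `h0`. -/
theorem wp_adjacency {B n m : ℕ} {xe ye : ℕ → ℕ} {σ : Env} (hvB : σ.var v_B = B)
    (hn : σ.var v_n = n) (hm : σ.var v_m = m) (hB : 16 * (n + 2 * m + 3) ≤ B)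
    (hE : EdgeList n m xe ye σ) (h0 : ∀ a b, σ.arr a_adj a b = 0) :
    wp B adjacency (fun t τ => t ≤ 150 * (n + m + 1) ∧
      ∀ a < n, ∀ b < n, τ.arr a_adj a b ≠ 0 ↔ a = b ∨ Joined m xe ye a b) σ := by
  simp only [adjacency, wp_seq]
  refine wp_for (fun i τ => ∀ a b, τ.arr a_adj a b ≠ 0 ↔ a = b ∧ a < i) n 30
    (by decide) (by decide) (by decide) (by omega) (by simp) (by simp [hn]) (by simp [h0]) ?_ ?_
  · rintro i hi τ hvi - hf hI
    have hv0 := hf.var v_B (by decide)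
    simp [hv0, hvB, hvi]
    and_intros
    all_goals first | omega | skip
    intro a b
    have := hI a b
    split_ifs with h
    · simp [h.1, h.2]
    · rw [← ne_eq, this]; omega
  rintro t τ ht hI hf
  have hv0 := hf.var v_B (by decide)
  have hvm := hf.var v_m (by decide)
  have hE1 := hE.congr (hf.arr a_rank (by decide)) (hf.cell (by decide))
  simp only [wp_assign]
  refine ⟨by simp; omega, ?_⟩
  refine wp_for (fun i τ => τ.var v_pos = 3 + 2 * i ∧
    ∀ a < n, ∀ b < n, τ.arr a_adj a b ≠ 0 ↔ a = b ∨ Joined i xe ye a b) m 100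
    (by decide) (by decide) (by decide) (by omega) (by simp) (by simp [hvm, hm])
    ⟨by simp, fun a ha b hb => ?_⟩ ?_ ?_
  · have : ¬ Joined 0 xe ye a b := by rintro ⟨e, he, -⟩; omega
    simp only [Env.set_arr, hI, this, or_false]
    omega
  · rintro i hi τ' hvi - hf' ⟨hp, hI'⟩
    have hv0' := hf'.var v_B (by decide)
    have hrk := hf'.arr a_rank (by decide)
    have hc := hf'.cell (by decide)
    have h1 := hE1.lt i hi
    have h2 := hE1.fst i hi
    have h3 := hE1.snd i hi
    have h4 := hE1.cell i hi
    simp [hv0, hvB] at hv0' hrk hc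
    simp [hv0', hp, hrk, hc, h2, h3]
    and_intros
    all_goals first | omega | skip
    intro a ha b hb
    rw [joined_succ, ← or_assoc, ← hI' a ha b hb]
    split_ifs with h h'
    · simp [h]
    · simp [h']
    · rw [← ne_eq]; tauto
  · rintro t' τ' ht' hI' -
    simp at ht ht'
    exact ⟨by simp; omega, hI'.2⟩

/-- Computes the powers `2 ^ c` for `c < k` and `2 ^ k`, unless one of the former exceeds the number
of vertices. -/
def powers : Cmd :=
  v_P ::= 1 ;; v_big ::= 0 ;;
  .forTo v_c v_cEnd †v_k
    (.ite (†v_n + 1 - †v_P) (.put a_pow 0 †v_c †v_P ;; v_P ::= †v_P + †v_P) (v_big ::= 1))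

/-- A power is entered only if it is at most `n`, so a run without exception ends with `2 ^ k ≤ 2
n`. An exception shows that some `2 ^ c` with `c < k` exceeds `n`. -/
theorem wp_powers {B n k : ℕ} {σ : Env} (hvB : σ.var v_B = B) (hn : σ.var v_n = n)
    (hk : σ.var v_k = k) (hB : 16 * (n + k + 1) ≤ B) (hn0 : 0 < n) :
    wp B powers (fun t τ => t ≤ 100 * (k + 1) ∧
      (τ.var v_big = 0 ∧ τ.var v_P = 2 ^ k ∧ 2 ^ k ≤ 2 * n ∧ (∀ c < k, τ.arr a_pow 0 c = 2 ^ c) ∨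
        τ.var v_big ≠ 0 ∧ n < 2 ^ (k - 1))) σ := by
  simp only [powers, wp_seq, wp_assign]
  refine ⟨by simp; omega, by simp; omega, ?_⟩
  refine wp_for (fun i τ =>
      τ.var v_big = 0 ∧ τ.var v_P = 2 ^ i ∧ 2 ^ i ≤ 2 * n ∧ (∀ c < i, τ.arr a_pow 0 c = 2 ^ c) ∨
        τ.var v_big ≠ 0 ∧ n < 2 ^ (k - 1) ∧ n < τ.var v_P) k 60
    (by decide) (by decide) (by decide) (by omega) (by simp) (by simp [hk])
    (.inl ⟨by simp, by simp, by omega, by simp⟩) ?_ ?_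
  · rintro i hi τ hvi - hf hI
    have hv0 := hf.var v_B (by decide)
    have hvn := hf.var v_n (by decide)
    simp [hvB, hn] at hv0 hvn
    rcases hI with ⟨h1, h2, h3, h4⟩ | ⟨h1, h2, h3⟩
    · have hmono : 2 ^ i ≤ 2 ^ (k - 1) := Nat.pow_le_pow_right (by omega) (by omega)
      simp [hv0, hvn, hvi, h1, h2]
      refine ⟨⟨by omega, by omega⟩, fun h => ?_, fun h => ⟨by omega, by omega⟩⟩
      refine ⟨⟨by omega, by omega⟩, by omega, by rw [pow_succ]; omega, by rw [pow_succ]; omega,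
        fun c hc => ?_⟩
      split_ifs with h'
      · rw [h']
      · exact h4 c (by omega)
    · have : n + 1 - τ.var v_P = 0 := by omega
      simp [hvn, this, h2, h3]
      omega
  · rintro t τ ht hI -
    simp at ht
    refine ⟨by simp; omega, hI.imp_right fun h => ⟨h.1, h.2.1⟩⟩

/-- Marks the pair `(v_a, v_b)` and counts it, unless it has been marked before. -/
def mark : Cmd :=
  .ite (.get a_near †v_a †v_b) .skip
    (.put a_near †v_a †v_b 1 ;; .put a_ans 0 †v_a (.get a_ans 0 †v_a + 1))

open Classical in
/-- The marked pairs are those in `M`; they have been counted. -/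
structure Marked (n : ℕ) (M : ℕ → ℕ → Prop) (σ : Env) : Prop where
  near : ∀ a b, σ.arr a_near a b ≠ 0 ↔ M a b
  ans : ∀ a, σ.arr a_ans 0 a = ((Finset.range n).filter fun b => M a b).card

theorem Marked.congr {n : ℕ} {M M' : ℕ → ℕ → Prop} {σ τ : Env} (h : Marked n M σ)
    (hM : ∀ a b, M a b ↔ M' a b) (h1 : τ.arr a_near = σ.arr a_near)
    (h2 : τ.arr a_ans = σ.arr a_ans) : Marked n M' τ := by
  obtain rfl : M = M' := by funext a b; exact propext (hM a b)
  exact ⟨h1 ▸ h.near, h2 ▸ h.ans⟩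

theorem wp_mark {B n a b : ℕ} {M M' : ℕ → ℕ → Prop} {σ : Env} (hvB : σ.var v_B = B)
    (ha : σ.var v_a = a) (hb : σ.var v_b = b) (han : a < n) (hbn : b < n) (hB : 16 * (n + 1) ≤ B)
    (h : Marked n M σ) (hM : ∀ x y, M' x y ↔ M x y ∨ x = a ∧ y = b) :
    wp B mark (fun t τ => t ≤ 60 ∧ Marked n M' τ) σ := by
  classical
  have hle : σ.arr a_ans 0 a ≤ n := by
    rw [h.ans]
    simpa using Finset.card_filter_le (Finset.range n) fun b => M a b
  simp [mark, ha, hb, hvB]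
  refine ⟨by omega, fun hne => h.congr (fun x y => ?_) rfl rfl, fun he => ?_⟩
  · rw [hM]
    refine ⟨.inl, ?_⟩
    rintro (h' | ⟨rfl, rfl⟩)
    · exact h'
    · exact (h.near x y).1 hne
  · have hnM : ¬ M a b := fun hc => (h.near a b).2 hc he
    and_intros
    all_goals first | omega | skip
    constructor
    · intro x y
      rw [hM, ← h.near]
      simp
      split_ifs with h'
      · simp [h']
      · simp [h']
    · intro x
      by_cases hx : x = a
      · subst hx
        have : ((Finset.range n).filter fun y => M' x y) =
            insert b ((Finset.range n).filter fun y => M x y) := by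
          ext y
          simp only [Finset.mem_filter, Finset.mem_range, Finset.mem_insert, hM]
          constructor
          · tauto
          · rintro (rfl | h')
            · exact ⟨hbn, by tauto⟩
            · tauto
        rw [this, Finset.card_insert_of_notMem (by simp [hnM]), ← h.ans]
        simp
      · simp [hx, h.ans]
        congr 1
        ext y
        simp [hM, hx]

/-- Marks all pairs of vertices at distance at most two, in quadratic time. -/
def brute : Cmd :=
  .forTo v_i v_iEnd †v_n
    (v_a ::= †v_i ;; v_b ::= †v_i ;; mark ;; v_pos ::= 3 ;;
      .forTo v_j v_jEnd †v_m
        (v_x ::= .get a_rank 0 (.raw †v_pos) - 1 ;; v_z ::= .get a_rank 0 (.raw (†v_pos + 1)) - 1 ;;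
          v_pos ::= †v_pos + 2 ;;
          .ite (.get a_adj †v_a †v_x) (v_b ::= †v_z ;; mark) .skip ;;
          .ite (.get a_adj †v_a †v_z) (v_b ::= †v_x ;; mark) .skip))

/-- A vertex other than `i` within distance two of `i` is an end of an edge whose other end is `i`
or a neighbour of `i`. The reflexive matrix treats these cases alike, so one pass over the edges per
vertex suffices, with both orientations tried. -/
theorem wp_brute {B n m : ℕ} {xe ye : ℕ → ℕ} {A : ℕ → ℕ → Prop} {σ : Env} (hvB : σ.var v_B = B)
    (hn : σ.var v_n = n) (hm : σ.var v_m = m) (hB : 16 * (n + 2 * m + 3) ≤ B)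
    (hE : EdgeList n m xe ye σ) (hA : ∀ a b, A a b ↔ a < n ∧ b < n ∧ (a = b ∨ Joined m xe ye a b))
    (hadj : ∀ a < n, ∀ b < n, σ.arr a_adj a b ≠ 0 ↔ A a b)
    (h0 : Marked n (fun _ _ => False) σ) :
    wp B brute (fun t τ => t ≤ 400 * (n * (m + 1) + 1) ∧ Marked n (Elim.Near A) τ) σ := by
  simp only [brute]
  refine wp_for (fun i τ => Marked n (fun a b => a < i ∧ Elim.Near A a b) τ) n (300 * (m + 1))
    (by decide) (by decide) (by decide) (by omega) (by simp) (by simp [hn])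
    (h0.congr (by simp) rfl rfl) ?_ ?_
  · rintro i hi τ hvi - hf hI
    have hv0 := hf.var v_B (by decide)
    have hvm := hf.var v_m (by decide)
    have hE1 := hE.congr (hf.arr a_rank (by decide)) (hf.cell (by decide))
    have had := hf.arr a_adj (by decide)
    rw [hvB] at hv0
    rw [hm] at hvm
    simp only [wp_seq, wp_assign]
    refine ⟨by simp, by simp, ?_⟩
    refine (wp_mark (n := n) (a := i) (b := i) (by simpa using hv0) (by simp [hvi]) (by simp [hvi])
      hi hi (by omega) (hI.congr (fun _ _ => Iff.rfl) (by simp) (by simp)) fun _ _ => Iff.rfl).mono ?_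
    rintro t1 τ1 ⟨ht1, h1⟩ hf1
    have hv1 := hf1.var v_B (by decide)
    have hvm1 := hf1.var v_m (by decide)
    have hva1 := hf1.var v_a (by decide)
    have hE2 := hE1.congr (hf1.arr a_rank (by decide)) (hf1.cell (by decide))
    have had1 := hf1.arr a_adj (by decide)
    simp [had, hv0, hvm, hvi] at hv1 hvm1 hva1 had1
    refine ⟨by simp; omega, ?_⟩
    refine wp_for (fun j τ => τ.var v_pos = 3 + 2 * j ∧ Marked n (fun a b =>
      (a < i ∧ Elim.Near A a b ∨ a = i ∧ b = i) ∨ a = i ∧ ∃ e < j, A i (xe e) ∧ b = ye e ∨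
        A i (ye e) ∧ b = xe e) τ) m 240
      (by decide) (by decide) (by decide) (by omega) (by simp) (by simp [hvm1])
      ⟨by simp, h1.congr (by simp) rfl rfl⟩ ?_ ?_
    · rintro j hj τ2 hvj - hf2 ⟨hp, hI2⟩
      have hv2 := hf2.var v_B (by decide)
      have hva2 := hf2.var v_a (by decide)
      have hrk2 := hf2.arr a_rank (by decide)
      have hc2 := hf2.cell (by decide)
      have had2 := hf2.arr a_adj (by decide)
      simp [hv1, hva1, had1] at hv2 hva2 hrk2 hc2 had2
      have g1 := hE2.lt j hj
      have g2 := hE2.fst j hj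
      have g3 := hE2.snd j hj
      have g4 := hE2.cell j hj
      have q1 := hadj i hi _ g1.1
      have q2 := hadj i hi _ g1.2
      simp only [wp_seq, wp_assign]
      refine ⟨?_, ?_, ?_, ?_⟩
      · simp [hv2, hp, hc2]; omega
      · simp [hv2, hp, hc2]; omega
      · simp [hp]; omega
      let M1 : ℕ → ℕ → Prop := fun a b => (a < i ∧ Elim.Near A a b ∨ a = i ∧ b = i) ∨
        a = i ∧ ∃ e < j, A i (xe e) ∧ b = ye e ∨ A i (ye e) ∧ b = xe e
      -- The second test of the body, stated separately because both outcomes of the first test lead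
      -- to it. The numbers `80` are allowances for what has been executed before.
      have second : ∀ τ3 : Env, ∀ t3, t3 ≤ 80 → Marked n (fun a b => M1 a b ∨
          a = i ∧ A i (xe j) ∧ b = ye j) τ3 → τ3.var v_B = B → τ3.var v_a = i → τ3.var v_x = xe j →
          τ3.var v_z = ye j → τ3.var v_pos = 3 + 2 * (j + 1) → τ3.arr a_adj = σ.arr a_adj →
          wp B (.ite (.get a_adj †v_a †v_z) (v_b ::= †v_x ;; mark) .skip)
            (fun t' τ' => 80 + t3 + t' ≤ 240 ∧ (τ'.set v_j (j + 1)).var v_pos = 3 + 2 * (j + 1) ∧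
            Marked n (fun a b => (a < i ∧ Elim.Near A a b ∨ a = i ∧ b = i) ∨
              a = i ∧ ∃ e < j + 1, A i (xe e) ∧ b = ye e ∨ A i (ye e) ∧ b = xe e)
              (τ'.set v_j (j + 1))) τ3 := by
        intro τ3 t3 ht3 hM3 w1 w2 w3 w4 w5 w6
        have hconv : ∀ a b, ((M1 a b ∨ a = i ∧ A i (xe j) ∧ b = ye j) ∨
            a = i ∧ A i (ye j) ∧ b = xe j) ↔
            ((a < i ∧ Elim.Near A a b ∨ a = i ∧ b = i) ∨
              a = i ∧ ∃ e < j + 1, A i (xe e) ∧ b = ye e ∨ A i (ye e) ∧ b = xe e) := by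
          intro a b
          rw [or_assoc, or_assoc]
          refine or_congr_right ?_
          rw [← and_or_left, ← and_or_left]
          refine and_congr_right fun _ => ?_
          constructor
          · rintro (⟨e, he, h⟩ | h)
            · exact ⟨e, by omega, h⟩
            · exact ⟨j, by omega, h⟩
          · rintro ⟨e, he, h⟩
            rcases Nat.lt_succ_iff_lt_or_eq.1 he with he | rfl
            · exact .inl ⟨e, he, h⟩
            · exact .inr h
        simp only [wp_ite, wp_seq, wp_assign, wp_skip]
        refine ⟨by simp [w1, w2, w4]; omega, fun hne => ?_, fun he => ?_⟩
        · refine ⟨by simp, ?_⟩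
          refine (wp_mark (n := n) (a := i) (b := xe j) (by simpa using w1) (by simp [w2])
            (by simp [w3]) hi g1.1 (by omega) (hM3.congr (fun _ _ => Iff.rfl) (by simp) (by simp))
            (M' := fun a b => (M1 a b ∨ a = i ∧ A i (xe j) ∧ b = ye j) ∨
              a = i ∧ A i (ye j) ∧ b = xe j) ?_).mono ?_
          · simp [w2, w4, w6] at hne
            intro x y
            simp [q2.1 hne]
          · rintro t4 τ4 ⟨ht4, hM4⟩ hf4
            have := hf4.var v_pos (by decide)
            refine ⟨by simp; omega, by simpa [w5] using this, hM4.congr hconv (by simp) (by simp)⟩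
        · simp [w2, w4, w6] at he
          have : ¬ A i (ye j) := fun h => q2.2 h he
          refine ⟨by simp; omega, by simp [w5], hM3.congr (fun a b => ?_) (by simp) (by simp)⟩
          rw [← hconv]
          simp [this]
      simp only [wp_ite (c := v_b ::= †v_z ;; mark), wp_seq, wp_assign, wp_skip]
      refine ⟨by simp [hv2, hva2, hp, hc2, hrk2, g2]; omega, fun hne => ⟨by simp, ?_⟩, fun he => ?_⟩
      · simp [hp, hc2, hva2, had2, hrk2, g2] at hne
        refine (wp_mark (n := n) (a := i) (b := ye j) (by simpa using hv2) (by simp [hva2])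
          (by simp [hp, hc2, hrk2, g3]) hi g1.2 (by omega)
          (hI2.congr (fun _ _ => Iff.rfl) (by simp) (by simp))
          (M' := fun a b => M1 a b ∨ a = i ∧ A i (xe j) ∧ b = ye j) ?_).mono ?_
        · intro x y
          simp [q1.1 hne, M1]
        · rintro t4 τ4 ⟨ht4, hM4⟩ hf4
          have z1 := hf4.var v_B (by decide)
          have z2 := hf4.var v_a (by decide)
          have z3 := hf4.var v_x (by decide)
          have z4 := hf4.var v_z (by decide)
          have z5 := hf4.var v_pos (by decide)
          have z6 := hf4.arr a_adj (by decide)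
          simp [hv2, hva2, hp, hc2, hrk2, g2, g3, had2] at z1 z2 z3 z4 z5 z6
          refine (second τ4 t4 (by omega) hM4 z1 z2 z3 z4 (by omega) z6).mono ?_
          rintro t5 τ5 ⟨ht5, h5⟩ -
          refine ⟨by simp; omega, h5⟩
      · simp [hp, hc2, hva2, had2, hrk2, g2] at he
        have hne : ¬ A i (xe j) := fun h => q1.2 h he
        refine (second _ 0 (by omega) (hI2.congr (fun a b => ?_) (by simp) (by simp))
          (by simpa using hv2) (by simpa using hva2) (by simp [hp, hc2, hrk2, g2])
          (by simp [hp, hc2, hrk2, g3]) (by simp [hp]; omega) (by simpa using had2)).mono ?_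
        · simp [hne, M1]
        · rintro t5 τ5 ⟨ht5, h5⟩ -
          refine ⟨by simp; omega, h5⟩
    · rintro t τ' ht' ⟨-, hI2⟩ -
      simp at ht'
      refine ⟨by simp; omega, hI2.congr (fun a b => ?_) (by simp) (by simp)⟩
      have key : (b = i ∨ ∃ e < m, A i (xe e) ∧ b = ye e ∨ A i (ye e) ∧ b = xe e) ↔
          Elim.Near A i b := by
        constructor
        · rintro (rfl | ⟨e, he, ⟨h, rfl⟩ | ⟨h, rfl⟩⟩)
          · have : A b b := (hA _ _).2 ⟨hi, hi, .inl rfl⟩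
            exact ⟨b, this, this⟩
          · exact ⟨_, h, (hA _ _).2 ⟨(hE.lt e he).1, (hE.lt e he).2, .inr ⟨e, he, .inl ⟨rfl, rfl⟩⟩⟩⟩
          · exact ⟨_, h, (hA _ _).2 ⟨(hE.lt e he).2, (hE.lt e he).1, .inr ⟨e, he, .inr ⟨rfl, rfl⟩⟩⟩⟩
        · rintro ⟨z, h1, h2⟩
          obtain ⟨-, -, h3⟩ := (hA _ _).1 h2
          have split : ∀ {z w}, A i z → Joined m xe ye z w →
              ∃ e < m, A i (xe e) ∧ w = ye e ∨ A i (ye e) ∧ w = xe e := by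
            rintro z w h ⟨e, he, ⟨rfl, rfl⟩ | ⟨rfl, rfl⟩⟩
            · exact ⟨e, he, .inl ⟨h, rfl⟩⟩
            · exact ⟨e, he, .inr ⟨h, rfl⟩⟩
          rcases h3 with rfl | h3
          · rcases ((hA _ _).1 h1).2.2 with rfl | h3
            · exact .inl rfl
            · exact .inr (split ((hA _ _).2 ⟨hi, hi, .inl rfl⟩) h3)
          · exact .inr (split h1 h3)
      rw [or_assoc, ← and_or_left, key, Nat.lt_succ_iff_lt_or_eq, or_and_right]
      refine or_congr_right (and_congr_right ?_)
      rintro rfl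
      rfl
  · rintro t τ ht hI -
    simp at ht
    refine ⟨by nlinarith, hI.congr (fun a b => ?_) rfl rfl⟩
    refine ⟨fun h => h.2, fun h => ⟨?_, h⟩⟩
    obtain ⟨z, h1, h2⟩ := h
    exact ((hA _ _).1 h1).1

end Loop

/-! ### Colouring and local marking -/

namespace Loop

theorem Row.mem_of_lt {X : Finset ℕ} {r l : ℕ} {σ : Env} (h : Row X r σ) (hl : l < X.card) :
    σ.arr a_S r l ∈ X := by
  have := Finset.mem_image_of_mem (σ.arr a_S r) (Finset.mem_range.2 hl)
  rwa [h.image] at this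

theorem Row.exists_of_mem {X : Finset ℕ} {r u : ℕ} {σ : Env} (h : Row X r σ) (hu : u ∈ X) :
    ∃ l < X.card, σ.arr a_S r l = u := by
  rw [← h.image] at hu
  obtain ⟨l, hl, rfl⟩ := Finset.mem_image.1 hu
  exact ⟨l, Finset.mem_range.1 hl, rfl⟩

theorem Row.mem_bag_of_le {S : ℕ → Finset ℕ} {r l : ℕ} {σ : Env} (h : Row (S r) r σ)
    (hl : l < (S r).card + 1) : σ.arr a_S r l ∈ Elim.bag S r := by
  rw [Elim.mem_bag]
  rcases Nat.lt_succ_iff_lt_or_eq.1 hl with hl | rfl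
  · exact .inr (h.mem_of_lt hl)
  · exact .inl h.self

theorem Row.exists_of_mem_bag {S : ℕ → Finset ℕ} {r u : ℕ} {σ : Env} (h : Row (S r) r σ)
    (hu : u ∈ Elim.bag S r) : ∃ l < (S r).card + 1, σ.arr a_S r l = u := by
  rcases Elim.mem_bag.1 hu with rfl | hu
  · exact ⟨_, Nat.lt_succ_self _, h.self⟩
  · obtain ⟨l, hl, h'⟩ := h.exists_of_mem hu
    exact ⟨l, by omega, h'⟩

/-- Colours the vertices greedily. -/
def colour : Cmd :=
  .forTo v_i v_iEnd †v_n
    (.forTo v_j v_jEnd (.get a_size 0 †v_i)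
        (.put a_used †v_i (.get a_col 0 (.get a_S †v_i †v_j)) 1) ;;
      .forTo v_c v_cEnd †v_k (.ite (.get a_used †v_i †v_c) .skip (.put a_col 0 †v_i †v_c)))

/-- Fewer than `k` colours are forbidden for `i`, so one below `k` is free; every free colour is
written, and the last one stays. Each vertex has its own row of marks, hence nothing must be reset.
-/
theorem wp_colour {B n k : ℕ} {S : ℕ → Finset ℕ} {σ : Env} (hvB : σ.var v_B = B)
    (hn : σ.var v_n = n) (hk : σ.var v_k = k) (hB : 16 * (n + k + 1) ≤ B)
    (hrow : ∀ i < n, Row (S i) i σ) (hlt : ∀ i < n, ∀ j ∈ S i, j < i)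
    (hcard : ∀ i < n, (S i).card < k) (h0 : ∀ i c, σ.arr a_used i c = 0) :
    wp B colour (fun t τ => t ≤ 200 * n * (k + 1) + 100 ∧
      ∀ i < n, τ.arr a_col 0 i < k ∧ ∀ j ∈ S i, τ.arr a_col 0 j ≠ τ.arr a_col 0 i) σ := by
  refine wp_for (fun i τ => (∀ j < i, τ.arr a_col 0 j < k ∧
      ∀ l ∈ S j, τ.arr a_col 0 l ≠ τ.arr a_col 0 j) ∧ ∀ r ≥ i, ∀ u, τ.arr a_used r u = 0)
    n (120 * (k + 1)) (by decide) (by decide) (by decide) (by omega) (by simp) (by simp [hn])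
    ⟨by simp, by simpa using h0⟩ ?_ ?_
  · rintro i hi τ hvi - hf ⟨hI, hI0⟩
    have hv0 := hf.var v_B (by decide)
    have hvk := hf.var v_k (by decide)
    have hR : Row (S i) i τ := (hrow i hi).congr (by rw [hf.arr a_size (by decide)])
      (by rw [hf.arr a_S (by decide)]) (by rw [hf.arr a_par (by decide)])
      (by rw [hf.arr a_in (by decide)])
    rw [hvB] at hv0
    rw [hk] at hvk
    have hci := hcard i hi
    simp only [wp_seq]
    refine wp_for (fun j τ' => (∀ c, τ'.arr a_used i c ≠ 0 ↔
        ∃ l < j, τ.arr a_col 0 (τ.arr a_S i l) = c) ∧ ∀ r > i, ∀ u, τ'.arr a_used r u = 0)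
      (S i).card 40 (by decide) (by decide) (by decide) (by omega)
      (by simp [hv0, hvi]; omega) (by simp [hvi, hR.size])
      ⟨by simp [hI0], fun r hr u => by simp [hI0 r hr.le u]⟩ ?_ ?_
    · rintro j hj τ1 hvj - hf1 ⟨h1, h2⟩
      have hv1 := hf1.var v_B (by decide)
      have hvi1 := hf1.var v_i (by decide)
      have hc1 := hf1.arr a_col (by decide)
      have hs1 := hf1.arr a_S (by decide)
      have hm := hR.mem_of_lt hj
      have hm' := hlt i hi _ hm
      have hcol := (hI _ hm').1
      simp [hv1, hvi1, hc1, hs1, hv0, hvi, hvj]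
      and_intros
      all_goals first | omega | skip
      · intro c
        rw [← ne_eq]
        split_ifs with h
        · simp only [ne_eq, one_ne_zero, not_false_eq_true, true_iff]
          exact ⟨j, le_rfl, h.symm⟩
        · rw [h1]
          refine exists_congr fun l => ?_
          constructor
          · rintro ⟨hl, h'⟩
            exact ⟨hl.le, h'⟩
          · rintro ⟨hl, h'⟩
            refine ⟨lt_of_le_of_ne hl ?_, h'⟩
            rintro rfl
            exact h h'.symm
      · intro r hr u
        simp [hr.ne', h2 r hr u]
    · rintro t1 τ1 ht1 ⟨h1, h2⟩ hf1
      have hv1 := hf1.var v_B (by decide)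
      have hvi1 := hf1.var v_i (by decide)
      have hvk1 := hf1.var v_k (by decide)
      have hc1 := hf1.arr a_col (by decide)
      rw [hv0] at hv1
      rw [hvi] at hvi1
      rw [hvk] at hvk1
      simp at ht1
      refine wp_for (fun c τ' => (∀ a, a ≠ i → τ'.arr a_col 0 a = τ.arr a_col 0 a) ∧
          ((∃ c' < c, τ1.arr a_used i c' = 0) →
            τ'.arr a_col 0 i < k ∧ τ1.arr a_used i (τ'.arr a_col 0 i) = 0))
        k 40 (by decide) (by decide) (by decide) (by omega) (by simp) (by simp [hvk1])
        ⟨by simp [hc1], by simp⟩ ?_ ?_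
      · rintro c hc τ2 hvc - hf2 ⟨g1, g2⟩
        have hv2 := hf2.var v_B (by decide)
        have hvi2 := hf2.var v_i (by decide)
        have hu2 := hf2.arr a_used (by decide)
        simp [hv2, hvi2, hu2, hv1, hvi1, hvc]
        refine ⟨by omega, fun hne => ⟨g1, fun x hx hx0 => g2 ⟨x, lt_of_le_of_ne hx ?_, hx0⟩⟩,
          fun he => ⟨by omega, ?_, fun x hx hx0 => ⟨hc, he⟩⟩⟩
        · rintro rfl
          exact hne hx0
        · intro a ha
          simp [ha, g1 a ha]
      · rintro t2 τ2 ht2 ⟨g1, g2⟩ hf2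
        have hu2 := hf2.arr a_used (by decide)
        simp at ht2
        have hex : ∃ c < k, τ1.arr a_used i c = 0 := by
          by_contra! hall
          have : Finset.range k ⊆ (S i).image (τ.arr a_col 0) := by
            intro c hc
            obtain ⟨l, hl, rfl⟩ := (h1 c).1 (hall c (Finset.mem_range.1 hc))
            exact Finset.mem_image_of_mem _ (hR.mem_of_lt hl)
          have := (Finset.card_le_card this).trans Finset.card_image_le
          simp at this
          omega
        obtain ⟨g3, g4⟩ := g2 hex
        refine ⟨by nlinarith, ?_, ?_⟩
        · intro j hj
          simp only [Env.set_arr]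
          rcases Nat.lt_succ_iff_lt_or_eq.1 hj with hj | rfl
          · rw [g1 j (by omega)]
            refine ⟨(hI j hj).1, fun l hl => ?_⟩
            have := hlt j (by omega) l hl
            rw [g1 l (by omega)]
            exact (hI j hj).2 l hl
          · refine ⟨g3, fun l hl he => (h1 _).2 ?_ g4⟩
            rw [← he, g1 l (hlt j hi l hl).ne]
            obtain ⟨a, ha, ha'⟩ := hR.exists_of_mem hl
            exact ⟨a, ha, by rw [ha']⟩
        · intro r hr u
          simp only [Env.set_arr, hu2, Env.set_arr]
          exact h2 r hr u
  · rintro t τ ht hI -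
    simp at ht
    exact ⟨by nlinarith, hI.1⟩

/-- Marks all pairs of vertices in a common bag that have a common neighbour in that bag. -/
def markLocal : Cmd :=
  .forTo v_i v_iEnd †v_n
    (v_s ::= .get a_size 0 †v_i + 1 ;;
      .forTo v_j v_jEnd †v_s
        (v_a ::= .get a_S †v_i †v_j ;;
          .forTo v_l v_lEnd †v_s
            (v_z ::= .get a_S †v_i †v_l ;;
              .ite (.get a_adj †v_a †v_z)
                (.forTo v_c v_cEnd †v_s
                  (v_b ::= .get a_S †v_i †v_c ;; .ite (.get a_adj †v_z †v_b) mark .skip))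
                .skip)))

theorem wp_markLocal {B n k : ℕ} {S : ℕ → Finset ℕ} {A : ℕ → ℕ → Prop} {σ : Env}
    (hvB : σ.var v_B = B)
    (hn : σ.var v_n = n) (hB : 16 * (n + k + 1) ≤ B)
    (hrow : ∀ i < n, Row (S i) i σ) (hlt : ∀ i < n, ∀ j ∈ S i, j < i)
    (hcard : ∀ i < n, (S i).card < k)
    (hadj : ∀ a < n, ∀ b < n, σ.arr a_adj a b ≠ 0 ↔ A a b)
    (h0 : Marked n (fun _ _ => False) σ) :
    wp B markLocal (fun t τ => t ≤ 200 * n * (k + 1) ^ 3 + 100 ∧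
      Marked n (Elim.LocalNear n A S) τ) σ := by
  refine wp_for (fun i τ => Marked n (Elim.LocalNear i A S) τ)
    n (180 * (k + 1) ^ 3) (by decide) (by decide) (by decide) (by omega) (by simp) (by simp [hn])
    (h0.congr (fun a b => by simp [Elim.LocalNear]) rfl rfl) ?_ ?_
  · rintro i hi τ hvi - hf hI
    have hv0 := hf.var v_B (by decide)
    have hsz := hf.arr a_size (by decide)
    have hS := hf.arr a_S (by decide)
    have hA := hf.arr a_adj (by decide)
    rw [hvB] at hv0
    have hR : Row (S i) i σ := hrow i hi
    have hci := hcard i hi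
    set s := (S i).card + 1 with hs
    set f := σ.arr a_S i with hfdef
    have hfn : ∀ l < s, f l < n := by
      intro l hl
      rcases Elim.mem_bag.1 (hR.mem_bag_of_le hl) with h | h
      · rw [hfdef, h]; exact hi
      · exact (hlt i hi _ h).trans hi
    -- The argument `C` selects the triples of positions visited so far, so the invariants of the
    -- three nested loops differ in `C` only. Triples with a non-adjacent first pair contribute
    -- nothing, which justifies skipping the innermost loop.
    let R : (ℕ → ℕ → ℕ → Prop) → ℕ → ℕ → Prop := fun C a b => Elim.LocalNear i A S a b ∨
      ∃ j < s, ∃ l < s, ∃ c < s, C j l c ∧ A (f j) (f l) ∧ A (f l) (f c) ∧ a = f j ∧ b = f c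
    simp only [wp_seq, wp_assign]
    refine ⟨by simp [hv0, hvi, hsz, hR.size]; omega, ?_⟩
    refine wp_for (fun j τ => Marked n (R fun j' _ _ => j' < j) τ) s (150 * (k + 1) ^ 2)
      (by decide) (by decide) (by decide) (by omega) (by simp) (by simp [hvi, hsz, hR.size, hs])
      (hI.congr (fun a b => by simp [R]) (by simp) (by simp)) ?_ ?_
    · rintro j hj τ1 hvj - hf1 hI1
      have hv1 := hf1.var v_B (by decide)
      have hvi1 := hf1.var v_i (by decide)
      have hvs1 := hf1.var v_s (by decide)
      have hS1 := hf1.arr a_S (by decide)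
      have hA1 := hf1.arr a_adj (by decide)
      simp [hv0, hvi, hsz, hR.size, hS, hA] at hv1 hvi1 hvs1 hS1 hA1
      simp only [wp_seq, wp_assign]
      refine ⟨by simp [hv1, hvi1, hvj]; omega, ?_⟩
      refine wp_for (fun l τ => Marked n (R fun j' l' _ => j' < j ∨ j' = j ∧ l' < l) τ) s
        (120 * (k + 1))
        (by decide) (by decide) (by decide) (by omega) (by simp) (by simp [hvs1, hs])
        (hI1.congr (fun a b => by simp [R]) (by simp) (by simp)) ?_ ?_
      · rintro l hl τ2 hvl - hf2 hI2
        have hv2 := hf2.var v_B (by decide)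
        have hvi2 := hf2.var v_i (by decide)
        have hvs2 := hf2.var v_s (by decide)
        have hva2 := hf2.var v_a (by decide)
        have hS2 := hf2.arr a_S (by decide)
        have hA2 := hf2.arr a_adj (by decide)
        simp [hv1, hvi1, hvs1, hS1, hA1, hvj] at hv2 hvi2 hvs2 hva2 hS2 hA2
        have hjn := hfn j hj
        have hln := hfn l hl
        rw [wp_seq, wp_assign]
        refine ⟨by simp [hv2, hvi2, hvl]; omega, ?_⟩
        rw [wp_ite]
        have hq := hadj _ hjn _ hln
        refine ⟨by simp [hv2, hvi2, hvl, hva2, hS2, ← hfdef]; omega, fun hne => ?_, fun he => ?_⟩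
        · simp [hvi2, hvl, hva2, hS2, hA2, ← hfdef] at hne
          have hAjl := hq.1 hne
          refine wp_for (fun c τ => Marked n (R fun j' l' c' => (j' < j ∨ j' = j ∧ l' < l) ∨
              j' = j ∧ l' = l ∧ c' < c) τ) s 90
            (by decide) (by decide) (by decide) (by omega) (by simp) (by simp [hvs2, hs])
            (hI2.congr (fun a b => by simp [R]) (by simp) (by simp)) ?_ ?_
          · rintro c hc τ3 hvc - hf3 hI3
            have hv3 := hf3.var v_B (by decide)
            have hvi3 := hf3.var v_i (by decide)
            have hva3 := hf3.var v_a (by decide)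
            have hvz3 := hf3.var v_z (by decide)
            have hS3 := hf3.arr a_S (by decide)
            have hA3 := hf3.arr a_adj (by decide)
            simp [hv2, hvi2, hva2, hS2, hA2, hvl] at hv3 hvi3 hva3 hvz3 hS3 hA3
            have hcn := hfn c hc
            have hq' := hadj _ hln _ hcn
            have hsucc : ∀ a b, (R (fun j' l' c' => (j' < j ∨ j' = j ∧ l' < l) ∨
                j' = j ∧ l' = l ∧ c' < c + 1) a b ↔ R (fun j' l' c' => (j' < j ∨ j' = j ∧ l' < l) ∨
                j' = j ∧ l' = l ∧ c' < c) a b ∨ A (f l) (f c) ∧ a = f j ∧ b = f c) := by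
              intro a b
              simp only [R]
              rw [or_assoc]
              refine or_congr_right ?_
              constructor
              · rintro ⟨j', hj', l', hl', c', hc', h, g⟩
                by_cases h' : j' = j ∧ l' = l ∧ c' = c
                · obtain ⟨rfl, rfl, rfl⟩ := h'
                  exact .inr g.2
                · exact .inl ⟨j', hj', l', hl', c', hc', by omega, g⟩
              · rintro (⟨j', hj', l', hl', c', hc', h, g⟩ | h)
                · exact ⟨j', hj', l', hl', c', hc', by omega, g⟩
                · exact ⟨j, hj, l, hl, c, hc, by omega, hAjl, h⟩
            simp only [wp_seq, wp_assign, wp_ite, wp_skip]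
            refine ⟨by simp [hv3, hvi3, hvc]; omega,
              by simp [hv3, hvi3, hvc, hvz3, hS3, ← hfdef]; omega, fun hne' => ?_, fun he => ?_⟩
            · simp [hvi3, hvz3, hS3, hA3, ← hfdef, hvc] at hne'
              refine (wp_mark (n := n) (a := f j) (b := f c) (by simpa using hv3)
                (by simp [hva3, hfdef]) (by simp [hvi3, hvc, hS3, hfdef]) hjn hcn (by omega)
                (hI3.congr (fun _ _ => Iff.rfl) (by simp) (by simp))
                (M' := R fun j' l' c' => (j' < j ∨ j' = j ∧ l' < l) ∨ j' = j ∧ l' = l ∧ c' < c + 1)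
                fun a b => ?_).mono ?_
              · rw [hsucc]
                simp [hq'.1 hne']
              · rintro t4 τ4 ⟨ht4, h4⟩ -
                exact ⟨by simp; omega, h4.congr (fun _ _ => Iff.rfl) (by simp) (by simp)⟩
            · simp [hvi3, hvz3, hS3, hA3, ← hfdef, hvc] at he
              refine ⟨by simp, hI3.congr (fun a b => ?_) (by simp) (by simp)⟩
              rw [hsucc]
              have : ¬ A (f l) (f c) := fun h => hq'.2 h he
              simp [this]
          · rintro t3 τ3 ht3 h3 -
            simp at ht3
            refine ⟨by simp; nlinarith, h3.congr (fun a b => ?_) (by simp) (by simp)⟩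
            simp only [R]
            refine or_congr_right ?_
            constructor
            · rintro ⟨j', hj', l', hl', c', hc', h, g⟩
              exact ⟨j', hj', l', hl', c', hc', by omega, g⟩
            · rintro ⟨j', hj', l', hl', c', hc', h, g⟩
              exact ⟨j', hj', l', hl', c', hc', by omega, g⟩
        · simp [hvi2, hvl, hva2, hS2, hA2, ← hfdef] at he
          have hno : ¬ A (f j) (f l) := fun h => hq.2 h he
          simp only [wp_skip]
          refine ⟨by simp; omega, hI2.congr (fun a b => ?_) (by simp) (by simp)⟩
          simp only [R]
          refine or_congr_right ?_
          constructor
          · rintro ⟨j', hj', l', hl', c', hc', h, g⟩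
            exact ⟨j', hj', l', hl', c', hc', by omega, g⟩
          · rintro ⟨j', hj', l', hl', c', hc', h, g⟩
            refine ⟨j', hj', l', hl', c', hc', ?_, g⟩
            by_cases h' : j' = j ∧ l' = l
            · obtain ⟨rfl, rfl⟩ := h'
              exact absurd g.1 hno
            · omega
      · rintro t2 τ2 ht2 h2 -
        simp at ht2
        refine ⟨by simp; nlinarith, h2.congr (fun a b => ?_) (by simp) (by simp)⟩
        simp only [R]
        refine or_congr_right ?_
        constructor
        · rintro ⟨j', hj', l', hl', c', hc', h, g⟩
          exact ⟨j', hj', l', hl', c', hc', by omega, g⟩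
        · rintro ⟨j', hj', l', hl', c', hc', h, g⟩
          exact ⟨j', hj', l', hl', c', hc', by omega, g⟩
    · rintro t1 τ1 ht1 h1 -
      simp at ht1
      refine ⟨by simp; nlinarith, h1.congr (fun a b => ?_) (by simp) (by simp)⟩
      simp only [R]
      constructor
      · rintro (⟨x, hx, h⟩ | ⟨j', hj', l', hl', c', hc', h, g1, g2, rfl, rfl⟩)
        · exact ⟨x, by omega, h⟩
        · exact ⟨i, by omega, f l', hR.mem_bag_of_le hl', hR.mem_bag_of_le hj',
            hR.mem_bag_of_le hc', g1, g2⟩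
      · rintro ⟨x, hx, z, hz, ha, hb, h1, h2⟩
        rcases Nat.lt_succ_iff_lt_or_eq.1 hx with hx | rfl
        · exact .inl ⟨x, hx, z, hz, ha, hb, h1, h2⟩
        · obtain ⟨j', hj', rfl⟩ := hR.exists_of_mem_bag ha
          obtain ⟨l', hl', rfl⟩ := hR.exists_of_mem_bag hz
          obtain ⟨c', hc', rfl⟩ := hR.exists_of_mem_bag hb
          exact .inr ⟨j', hj', l', hl', c', hc', hj', h1, h2, rfl, rfl⟩
  · rintro t τ ht hI -
    simp at ht
    refine ⟨?_, hI⟩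
    have : 1 ≤ (k + 1) ^ 3 := Nat.one_le_pow _ _ (by omega)
    nlinarith

end Loop

/-! ### Projections of colour masks -/

namespace Loop

/-- The colours below `k` in the mask `M` whose flag is not `0`. -/
def proj (f : ℕ → ℕ) : ℕ → ℕ → ℕ
  | 0, _ => 0
  | k + 1, M => proj f k M + if f k ≠ 0 ∧ M.testBit k = true then 2 ^ k else 0

theorem proj_lt (f : ℕ → ℕ) (k M : ℕ) : proj f k M < 2 ^ k := by
  induction k with
  | zero => simp [proj]
  | succ k ih => rw [proj, pow_succ]; split_ifs <;> omega

theorem testBit_proj (f : ℕ → ℕ) (k M c : ℕ) :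
    (proj f k M).testBit c = true ↔ c < k ∧ f c ≠ 0 ∧ M.testBit c = true := by
  induction k with
  | zero => simp [proj]
  | succ k ih =>
    have hlt := proj_lt f k M
    rw [proj]
    split_ifs with h
    · rw [add_comm]
      rcases lt_trichotomy c k with hc | rfl | hc
      · rw [Nat.testBit_two_pow_add_gt hc, ih]
        simp [hc, hc.trans (Nat.lt_succ_self k)]
      · rw [Nat.testBit_two_pow_add_eq, Nat.testBit_lt_two_pow hlt]
        simpa using h
      · have h1 : 2 ^ k + proj f k M < 2 ^ c :=
          calc _ < 2 ^ (k + 1) := by rw [pow_succ]; omega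
            _ ≤ 2 ^ c := Nat.pow_le_pow_right (by omega) hc
        rw [Nat.testBit_lt_two_pow h1]
        simp
        omega
    · rw [add_zero, ih]
      constructor
      · rintro ⟨h1, h2⟩
        exact ⟨by omega, h2⟩
      · rintro ⟨h1, h2⟩
        refine ⟨lt_of_le_of_ne (by omega) ?_, h2⟩
        rintro rfl
        exact h h2

theorem proj_zero (f : ℕ → ℕ) (k : ℕ) : proj f k 0 = 0 := by
  induction k with
  | zero => rfl
  | succ k ih => simp [proj, ih]

/-- A table for the masks below `2 ^ c` extends to those below `2 ^ (c + 1)` by one addition per new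
entry. -/
theorem proj_add_two_pow {f : ℕ → ℕ} {k c M : ℕ} (hc : c < k) (hM : M < 2 ^ c) :
    proj f k (M + 2 ^ c) = proj f k M + if f c ≠ 0 then 2 ^ c else 0 := by
  have h0 : proj f k M < 2 ^ c := by
    by_contra hle
    obtain ⟨a, ha, hb⟩ := Nat.exists_ge_and_testBit_of_ge_two_pow (not_lt.1 hle)
    have := (testBit_proj f k M a).1 hb
    rw [Nat.testBit_lt_two_pow (hM.trans_le (Nat.pow_le_pow_right (by omega) ha))] at this
    simp at this
  refine Nat.eq_of_testBit_eq fun a => Bool.eq_iff_iff.2 ?_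
  rw [testBit_proj, add_comm M]
  rcases lt_trichotomy a c with h | rfl | h
  · rw [Nat.testBit_two_pow_add_gt h]
    split_ifs
    · rw [add_comm, Nat.testBit_two_pow_add_gt h, testBit_proj]
    · rw [add_zero, testBit_proj]
  · rw [Nat.testBit_two_pow_add_eq, Nat.testBit_lt_two_pow hM]
    split_ifs with hf
    · rw [add_comm, Nat.testBit_two_pow_add_eq, Nat.testBit_lt_two_pow h0]
      simp [hc, hf]
    · rw [add_zero, Nat.testBit_lt_two_pow h0]
      simp only [ne_eq, not_not] at hf
      simp [hf]
  · have h2 : 2 ^ (c + 1) ≤ 2 ^ a := Nat.pow_le_pow_right (by omega) h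
    rw [pow_succ] at h2
    rw [Nat.testBit_lt_two_pow (x := 2 ^ c + M) (by omega), Nat.testBit_lt_two_pow]
    · simp
    · split_ifs <;> omega

/-- Tabulates the projection, given by flags in `F`, of all masks in `D`. -/
def project (F D : ℕ) : Cmd :=
  .put D †v_i 0 0 ;;
  .forTo v_c v_cEnd †v_k
    (v_b ::= .get a_pow 0 †v_c ;; .ite (.get F †v_i †v_c) (v_a ::= †v_b) (v_a ::= 0) ;;
      .forTo v_M v_MEnd †v_b (.put D †v_i (†v_M + †v_b) (.get D †v_i †v_M + †v_a)))

/-- Whether a command leaves the main variables and the tables that describe the graph alone. -/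
def Cmd.keeps (c : Cmd) : Bool :=
  !(c.modVar v_B || c.modVar v_n || c.modVar v_k || c.modVar v_P || c.modArr a_pow ||
    c.modArr a_S || c.modArr a_size || c.modArr a_par || c.modArr a_in || c.modArr a_adj ||
    c.modArr a_col)

/-- The tables that describe the graph, its elimination ordering, and its colouring. -/
structure Setup (B n k : ℕ) (A : ℕ → ℕ → Prop) (S : ℕ → Finset ℕ) (col : ℕ → ℕ) (σ : Env) :
    Prop where
  bound : σ.var v_B = B
  size : σ.var v_n = n
  width : σ.var v_k = k
  two_pow : σ.var v_P = 2 ^ k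
  pow : ∀ c < k, σ.arr a_pow 0 c = 2 ^ c
  row : ∀ i < n, Row (S i) i σ
  adj : ∀ a < n, ∀ b < n, σ.arr a_adj a b ≠ 0 ↔ A a b
  col : ∀ i < n, σ.arr a_col 0 i = col i

variable {B n k : ℕ} {A : ℕ → ℕ → Prop} {S : ℕ → Finset ℕ} {col : ℕ → ℕ} {σ τ : Env}

theorem Setup.frame {c : Cmd} (h : Setup B n k A S col σ) (hf : Frame c σ τ)
    (hc : c.keeps = true) : Setup B n k A S col τ := by
  simp only [Cmd.keeps, Bool.not_eq_eq_eq_not, Bool.not_true, Bool.or_eq_false_iff] at hc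
  obtain ⟨⟨⟨⟨⟨⟨⟨⟨⟨⟨h1, h2⟩, h3⟩, h4⟩, h5⟩, h6⟩, h7⟩, h8⟩, h9⟩, h10⟩, h11⟩ := hc
  refine ⟨hf.var _ h1 ▸ h.bound, hf.var _ h2 ▸ h.size, hf.var _ h3 ▸ h.width,
    hf.var _ h4 ▸ h.two_pow, hf.arr _ h5 ▸ h.pow, fun i hi => (h.row i hi).congr ?_ ?_ ?_ ?_,
    hf.arr _ h10 ▸ h.adj, hf.arr _ h11 ▸ h.col⟩
  · rw [hf.arr _ h7]
  · rw [hf.arr _ h6]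
  · rw [hf.arr _ h8]
  · rw [hf.arr _ h9]

theorem Setup.set {x v : ℕ} (h : Setup B n k A S col σ) (h0 : x ≠ v_B) (h1 : x ≠ v_n)
    (h2 : x ≠ v_k) (h3 : x ≠ v_P) : Setup B n k A S col (σ.set x v) :=
  ⟨by simp [h0.symm, h.bound], by simp [h1.symm, h.size], by simp [h2.symm, h.width],
    by simp [h3.symm, h.two_pow], by simpa using h.pow,
    fun i hi => (h.row i hi).congr (by simp) (by simp) (by simp) (by simp),
    by simpa using h.adj, by simpa using h.col⟩

/-- The stage for colour `c` adds `2 ^ c` entries. The time is a geometric sum plus an overhead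
linear in `k`, which is absorbed by `k < 2 ^ k`. -/
theorem wp_project {F D i : ℕ} (hF : F < 32) (hD : D < 32) (hFD : F ≠ D) (hDp : D ≠ a_pow)
    (hvB : σ.var v_B = B) (hvk : σ.var v_k = k) (hpow : ∀ c < k, σ.arr a_pow 0 c = 2 ^ c)
    (hvi : σ.var v_i = i) (hi : i < n) (hB : 16 * (n + k + 1) ≤ B) (hk : 2 ^ k ≤ 2 * n) :
    wp B (project F D) (fun t τ => t ≤ 200 * 2 ^ k ∧
      (∀ M < 2 ^ k, τ.arr D i M = proj (σ.arr F i) k M) ∧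
      ∀ r ≠ i, τ.arr D r = σ.arr D r) σ := by
  have hkk : k < 2 ^ k := Nat.lt_two_pow_self
  simp only [project, wp_seq, wp_put]
  refine ⟨by simp [hvB, hvi, hD]; omega, ?_⟩
  refine wp_forTo (fun c t τ => t ≤ 70 * 2 ^ c + 60 * c ∧
      (∀ M < 2 ^ c, τ.arr D i M = proj (σ.arr F i) k M) ∧ ∀ r ≠ i, τ.arr D r = σ.arr D r)
    k (by decide) rfl rfl (by omega) (by simp) (by simp [hvk]) ⟨by simp, ?_, ?_⟩ ?_ ?_
  · intro M hM
    obtain rfl : M = 0 := by simpa using hM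
    simp [hvi, proj_zero]
  · intro r hr
    funext M
    simp [hvi, hr]
  · rintro c hc t τ hvc - hf ⟨ht, hI, hr⟩
    have hvB1 := hf.var v_B rfl
    have hvi1 := hf.var v_i rfl
    have hF1 := hf.arr F (by simpa [Cmd.modArr, Cmd.forTo] using hFD)
    have hpow1 := hf.arr a_pow (by simpa [Cmd.modArr, Cmd.forTo] using hDp.symm)
    simp [hvB, hvi] at hvB1 hvi1
    have hFi : ∀ c, τ.arr F i c = σ.arr F i c := by
      intro c
      rw [hF1]
      simp [hFD]
    have hpc : τ.arr a_pow 0 c = 2 ^ c := by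
      rw [hpow1]
      simpa [hDp.symm] using hpow c hc
    have hle : 2 ^ (c + 1) ≤ 2 ^ k := Nat.pow_le_pow_right (by omega) hc
    have hs : 2 ^ (c + 1) = 2 * 2 ^ c := by ring
    have main : ∀ t4 t0 τ0, t4 + t0 ≤ 40 → τ0.var v_B = B → τ0.var v_i = i → τ0.arr = τ.arr →
        τ0.var v_b = 2 ^ c →
        τ0.var v_a = (if σ.arr F i c ≠ 0 then 2 ^ c else 0) →
        wp B (.forTo v_M v_MEnd †v_b (.put D †v_i (†v_M + †v_b) (.get D †v_i †v_M + †v_a)))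
          (fun t' τ' => t + (t4 + (t0 + t')) ≤ 70 * 2 ^ (c + 1) + 60 * (c + 1) ∧
            (∀ M < 2 ^ (c + 1), (τ'.set v_c (c + 1)).arr D i M = proj (σ.arr F i) k M) ∧
            ∀ r ≠ i, (τ'.set v_c (c + 1)).arr D r = σ.arr D r) τ0 := by
      intro t4 t0 τ0 ht0 hvB0 hvi0 hD0 hb0 ha0
      have hac : τ0.var v_a ≤ 2 ^ c := by rw [ha0]; split_ifs <;> simp
      refine wp_for (fun M τ' => (∀ M' < 2 ^ c + M, τ'.arr D i M' = proj (σ.arr F i) k M') ∧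
          ∀ r ≠ i, τ'.arr D r = σ.arr D r) (2 ^ c) 50
        (by decide) rfl rfl (by omega) (by simp) (by simp [hb0])
        ⟨by simpa [hD0] using hI, by simpa [hD0] using hr⟩ ?_ ?_
      · rintro M hM τ1 hvM - hf1 ⟨h1, h2⟩
        have hvB2 := hf1.var v_B rfl
        have hvi2 := hf1.var v_i rfl
        have hva2 := hf1.var v_a rfl
        have hvb2 := hf1.var v_b rfl
        have hDM := h1 M (by omega)
        have hDle := proj_lt (σ.arr F i) k M
        rw [hvB0] at hvB2
        rw [hvi0] at hvi2
        rw [hb0] at hvb2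
        simp only [wp_put, safe_var, safe_add, safe_get, eval_var, eval_add, eval_get, hvB2, hvi2,
          hva2, hvb2, hvM, hDM]
        refine ⟨⟨hD, trivial, trivial, ?_, ?_, ?_, ?_⟩, ?_, ?_, ?_⟩
        · simp; omega
        · simp [hD]; omega
        · omega
        · omega
        · simp
        · intro M' hM'
          simp
          split_ifs with h
          · rw [h, proj_add_two_pow hc hM, ha0]
          · exact h1 M' (by omega)
        · intro r hr'
          funext u
          simp [hr', h2 r hr']
      · rintro t1 τ1 ht1 ⟨h1, h2⟩ -
        simp at ht1
        refine ⟨by omega, fun M hM => ?_, fun r hr' => ?_⟩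
        · simpa using h1 M (by omega)
        · simpa using h2 r hr'
    simp only [wp_seq, wp_ite, wp_assign]
    refine ⟨by simp [hvB1, hvc]; omega, by simp [hvB1, hvi1, hvc, hF]; omega,
      fun hne => ⟨by simp, ?_⟩, fun he => ⟨by simp; omega, ?_⟩⟩
    · simp [hvi1, hvc, hFi] at hne
      refine main _ _ _ ?_ ?_ ?_ ?_ ?_ ?_ <;> simp [hvB1, hvi1, hvc, hpc, hne]
    · simp [hvi1, hvc, hFi] at he
      refine main _ _ _ ?_ ?_ ?_ ?_ ?_ ?_ <;> simp [hvB1, hvi1, hvc, hpc, he]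
  · rintro t τ ⟨ht, h1, h2⟩ -
    refine ⟨by simp; omega, h1, h2⟩

/-- Tabulates in `D` the masks restricted to the colours of those elements `v_z` of the current row
for which `e` is not `0`. -/
def mask (F D : ℕ) (e : Expr) : Cmd :=
  .forTo v_c v_cEnd †v_k (.put F †v_i †v_c 0) ;;
  .forTo v_l v_lEnd (.get a_size 0 †v_i)
    (v_z ::= .get a_S †v_i †v_l ;; .ite e (.put F †v_i (.get a_col 0 †v_z) 1) .skip) ;;
  project F D

/-- `M'` is the restriction of `M` to the colours of the elements of `X` with the property `P`. -/
def Restricts (X : Finset ℕ) (P : ℕ → Prop) (col : ℕ → ℕ) (M M' : ℕ) : Prop :=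
  ∀ c, M'.testBit c = true ↔ M.testBit c = true ∧ ∃ z ∈ X, P z ∧ col z = c

/-- The expression `e` tests the element held in `v_z`. It is evaluated in intermediate states, so
`he` concerns all states that differ from the initial one only in the loop variables and the flags.
-/
theorem wp_mask {F D i : ℕ} {e : Expr} {P : ℕ → Prop} (h : Setup B n k A S col σ)
    (hF : F < 32) (hD : D < 32) (hFD : F ≠ D)
    (hFk : (Cmd.put F 0 0 0).keeps = true) (hDp : D ≠ a_pow)
    (hvi : σ.var v_i = i) (hi : i < n) (hB : 16 * (n + k + 1) ≤ B) (hk : 2 ^ k ≤ 2 * n)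
    (hlt : ∀ i < n, ∀ j ∈ S i, j < i) (hcol : ∀ i < n, col i < k) (hcard : (S i).card < k)
    (he : ∀ τ, ∀ z ∈ S i, (∀ x, x ≠ v_c → x ≠ v_cEnd → x ≠ v_l → x ≠ v_lEnd → x ≠ v_z →
        τ.var x = σ.var x) → (∀ j, j ≠ F → τ.arr j = σ.arr j) →
      τ.var v_z = z → e.Safe B τ ∧ (e.eval τ ≠ 0 ↔ P z)) (hcost : e.cost ≤ 20) :
    wp B (mask F D e) (fun t τ => t ≤ 400 * 2 ^ k ∧
      (∀ M < 2 ^ k, τ.arr D i M < 2 ^ k ∧ Restricts (S i) P col M (τ.arr D i M)) ∧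
      ∀ r ≠ i, τ.arr D r = σ.arr D r) σ := by
  have hkk : k < 2 ^ k := Nat.lt_two_pow_self
  have hvB := h.bound
  have hvk := h.width
  have hRow := h.row i hi
  simp only [mask, wp_seq]
  refine wp_for (fun c τ => ∀ c' < c, τ.arr F i c' = 0) k 20
    (by decide) rfl rfl (by omega) (by simp) (by simp [hvk]) (by simp) ?_ ?_
  · rintro c hc τ hvc - hf hI
    have hvB1 := hf.var v_B rfl
    have hvi1 := hf.var v_i rfl
    simp [hvB1, hvi1, hvB, hvi, hvc, hF]
    refine ⟨by omega, fun c' hc' hne => hI c' (by omega)⟩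
  rintro t1 τ1 ht1 h1 hf1
  have hvB1 := hf1.var v_B rfl
  have hvi1 := hf1.var v_i rfl
  have h1' : Setup B n k A S col τ1 := h.frame hf1 (by
    simpa [Cmd.keeps, Cmd.modVar, Cmd.modArr, Cmd.forTo] using hFk)
  have hRow1 := h1'.row i hi
  rw [hvB] at hvB1
  rw [hvi] at hvi1
  simp at ht1
  refine wp_for (fun l τ => ∀ c < k, τ.arr F i c ≠ 0 ↔ ∃ l' < l, P (τ1.arr a_S i l') ∧
      col (τ1.arr a_S i l') = c) (S i).card 60
    (by decide) rfl rfl (by omega) (by simp [hvB1, hvi1]; omega) (by simp [hvi1, hRow1.size])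
    (by simpa using h1) ?_ ?_
  · rintro l hl τ hvl - hf hI
    have hvB2 := hf.var v_B rfl
    have hvi2 := hf.var v_i rfl
    have h2 : Setup B n k A S col τ := h1'.frame hf (by
      simpa [Cmd.keeps, Cmd.modVar, Cmd.modArr, Cmd.forTo] using hFk)
    rw [hvB1] at hvB2
    rw [hvi1] at hvi2
    set z := τ1.arr a_S i l with hz
    have hzS : z ∈ S i := hRow1.mem_of_lt hl
    have hzi := hlt i hi z hzS
    have hSz : τ.arr a_S i l = z := by
      have hne : F ≠ a_S := by
        rintro rfl
        simp [Cmd.keeps, Cmd.modArr] at hFk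
      rw [hf.arr a_S (by simpa [Cmd.modArr, Cmd.forTo] using hne.symm)]
    obtain ⟨he1, he2⟩ := he (τ.set v_z z) z hzS
      (fun x g1 g2 g3 g4 g5 => by
        have w1 := hf1.var x (by simp [Cmd.modVar, Cmd.forTo, g1, g2])
        have w2 := hf.var x (by simp [Cmd.modVar, Cmd.forTo, g3, g4, g5])
        simp [g5, w1, w2])
      (fun j hj => by
        have w1 := hf1.arr j (by simp [Cmd.modArr, Cmd.forTo, hj])
        have w2 := hf.arr j (by simp [Cmd.modArr, Cmd.forTo, hj])
        simp [w1, w2]) (by simp)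
    have hcz := h2.col z (by omega)
    have hck := hcol z (by omega)
    have hsplit : ∀ c, (∃ l' < l + 1, P (τ1.arr a_S i l') ∧ col (τ1.arr a_S i l') = c) ↔
        (∃ l' < l, P (τ1.arr a_S i l') ∧ col (τ1.arr a_S i l') = c) ∨ P z ∧ col z = c := by
      intro c
      constructor
      · rintro ⟨l', hl', h'⟩
        rcases Nat.lt_succ_iff_lt_or_eq.1 hl' with hl' | rfl
        · exact .inl ⟨l', hl', h'⟩
        · exact .inr h'
      · rintro (⟨l', hl', h'⟩ | h')
        · exact ⟨l', by omega, h'⟩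
        · exact ⟨l, by omega, h'⟩
    simp only [wp_seq, wp_assign, wp_ite, wp_put, wp_skip, eval_get, eval_var, hvi2, hvl, hSz]
    refine ⟨by simp [hvB2, hvi2, hvl]; omega, he1, fun hne => ?_, fun h0 => ?_⟩
    · have hP := he2.1 hne
      refine ⟨by simp [hF, hvB2, hvi2, hcz]; omega, by simp; omega, fun c hc => ?_⟩
      rw [hsplit, ← hI c hc]
      simp [hvi2, hcz, hP]
      split_ifs with h'
      · simp [h']
      · rw [← ne_eq]
        tauto
    · have hP : ¬ P z := fun h => he2.2 h h0
      refine ⟨by simp; omega, fun c hc => ?_⟩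
      rw [hsplit, ← hI c hc]
      simp [hP]
  · rintro t2 τ2 ht2 h2 hf2
    have hvB2 := hf2.var v_B rfl
    have hvi2 := hf2.var v_i rfl
    have h2' : Setup B n k A S col τ2 := h1'.frame hf2 (by
      simpa [Cmd.keeps, Cmd.modVar, Cmd.modArr, Cmd.forTo] using hFk)
    rw [hvi1] at hvi2
    simp at ht2
    refine (wp_project (n := n) hF hD hFD hDp h2'.bound h2'.width h2'.pow hvi2 hi hB hk).mono ?_
    rintro t3 τ3 ⟨ht3, h3, h4⟩ -
    refine ⟨by omega, fun M hM => ?_, fun r hr => ?_⟩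
    · rw [h3 M hM]
      refine ⟨proj_lt _ _ _, fun c => ?_⟩
      rw [testBit_proj]
      constructor
      · rintro ⟨hc, hf, hb⟩
        obtain ⟨l, hl, h'⟩ := (h2 c hc).1 hf
        exact ⟨hb, _, hRow1.mem_of_lt hl, h'⟩
      · rintro ⟨hb, z, hz, hP, rfl⟩
        obtain ⟨l, hl, rfl⟩ := hRow1.exists_of_mem hz
        have hc := hcol _ ((hlt i hi _ hz).trans hi)
        exact ⟨hc, (h2 _ hc).2 ⟨l, hl, hP, rfl⟩, hb⟩
    · rw [h4 r hr, hf2.arr D (by simpa [Cmd.modArr, Cmd.forTo] using hFD.symm),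
        hf1.arr D (by simpa [Cmd.modArr, Cmd.forTo] using hFD.symm)]

/-- Tabulates the masks without the colour of the current vertex. -/
def remove : Cmd :=
  .forTo v_c v_cEnd †v_k (.put a_rmf †v_i †v_c 1) ;; .put a_rmf †v_i (.get a_col 0 †v_i) 0 ;;
  project a_rmf a_rm

theorem wp_remove {i : ℕ} (h : Setup B n k A S col σ) (hvi : σ.var v_i = i) (hi : i < n)
    (hB : 16 * (n + k + 1) ≤ B) (hk : 2 ^ k ≤ 2 * n) (hcol : ∀ i < n, col i < k) :
    wp B remove (fun t τ => t ≤ 300 * 2 ^ k ∧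
      (∀ M < 2 ^ k, τ.arr a_rm i M < 2 ^ k ∧
        ∀ c, (τ.arr a_rm i M).testBit c = true ↔ M.testBit c = true ∧ c ≠ col i) ∧
      ∀ r ≠ i, τ.arr a_rm r = σ.arr a_rm r) σ := by
  have hkk : k < 2 ^ k := Nat.lt_two_pow_self
  have hvB := h.bound
  have hvk := h.width
  simp only [remove, wp_seq]
  refine wp_for (fun c τ => ∀ c' < c, τ.arr a_rmf i c' ≠ 0) k 20
    (by decide) rfl rfl (by omega) (by simp) (by simp [hvk]) (by simp) ?_ ?_
  · rintro c hc τ hvc - hf hI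
    have hvB1 := hf.var v_B rfl
    have hvi1 := hf.var v_i rfl
    simp [hvB1, hvi1, hvB, hvi, hvc]
    and_intros
    all_goals first | omega | skip
    intro c' hc'
    split_ifs with h'
    · simp
    · exact hI c' (by omega)
  rintro t1 τ1 ht1 h1 hf1
  have h1' : Setup B n k A S col τ1 := h.frame hf1 rfl
  have hvB1 := h1'.bound
  have hvi1 := hf1.var v_i rfl
  have hrm := hf1.arr a_rm rfl
  have hci := h1'.col i hi
  have hck := hcol i hi
  rw [hvi] at hvi1
  simp at ht1
  rw [wp_put]
  refine ⟨by simp [hvB1, hvi1, hci]; omega, ?_⟩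
  refine (wp_project (n := n) (B := B) (k := k) (i := i) (by decide) (by decide) (by decide) (by decide)
    (by simpa using hvB1) (by simpa using h1'.width) (by simpa using h1'.pow) (by simpa using hvi1)
    hi hB hk).mono ?_
  rintro t3 τ3 ⟨ht3, h3, h4⟩ -
  refine ⟨by simp; omega, fun M hM => ?_, fun r hr => ?_⟩
  · rw [h3 M hM]
    refine ⟨proj_lt _ _ _, fun c => ?_⟩
    rw [testBit_proj]
    simp only [eval_var, eval_get, eval_ofNat, hvi1, hci]
    simp
    constructor
    · rintro ⟨h5, h6, h7⟩
      exact ⟨h7, h6.1⟩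
    · rintro ⟨h5, h6⟩
      have hc : c < k := by
        by_contra hc
        have := Nat.testBit_lt_two_pow (hM.trans_le (Nat.pow_le_pow_right (by omega) (not_lt.1 hc)))
        simp [this] at h5
      exact ⟨hc, ⟨h6, h1 c hc⟩, h5⟩
  · rw [h4 r hr, ← hrm]
    funext u
    simp

end Loop

/-! ### The bottom-up pass -/

namespace Elim

variable {n : ℕ} {A : ℕ → ℕ → Prop} {S : ℕ → Finset ℕ} {col : ℕ → ℕ}

theorem sum_filter_le_succ {n i : ℕ} {p : ℕ → Prop} [DecidablePred p] (f : ℕ → ℕ) (hi : i < n) :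
    ∑ c ∈ (Finset.range n).filter (fun c => p c ∧ i ≤ c), f c =
      ∑ c ∈ (Finset.range n).filter (fun c => p c ∧ i + 1 ≤ c), f c + if p i then f i else 0 := by
  have : (if p i then f i else 0) = ∑ c ∈ Finset.range n, if c = i then (if p i then f i else 0)
      else 0 := by
    rw [Finset.sum_ite_eq' _ _ fun _ => if p i then f i else 0, if_pos (Finset.mem_range.2 hi)]
  rw [Finset.sum_filter, Finset.sum_filter, this, ← Finset.sum_add_distrib]
  refine Finset.sum_congr rfl fun c _ => ?_
  rcases lt_trichotomy c i with h | rfl | h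
  · simp [h.ne, not_le.2 h, not_le.2 (h.trans (Nat.lt_succ_self i))]
  · simp
  · simp [h.ne', h.le, Nat.succ_le_of_lt h]

-- Subtrees of different children are disjoint. The bound excludes overflow while the sums over
-- children are being accumulated.
open Classical in
theorem sum_up_le (hE : IsElimination n A S) (i M : ℕ) :
    ∑ c ∈ (Finset.range n).filter (fun c => Child S c i), up n A S col c M ≤ n := by
  have key : ∀ p : ℕ → Prop, ∑ c ∈ (Finset.range n).filter (fun c => Child S c i),
      ((Finset.range n).filter fun u => Desc S c u ∧ p u).card ≤ n := by
    intro p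
    rw [← card_desc hE]
    simpa using Finset.card_filter_le (Finset.range n) fun u => (Desc S i u ∧ u ≠ i) ∧ p u
  refine (Finset.sum_le_sum fun c _ => ?_).trans (key fun _ => True)
  rw [up]
  refine Finset.card_le_card fun u hu => ?_
  simp only [Finset.mem_filter] at hu ⊢
  tauto

theorem up_le (i M : ℕ) : up n A S col i M ≤ n := by
  classical
  rw [up]
  simpa using Finset.card_filter_le (Finset.range n) fun u => Desc S i u ∧ Hit A col (S i) u M

end Elim

namespace Loop

variable {B n k : ℕ} {A : ℕ → ℕ → Prop} {S : ℕ → Finset ℕ} {col : ℕ → ℕ} {σ τ : Env}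

/-- Whether a vertex hits a mask is thereby decided by one look at a table of restricted masks. -/
theorem Restricts.ne_zero {X : Finset ℕ} {u M M' : ℕ} (h : Restricts X (A u) col M M') :
    M' ≠ 0 ↔ Elim.Hit A col X u M := by
  constructor
  · intro h0
    obtain ⟨c, hc⟩ := Nat.exists_testBit_of_ne_zero h0
    obtain ⟨h1, z, hz, h2, rfl⟩ := (h c).1 hc
    exact ⟨z, hz, h2, h1⟩
  · rintro ⟨z, hz, h1, h2⟩ rfl
    simpa using (h (col z)).2 ⟨h2, z, hz, h1, rfl⟩

/-- Computes, from the leaves of the elimination tree to its roots, the tables `up` in `a_T`, and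
their sums over the children of a vertex in `a_W`. -/
def upPass : Cmd :=
  .forTo v_j v_jEnd †v_n
    (v_i ::= †v_n - (†v_j + 1) ;; mask a_nbf a_nbp (.get a_adj †v_i †v_z) ;; remove ;;
      v_s ::= .get a_size 0 †v_i ;; v_p ::= .get a_par 0 †v_i ;;
      .forTo v_M v_MEnd †v_P
        (v_x ::= .get a_W †v_i (.get a_rm †v_i †v_M) ;;
          .ite (.get a_nbp †v_i †v_M) (v_x ::= †v_x + 1) .skip ;;
          .put a_T †v_i †v_M †v_x ;;
          .ite †v_s (.put a_W †v_p †v_M (.get a_W †v_p †v_M + †v_x)) .skip))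

/-- The tables of the bottom-up pass are correct for the vertices from `lo` on. -/
structure UpTables (n k : ℕ) (A : ℕ → ℕ → Prop) (S : ℕ → Finset ℕ) (col : ℕ → ℕ) (lo : ℕ)
    (σ : Env) : Prop where
  nbp : ∀ r < n, lo ≤ r → ∀ M < 2 ^ k, σ.arr a_nbp r M < 2 ^ k ∧
    Restricts (S r) (A r) col M (σ.arr a_nbp r M)
  rm : ∀ r < n, lo ≤ r → ∀ M < 2 ^ k, σ.arr a_rm r M < 2 ^ k ∧
    ∀ c, (σ.arr a_rm r M).testBit c = true ↔ M.testBit c = true ∧ c ≠ col r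
  up : ∀ r < n, lo ≤ r → ∀ M < 2 ^ k, σ.arr a_T r M = Elim.up n A S col r M

-- Children are larger than their parents, so in descending order the sum over all children of `i`
-- is complete when `i` is reached. Then `up_eq` gives the table of `i`, which is added to the sum
-- of its parent.
open Classical in
theorem wp_upPass (h : Setup B n k A S col σ) (hB : 16 * (n + k + 1) ≤ B) (hk : 2 ^ k ≤ 2 * n)
    (hE : Elim.IsElimination n A S) (hproper : Elim.Proper n S col) (hcol : ∀ i < n, col i < k)
    (hcard : ∀ i < n, (S i).card < k) (hW : ∀ p M, σ.arr a_W p M = 0) :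
    wp B upPass (fun t τ => t ≤ 1200 * n * 2 ^ k + 20 ∧ UpTables n k A S col 0 τ ∧
      ∀ p < n, ∀ M < 2 ^ k, τ.arr a_W p M =
        ∑ c ∈ (Finset.range n).filter (fun c => Elim.Child S c p), Elim.up n A S col c M) σ := by
  have hkk : k < 2 ^ k := Nat.lt_two_pow_self
  refine wp_for (fun j τ => UpTables n k A S col (n - j) τ ∧ ∀ p < n, ∀ M < 2 ^ k, τ.arr a_W p M =
        ∑ c ∈ (Finset.range n).filter (fun c => Elim.Child S c p ∧ n - j ≤ c),
          Elim.up n A S col c M) n (1100 * 2 ^ k)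
    (by decide) (by decide) (by decide) (by omega) (by simp) (by simp [h.size]) ⟨?_, ?_⟩ ?_ ?_
  · constructor <;> · intro r hr hr'; omega
  · intro p hp M hM
    rw [Finset.filter_false_of_mem]
    · simp [hW]
    · intro c hc
      simp at hc
      omega
  · rintro j hj τ hvj - hf ⟨hI, hIW⟩
    have h1 : Setup B n k A S col τ := h.frame hf rfl
    have hvB := h1.bound
    obtain ⟨i, hi⟩ : ∃ i, i = n - (j + 1) := ⟨_, rfl⟩
    have hin : i < n := by omega
    have hlo : n - j = i + 1 := by omega
    rw [hlo] at hI hIW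
    rw [← hi]
    simp only [wp_seq, wp_assign, eval_sub, eval_var, eval_add, eval_ofNat, h1.size, hvj, ← hi]
    refine ⟨by simp [hvj]; omega, ?_⟩
    have h1' : Setup B n k A S col (τ.set v_i i) :=
      h1.set (by decide) (by decide) (by decide) (by decide)
    refine (wp_mask (i := i) (P := A i) h1' (by decide) (by decide) (by decide) rfl (by decide)
      (by simp) hin hB hk hE.lt hcol (hcard i hin) ?_ (by simp)).mono ?_
    · intro τ' z hz hv ha hvz
      have hzn := hE.lt i hin z hz
      have e1 : τ'.var v_B = B := by
        rw [hv _ (by decide) (by decide) (by decide) (by decide) (by decide)]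
        simpa using hvB
      have e2 : τ'.var v_i = i := by
        rw [hv _ (by decide) (by decide) (by decide) (by decide) (by decide)]
        simp
      have e3 : τ'.arr a_adj = τ.arr a_adj := by
        rw [ha _ (by decide)]
        simp
      simp only [safe_get, safe_var, eval_get, eval_var, e1, e2, e3, hvz]
      refine ⟨⟨trivial, trivial, by omega, trivial, by omega, by omega⟩, h1.adj i hin z (by omega)⟩
    rintro t2 τ2 ⟨ht2, hm, hm'⟩ hf2
    have h2 : Setup B n k A S col τ2 := h1'.frame hf2 rfl
    have hvi2 := hf2.var v_i rfl
    replace hvi2 : τ2.var v_i = i := by simpa using hvi2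
    refine (wp_remove h2 hvi2 hin hB hk hcol).mono ?_
    rintro t3 τ3 ⟨ht3, hr, hr'⟩ hf3
    have h3 : Setup B n k A S col τ3 := h2.frame hf3 rfl
    have hvi3 := hf3.var v_i rfl
    rw [hvi2] at hvi3
    have hR := h3.row i hin
    have hcin := hcard i hin
    have hnbp3 : τ3.arr a_nbp = τ2.arr a_nbp := hf3.arr _ rfl
    have hW3 : τ3.arr a_W = τ.arr a_W := by rw [hf3.arr _ rfl, hf2.arr _ rfl]; rfl
    have hT3 : τ3.arr a_T = τ.arr a_T := by rw [hf3.arr _ rfl, hf2.arr _ rfl]; rfl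
    have hrm2 : τ2.arr a_rm = τ.arr a_rm := by rw [hf2.arr _ rfl]; rfl
    refine ⟨by simp [hvi3, h3.bound]; omega, by simp [hvi3, h3.bound]; omega, ?_⟩
    simp only [eval_get, eval_var, eval_ofNat, Env.set_arr, hvi3, hR.size]
    let U := fun r M => Elim.up n A S col r M
    refine wp_for (fun M τ' => (∀ M' < M, τ'.arr a_T i M' = U i M') ∧
        (∀ r ≠ i, τ'.arr a_T r = τ.arr a_T r) ∧
        ∀ r < n, ∀ M' < 2 ^ k, τ'.arr a_W r M' = τ.arr a_W r M' +
          if Elim.Child S i r ∧ M' < M then U i M' else 0) (2 ^ k) 150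
      (by decide) rfl rfl (by omega) (by simp) (by simp [h3.two_pow]) ⟨by simp, ?_, ?_⟩ ?_ ?_
    · simp [hT3]
    · simp [hW3]
    · rintro M hM τ4 hvM - hf4 ⟨i1, i2, i3⟩
      have h4 : Setup B n k A S col τ4 := (((h3.set (x := v_s) (by decide) (by decide)
        (by decide) (by decide)).set (x := v_p) (by decide) (by decide) (by decide)
        (by decide)).frame hf4 rfl)
      have hvB4 := h4.bound
      have hvi4 := hf4.var v_i rfl
      have hvs4 := hf4.var v_s rfl
      have hvp4 := hf4.var v_p rfl
      have hnbp4 := hf4.arr a_nbp rfl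
      have hrm4 := hf4.arr a_rm rfl
      simp [hvi3] at hvi4 hvs4 hvp4 hnbp4 hrm4
      obtain ⟨hr1, hr2⟩ := hr M hM
      -- A vertex is not its own parent, so the additions to the parent's row do not disturb row `i`
      -- while it is being read.
      have hpar : ¬ Elim.Child S i i := fun hc => (hc.lt hE hin).ne rfl
      -- The recurrence `up_eq`, read off the tables: the masks without the colour of `i` index the
      -- sums over children, and a nonzero restricted mask contributes `i` itself.
      have hWi : τ4.arr a_W i (τ3.arr a_rm i M) + (if τ3.arr a_nbp i M ≠ 0 then 1 else 0) = U i M := by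
        rw [i3 i hin _ hr1, if_neg (fun hc => hpar hc.1), hIW i hin _ hr1]
        simp only [U, add_zero]
        rw [Elim.up_eq hE hproper hin hr2]
        congr 1
        · refine Finset.sum_congr (Finset.filter_congr fun c hc => ?_) fun _ _ => rfl
          simp only [and_iff_left_iff_imp]
          intro hc'
          exact hc'.lt hE (Finset.mem_range.1 hc)
        · rw [hnbp3]
          simp only [(hm M hM).2.ne_zero]
      have hU : U i M ≤ n := Elim.up_le i M
      have tail : ∀ t6 t5 τ5, t6 + t5 ≤ 60 → τ5.var v_x = U i M → τ5.var v_M = M → τ5.var v_B = B →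
          τ5.var v_i = i → τ5.var v_s = (S i).card → τ5.var v_p = τ3.arr a_par 0 i →
          τ5.arr = τ4.arr →
          wp B (.put a_T †v_i †v_M †v_x ;;
            .ite †v_s (.put a_W †v_p †v_M (.get a_W †v_p †v_M + †v_x)) .skip)
            (fun t' τ' => t6 + (t5 + t') ≤ 150 ∧
              (∀ M' < M + 1, (τ'.set v_M (M + 1)).arr a_T i M' = U i M') ∧
              (∀ r ≠ i, (τ'.set v_M (M + 1)).arr a_T r = τ.arr a_T r) ∧
              ∀ r < n, ∀ M' < 2 ^ k, (τ'.set v_M (M + 1)).arr a_W r M' = τ.arr a_W r M' +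
              if Elim.Child S i r ∧ M' < M + 1 then U i M' else 0) τ5 := by
        intro t6 t5 τ5 ht5 w1 w2 w3 w4 w5 w6 w7
        have hTnew : (∀ M' < M + 1, (if M' = M then U i M else τ4.arr a_T i M') = U i M') := by
          intro M' hM'
          split_ifs with h'
          · rw [h']
          · exact i1 M' (by omega)
        have hTold : ∀ r ≠ i, ∀ y, (if r = i ∧ y = M then U i M else τ4.arr a_T r y) =
            τ.arr a_T r y := by
          intro r hr y
          rw [if_neg (fun h => hr h.1), i2 r hr]
        simp only [wp_seq, wp_put, wp_ite, wp_skip]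
        refine ⟨by simp [w2, w3, w4]; omega, trivial, fun hne => ?_, fun he => ?_⟩
        · simp [w5] at hne
          have hch : Elim.Child S i (Elim.par S i) := ⟨Finset.nonempty_iff_ne_empty.2 hne, rfl⟩
          have hpv : τ3.arr a_par 0 i = Elim.par S i := hR.par hch.1
          have hplt := hch.lt hE hin
          have hpn : Elim.par S i < n := hplt.trans hin
          have hWp := i3 _ hpn M hM
          have hsum := Elim.sum_up_le (col := col) hE (Elim.par S i) M
          -- The new value is a partial sum over the children of the parent.
          have hle : τ4.arr a_W (Elim.par S i) M + U i M ≤ n := by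
            rw [hWp, if_neg (fun h => absurd h.2 (lt_irrefl _)), add_zero, hIW _ hpn M hM]
            have := Elim.sum_filter_le_succ (p := fun c => Elim.Child S c (Elim.par S i))
              (fun c => Elim.up n A S col c M) hin
            rw [if_pos hch] at this
            refine this.symm.le.trans (le_trans (Finset.sum_le_sum_of_subset fun c => ?_) hsum)
            simp only [Finset.mem_filter]
            tauto
          simp [w1, w2, w3, w4, w6, w7, hpv]
          refine ⟨by omega, by omega, by simpa [Nat.lt_succ_iff] using hTnew,
            fun r hr => by funext y; simpa [w7] using hTold r hr y, fun r hrn M' hM' => ?_⟩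
          have hiff : Elim.Child S i r ↔ r = Elim.par S i :=
            ⟨fun hc => hc.2.symm, fun hc => hc ▸ hch⟩
          have h5 := i3 r hrn M' hM'
          rw [hiff] at h5 ⊢
          by_cases hrp : r = Elim.par S i
          · subst hrp
            rcases lt_trichotomy M' M with hlt | rfl | hlt
            · simpa [hlt, hlt.ne, hlt.le] using h5
            · simpa using h5
            · simpa [hlt.not_gt, hlt.ne', hlt.not_ge] using h5
          · simpa [hrp] using h5
        · simp [w5] at he
          have hno : ∀ r, ¬ Elim.Child S i r := fun r hc => by simpa [he] using hc.1
          refine ⟨by simp; omega, by simpa [w1, w2, w4, w7] using hTnew,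
            fun r hr => by funext y; simpa [w1, w2, w4, w7] using hTold r hr y, fun r hrn M' hM' => ?_⟩
          simp [w7, i3 r hrn M' hM', hno]
      rw [wp_seq, wp_assign]
      refine ⟨by simp [hvi4, hvM, hvB4, hrm4]; omega, ?_⟩
      rw [wp_seq, wp_ite]
      simp only [wp_assign, wp_skip, eval_get, eval_var, Env.set_arr, hvM, hvi4, hrm4, hnbp4]
      refine ⟨by simp [hvi4, hvM, hvB4]; omega, fun hne => ⟨?_, ?_⟩, fun he => ?_⟩
      · have hne' : τ3.arr a_nbp i M ≠ 0 := by simpa [hvi4, hvM] using hne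
        rw [if_pos hne'] at hWi
        simp
        omega
      · have hne' : τ3.arr a_nbp i M ≠ 0 := by simpa [hvi4, hvM] using hne
        rw [if_pos hne'] at hWi
        refine tail _ _ _ ?_ ?_ ?_ ?_ ?_ ?_ ?_ ?_ <;>
          simp [hWi, hvM, hvB4, hvi4, hvs4, hvp4]
      · have he' : τ3.arr a_nbp i M = 0 := by simpa [hvi4, hvM] using he
        simp only [he', ne_eq, not_true_eq_false, if_false, add_zero] at hWi
        refine tail _ _ _ ?_ ?_ ?_ ?_ ?_ ?_ ?_ ?_ <;>
          simp [hWi, hvM, hvB4, hvi4, hvs4, hvp4]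
    · rintro t4 τ4 ht4 ⟨i1, i2, i3⟩ hf4
      have hnbp4 := hf4.arr a_nbp rfl
      have hrm4 := hf4.arr a_rm rfl
      simp at ht4
      refine ⟨?_, ⟨?_, ?_, ?_⟩, ?_⟩
      · simp
        omega
      · intro r hrn hir M hM
        simp only [Env.set_arr, hnbp4, hnbp3]
        rcases hir.eq_or_lt with rfl | hir
        · exact hm M hM
        · rw [hm' r hir.ne']
          exact hI.nbp r hrn hir M hM
      · intro r hrn hir M hM
        simp only [Env.set_arr, hrm4]
        rcases hir.eq_or_lt with rfl | hir
        · exact hr M hM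
        · rw [hr' r hir.ne', hrm2]
          exact hI.rm r hrn hir M hM
      · intro r hrn hir M hM
        simp only [Env.set_arr]
        rcases hir.eq_or_lt with rfl | hir
        · exact i1 M hM
        · rw [i2 r hir.ne']
          exact hI.up r hrn hir M hM
      · intro r hrn M hM
        rw [Elim.sum_filter_le_succ (fun c => Elim.up n A S col c M) hin, i3 r hrn M hM,
          hIW r hrn M hM]
        simp [hM, U]
  · rintro t τ ht ⟨hI, hIW⟩ -
    simp at ht
    rw [Nat.sub_self] at hI
    refine ⟨by nlinarith, hI, fun p hp M hM => ?_⟩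
    rw [hIW p hp M hM]
    congr 1
    ext c
    simp

end Loop

/-! ### The top-down pass -/

namespace Elim

variable {n : ℕ} {A : ℕ → ℕ → Prop} {S : ℕ → Finset ℕ} {col : ℕ → ℕ}

theorem total_le (i M : ℕ) : total n A S col i M ≤ n := by
  classical
  rw [total]
  simpa using Finset.card_filter_le (Finset.range n) fun u => u ∉ bag S i ∧ Hit A col (bag S i) u M

theorem down_of_eq_empty {i : ℕ} (h : S i = ∅) (M : ℕ) : down n A S col i M = 0 := by
  simp [down, Hit, h]

/-- Vertices below `i` are larger than `p` and hence outside its bag. The inequality makes the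
truncated subtraction in `descend` exact. -/
theorem up_le_total (hE : IsElimination n A S) {i p M M' : ℕ} (hi : i < n) (hp : Child S i p)
    (hM : ∀ c, M'.testBit c = true ↔ M.testBit c = true ∧ ∃ z ∈ S i, col z = c) :
    up n A S col i M ≤ total n A S col p M' := by
  classical
  rw [up, total]
  refine Finset.card_le_card fun u => ?_
  simp only [Finset.mem_filter, Finset.mem_range]
  rintro ⟨hu, hd, z, hz, hA, hc⟩
  refine ⟨hu, fun hb => ?_, z, subset_bag hE hi hp hz, hA, (hM _).2 ⟨hc, z, hz, rfl⟩⟩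
  have h1 := hd.le hE hu
  have h2 := hp.lt hE hi
  rcases mem_bag.1 hb with rfl | hb
  · omega
  · have := hE.lt p (by omega) u hb
    omega

theorem sum_filter_lt_succ {n i : ℕ} {p : ℕ → Prop} [DecidablePred p] (f : ℕ → ℕ) (hi : i < n) :
    ∑ c ∈ (Finset.range n).filter (fun c => p c ∧ c < i + 1), f c =
      ∑ c ∈ (Finset.range n).filter (fun c => p c ∧ c < i), f c + if p i then f i else 0 := by
  have : (if p i then f i else 0) = ∑ c ∈ Finset.range n, if c = i then (if p i then f i else 0)
      else 0 := by
    rw [Finset.sum_ite_eq' _ _ fun _ => if p i then f i else 0, if_pos (Finset.mem_range.2 hi)]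
  rw [Finset.sum_filter, Finset.sum_filter, this, ← Finset.sum_add_distrib]
  refine Finset.sum_congr rfl fun c _ => ?_
  rcases lt_trichotomy c i with h | rfl | h
  · simp [h.ne, h, h.le]
  · simp
  · simp [h.ne', h.not_gt, h.not_ge]

end Elim

namespace Loop

variable {B n k : ℕ} {A : ℕ → ℕ → Prop} {S : ℕ → Finset ℕ} {col : ℕ → ℕ} {σ τ : Env}

/-- Adds the vertex `v_u` to the table `a_Y` of the current vertex, and counts the descendants of
the current vertex for `v_u`. -/
def visit : Cmd :=
  mask a_fl a_tmp (.get a_adj †v_u †v_z) ;;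
  .forTo v_M v_MEnd †v_P
    (.ite (.get a_tmp †v_i †v_M) (.put a_Y †v_i †v_M (.get a_Y †v_i †v_M + 1)) .skip) ;;
  .put a_ans 0 †v_u (.get a_ans 0 †v_u + .get a_T †v_i (.get a_tmp †v_i (†v_P - 1)))

/-- Computes the table `down` of the current vertex in `a_Y`, from the totals of its parent, and
counts the descendants of the current vertex for those elements of the bag of the parent that leave
the bag. -/
def descend : Cmd :=
  v_p ::= .get a_par 0 †v_i ;; mask a_scf a_pr 1 ;;
  .forTo v_M v_MEnd †v_P
    (.put a_Y †v_i †v_M (.get a_W †v_p (.get a_pr †v_i †v_M) - .get a_T †v_i †v_M)) ;;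
  .forTo v_j v_jEnd (.get a_size 0 †v_p)
    (v_u ::= .get a_S †v_p †v_j ;;
      .ite (.get a_in †v_i †v_u) .skip
        visit)

/-- The mask `2 ^ k - 1` contains all colours, so the last entry of a table of restrictions is the
mask of the selected elements themselves. -/
theorem Restricts.eq_of_all {X : Finset ℕ} {P : ℕ → Prop} {M m : ℕ} (hcol : ∀ z ∈ X, col z < k)
    (h : Restricts X P col (2 ^ k - 1) M)
    (hm : ∀ c, m.testBit c = true ↔ ∃ z ∈ X, P z ∧ col z = c) : M = m := by
  refine Nat.eq_of_testBit_eq fun c => Bool.eq_iff_iff.2 ?_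
  rw [h c, hm c, Nat.testBit_two_pow_sub_one]
  simp only [decide_eq_true_eq, and_iff_right_iff_imp]
  rintro ⟨z, hz, -, rfl⟩
  exact hcol z hz

theorem Row.injOn {X : Finset ℕ} {r : ℕ} (h : Row X r σ) :
    Set.InjOn (σ.arr a_S r) (Finset.range X.card) := by
  refine Finset.injOn_of_card_image_eq ?_
  rw [h.image, Finset.card_range]

-- One table of restrictions for `u` serves twice. Its nonzero entries are the masks that `u` hits,
-- and its last entry is the mask of the neighbours of `u` in `S i`, at which the table `up`
-- supplies the contribution of `i` to the count for `u`.
open Classical in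
theorem wp_visit {i u : ℕ} {m : ℕ → ℕ → ℕ} (h : Setup B n k A S col σ)
    (hB : 16 * (n + k + 1) ≤ B)
    (hk : 2 ^ k ≤ 2 * n) (hlt : ∀ i < n, ∀ j ∈ S i, j < i)
    (hcol : ∀ i < n, col i < k) (hcard : ∀ i < n, (S i).card < k)
    (hm : ∀ v < n, ∀ i < n, ∀ c, (m v i).testBit c = true ↔ ∃ z ∈ S i, A v z ∧ col z = c)
    (hvi : σ.var v_i = i) (hi : i < n) (hvu : σ.var v_u = u) (hu : u < n)
    (hT : ∀ M < 2 ^ k, σ.arr a_T i M = Elim.up n A S col i M)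
    (hY : ∀ M < 2 ^ k, σ.arr a_Y i M + 1 ≤ B)
    (hans : σ.arr a_ans 0 u + Elim.up n A S col i (m u i) ≤ n) :
    wp B visit (fun t τ => t ≤ 550 * 2 ^ k ∧
      (∀ M < 2 ^ k, τ.arr a_Y i M = σ.arr a_Y i M + if Elim.Hit A col (S i) u M then 1 else 0) ∧
      (∀ r ≠ i, τ.arr a_Y r = σ.arr a_Y r) ∧
      ∀ v, τ.arr a_ans 0 v = σ.arr a_ans 0 v +
        if v = u then Elim.up n A S col i (m u i) else 0) σ := by
  have hkk : k < 2 ^ k := Nat.lt_two_pow_self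
  simp only [visit, wp_seq]
  refine (wp_mask (i := i) (P := A u) h (by decide) (by decide) (by decide) rfl
    (by decide) hvi hi hB hk hlt hcol (hcard i hi) ?_ (by simp)).mono ?_
  · intro τ z hz hv ha hvz
    have hzn := hlt i hi z hz
    have e1 : τ.var v_B = B := by
      rw [hv _ (by decide) (by decide) (by decide) (by decide) (by decide)]
      exact h.bound
    have e2 : τ.var v_u = u := by
      rw [hv _ (by decide) (by decide) (by decide) (by decide) (by decide)]
      exact hvu
    have e3 : τ.arr a_adj = σ.arr a_adj := ha _ (by decide)
    simp only [safe_get, safe_var, eval_get, eval_var, e1, e2, e3, hvz]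
    exact ⟨⟨trivial, trivial, by omega, trivial, by omega, by omega⟩, h.adj u hu z (by omega)⟩
  rintro t2 τ2 ⟨ht2, hpr, -⟩ hf2
  have h2 : Setup B n k A S col τ2 := h.frame hf2 rfl
  have hvi2 := hf2.var v_i rfl
  have hvu2 := hf2.var v_u rfl
  have hT2 := hf2.arr a_T rfl
  have hY2 := hf2.arr a_Y rfl
  have ha2 := hf2.arr a_ans rfl
  rw [hvi] at hvi2
  rw [hvu] at hvu2
  refine wp_for (fun M τ => (∀ M', τ.arr a_Y i M' = σ.arr a_Y i M' +
      if M' < M ∧ Elim.Hit A col (S i) u M' then 1 else 0) ∧ ∀ r ≠ i, τ.arr a_Y r = σ.arr a_Y r)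
    (2 ^ k) 60 (by decide) (by decide) (by decide) (by omega) (by simp) (by simp [h2.two_pow])
    ⟨by simp [hY2], by simp [hY2]⟩ ?_ ?_
  · rintro M hM τ3 hvM - hf3 ⟨i1, i2⟩
    have hvB3 : τ3.var v_B = B := (hf3.var v_B rfl).trans h2.bound
    have hvi3 := hf3.var v_i rfl
    have htmp3 := hf3.arr a_tmp rfl
    rw [hvi2] at hvi3
    have hne := (hpr M hM).2.ne_zero
    have hYM := hY M hM
    have i1M : τ3.arr a_Y i M = σ.arr a_Y i M := by simpa using i1 M
    simp only [wp_ite, wp_put, wp_skip]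
    refine ⟨by simp [hvB3, hvi3, hvM]; omega, fun h5 => ?_, fun h5 => ?_⟩
    · have hH : Elim.Hit A col (S i) u M := hne.1 (by simpa [hvi3, hvM, htmp3] using h5)
      refine ⟨by simp [hvB3, hvi3, hvM, i1M]; omega, by simp, fun M' => ?_, fun r hr => ?_⟩
      · simp only [Env.set_arr, Env.put_arr, eval_var, eval_add, eval_get, eval_ofNat, hvi3, hvM,
          i1M]
        rcases lt_trichotomy M' M with hlt | rfl | hlt
        · simpa [hlt.ne, hlt, hlt.le, Nat.lt_succ_iff] using i1 M'
        · simp [hH]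
        · simpa [hlt.ne', hlt.not_gt, hlt.not_ge, Nat.lt_succ_iff] using i1 M'
      · rw [← i2 r hr]
        funext y
        simp [hvi3, hr]
    · have hH : ¬ Elim.Hit A col (S i) u M := fun hc => hne.2 hc (by
        simpa [hvi3, hvM, htmp3] using h5)
      refine ⟨by simp, fun M' => ?_, fun r hr => by simpa using i2 r hr⟩
      rw [Env.set_arr, i1 M']
      congr 1
      refine if_congr ?_ rfl rfl
      constructor
      · rintro ⟨h6, h7⟩
        exact ⟨by omega, h7⟩
      · rintro ⟨h6, h7⟩
        refine ⟨lt_of_le_of_ne (by omega) ?_, h7⟩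
        rintro rfl
        exact hH h7
  · rintro t3 τ3 ht3 ⟨i1, i2⟩ hf3
    have h3 : Setup B n k A S col τ3 := h2.frame hf3 rfl
    have hvi3 := hf3.var v_i rfl
    have hvu3 := hf3.var v_u rfl
    have htmp3 := hf3.arr a_tmp rfl
    have hT3 := hf3.arr a_T rfl
    have ha3 := hf3.arr a_ans rfl
    rw [hvi2] at hvi3
    rw [hvu2] at hvu3
    rw [hT2] at hT3
    rw [ha2] at ha3
    obtain ⟨g1, g2⟩ := hpr (2 ^ k - 1) (by omega)
    have g3 := g2.eq_of_all (fun z hz => hcol z ((hlt i hi z hz).trans hi)) (hm u hu i hi)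
    have g4 := hT _ g1
    rw [g3] at g1 g4
    simp at ht3
    rw [wp_put]
    simp only [eval_get, eval_var, eval_ofNat, eval_sub, eval_add, hvi3, hvu3, h3.two_pow, htmp3,
      hT3, ha3, g3, g4]
    refine ⟨by simp [h3.bound, hvi3, hvu3, h3.two_pow, htmp3, g3, hT3, ha3, g4]; omega, by simp; omega,
      fun M hM => ?_, fun r hr => ?_, fun v => ?_⟩
    · simpa [hM] using i1 M
    · rw [← i2 r hr]
      funext y
      simp
    · by_cases hvu' : v = u <;> simp [hvu', ha3]

-- The elements of `S p` outside `S i` form the correction term of `down_add_up`, and they are also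
-- the vertices with an exit at `i`. A single loop over `S p` therefore finishes the table and all
-- counts belonging to `i`; it makes fewer than `k` visits of cost `O(2 ^ k)` each.
set_option maxHeartbeats 800000 in
open Classical in
theorem wp_descend {i p : ℕ} {m : ℕ → ℕ → ℕ} (h : Setup B n k A S col σ)
    (hB : 16 * (n + k + 1) ≤ B)
    (hk : 2 ^ k ≤ 2 * n) (hE : Elim.IsElimination n A S) (hproper : Elim.Proper n S col)
    (hcol : ∀ i < n, col i < k) (hcard : ∀ i < n, (S i).card < k)
    (hm : ∀ v < n, ∀ i < n, ∀ c, (m v i).testBit c = true ↔ ∃ z ∈ S i, A v z ∧ col z = c)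
    (hU : UpTables n k A S col 0 σ) (hvi : σ.var v_i = i) (hi : i < n) (hp : Elim.Child S i p)
    (hW : ∀ M < 2 ^ k, σ.arr a_W p M = Elim.total n A S col p M)
    (hans : ∀ u < n, Elim.Exits S u i → σ.arr a_ans 0 u + Elim.up n A S col i (m u i) ≤ n) :
    wp B descend (fun t τ => t ≤ 1200 * k * 2 ^ k ∧
      (∀ M < 2 ^ k, τ.arr a_Y i M = Elim.down n A S col i M) ∧
      (∀ r ≠ i, τ.arr a_Y r = σ.arr a_Y r) ∧
      ∀ u < n, τ.arr a_ans 0 u = σ.arr a_ans 0 u +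
        if Elim.Exits S u i then Elim.up n A S col i (m u i) else 0) σ := by
  have hkk : k < 2 ^ k := Nat.lt_two_pow_self
  have hci := hcard i hi
  have hR := h.row i hi
  have hpi := hp.lt hE hi
  have hpn : p < n := hpi.trans hi
  have hcp := hcard p hpn
  have hpar : σ.arr a_par 0 i = p := (hR.par hp.1).trans hp.2
  simp only [descend, wp_seq, wp_assign]
  refine ⟨by simp [h.bound, hvi]; omega, ?_⟩
  simp only [eval_get, eval_var, eval_ofNat, hvi, hpar]
  have h1 : Setup B n k A S col (σ.set v_p p) :=
    h.set (by decide) (by decide) (by decide) (by decide)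
  refine (wp_mask (i := i) (P := fun _ => True) h1 (by decide) (by decide) (by decide) rfl
    (by decide) (by simpa using hvi) hi hB hk hE.lt hcol hci ?_ (by simp)).mono ?_
  · intro τ z hz _ _ _
    simp
    omega
  rintro t2 τ2 ⟨ht2, hpr, -⟩ hf2
  have h2 : Setup B n k A S col τ2 := h1.frame hf2 rfl
  have hvi2 : τ2.var v_i = i := by simpa [hvi] using hf2.var v_i rfl
  have hvp2 : τ2.var v_p = p := by simpa using hf2.var v_p rfl
  have hW2 : τ2.arr a_W = σ.arr a_W := by simpa using hf2.arr a_W rfl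
  have hT2 : τ2.arr a_T = σ.arr a_T := by simpa using hf2.arr a_T rfl
  have hY2 : τ2.arr a_Y = σ.arr a_Y := by simpa using hf2.arr a_Y rfl
  have ha2 : τ2.arr a_ans = σ.arr a_ans := by simpa using hf2.arr a_ans rfl
  let D := fun M => Elim.total n A S col p (τ2.arr a_pr i M) - Elim.up n A S col i M
  have hD : ∀ M, D M ≤ n := fun M => (Nat.sub_le _ _).trans (Elim.total_le _ _)
  refine wp_for (fun M τ => (∀ M' < M, τ.arr a_Y i M' = D M') ∧ ∀ r ≠ i, τ.arr a_Y r = σ.arr a_Y r)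
    (2 ^ k) 80 (by decide) (by decide) (by decide) (by omega) (by simp) (by simp [h2.two_pow])
    ⟨by simp, by simp [hY2]⟩ ?_ ?_
  · rintro M hM τ3 hvM - hf3 ⟨i1, i2⟩
    have h3 : Setup B n k A S col τ3 := h2.frame hf3 rfl
    have hvi3 := hf3.var v_i rfl
    have hvp3 := hf3.var v_p rfl
    have hpr3 := hf3.arr a_pr rfl
    have hW3 := hf3.arr a_W rfl
    have hT3 := hf3.arr a_T rfl
    obtain ⟨hpr1, -⟩ := hpr M hM
    have e1 := hW _ hpr1
    have e2 := hU.up i hi (Nat.zero_le _) M hM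
    simp [h3.bound, hvi3, hvi2, hvp3, hvp2, hpr3, hvM, hW3, hW2, hT3, hT2, e1, e2]
    and_intros
    all_goals first | omega | skip
    · intro M' hM'
      split_ifs with h'
      · rw [h']
      · exact i1 M' (by omega)
    · intro r hr
      rw [← i2 r hr]
      funext y
      simp [hr]
  rintro t3 τ3 ht3 ⟨hY3, hY3'⟩ hf3
  have h3 : Setup B n k A S col τ3 := h2.frame hf3 rfl
  have hvi3 := hf3.var v_i rfl
  have hvp3 := hf3.var v_p rfl
  have hT3 := hf3.arr a_T rfl
  have ha3 := hf3.arr a_ans rfl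
  rw [hvi2] at hvi3
  rw [hvp2] at hvp3
  rw [hT2] at hT3
  rw [ha2] at ha3
  simp at ht3
  have hR3 := h3.row p hpn
  have hRi3 := h3.row i hi
  set f := τ3.arr a_S p with hf
  refine wp_for (fun j τ => (∀ M < 2 ^ k, τ.arr a_Y i M = D M +
      (((Finset.range j).image f).filter fun u => u ∉ S i ∧ Elim.Hit A col (S i) u M).card) ∧
      (∀ r ≠ i, τ.arr a_Y r = σ.arr a_Y r) ∧
      ∀ u < n, τ.arr a_ans 0 u = σ.arr a_ans 0 u +
        if u ∈ (Finset.range j).image f ∧ u ∉ S i then Elim.up n A S col i (m u i) else 0)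
    (S p).card (600 * 2 ^ k) (by decide) (by decide) (by decide) (by omega)
    (by simp [h3.bound, hvp3]; omega) (by simp [hvp3, hR3.size])
    ⟨by simpa using hY3, by simpa using hY3', by simp [ha3]⟩ ?_ ?_
  · rintro j hj τ4 hvj - hf4 ⟨i1, i2, i3⟩
    have h4 : Setup B n k A S col τ4 := h3.frame hf4 rfl
    have hvi4 := hf4.var v_i rfl
    have hvp4 := hf4.var v_p rfl
    have hS4 := hf4.arr a_S rfl
    have hT4 := hf4.arr a_T rfl
    rw [hvi3] at hvi4
    rw [hvp3] at hvp4
    rw [hT3] at hT4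
    obtain ⟨u, hu⟩ : ∃ u, u = f j := ⟨_, rfl⟩
    have huS : u ∈ S p := hu ▸ hR3.mem_of_lt hj
    have hup := hE.lt p hpn u huS
    have hun : u < n := hup.trans hpn
    have hnew : u ∉ (Finset.range j).image f := by
      intro hmem
      obtain ⟨l, hl, hl'⟩ := Finset.mem_image.1 hmem
      have hl := Finset.mem_range.1 hl
      have := hR3.injOn (Finset.mem_coe.2 (Finset.mem_range.2 (hl.trans hj)))
        (Finset.mem_coe.2 (Finset.mem_range.2 hj)) (hl'.trans hu)
      omega
    have himg : (Finset.range (j + 1)).image f = insert u ((Finset.range j).image f) := by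
      rw [Finset.range_add_one, Finset.image_insert, hu]
    have hin := (h4.row i hi).mem u
    simp only [wp_seq, wp_assign]
    refine ⟨by simp [h4.bound, hvp4, hvj]; omega, ?_⟩
    simp only [eval_get, eval_var, hvp4, hvj, hS4, ← hf, ← hu]
    rw [wp_ite, wp_skip]
    simp only [eval_get, eval_var, Env.set_arr]
    refine ⟨by simp [h4.bound, hvi4]; omega, fun hne => ?_, fun h0 => ?_⟩
    · replace hne : u ∈ S i := hin.1 (by simpa [hvi4] using hne)
      refine ⟨by simp; omega, fun M hM => ?_, fun r hr => by simpa using i2 r hr, fun v hv => ?_⟩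
      · rw [himg, Finset.filter_insert, if_neg (by simp [hne])]
        simpa using i1 M hM
      · rw [i3 v hv, himg]
        congr 1
        refine if_congr ?_ rfl rfl
        simp only [Finset.mem_insert]
        constructor
        · tauto
        · rintro ⟨rfl | h5, h6⟩
          · exact absurd hne h6
          · exact ⟨h5, h6⟩
    · have hnu : u ∉ S i := fun hc => hin.2 hc (by simpa [hvi4] using h0)
      have hex : Elim.Exits S u i := ⟨hp.1, hp.2.symm ▸ huS, hnu⟩
      have hau : τ4.arr a_ans 0 u = σ.arr a_ans 0 u := by simpa [hnew] using i3 u hun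
      have hY4 : ∀ M < 2 ^ k, τ4.arr a_Y i M + 1 ≤ B := by
        intro M hM
        have g1 := (Finset.card_filter_le ((Finset.range j).image f)
          fun u => u ∉ S i ∧ Elim.Hit A col (S i) u M).trans Finset.card_image_le
        rw [Finset.card_range] at g1
        have g2 := hD M
        rw [i1 M hM]
        omega
      refine (wp_visit (u := u) (h4.set (by decide) (by decide) (by decide) (by decide)) hB hk hE.lt
        hcol hcard hm (by simpa using hvi4) hi (by simp) hun
        (by simpa [hT4] using hU.up i hi (Nat.zero_le _)) (by simpa using hY4)
        (by simpa [hau] using hans u hun hex)).mono ?_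
      rintro t5 τ5 ⟨ht5, j1, j2, j3⟩ -
      refine ⟨by simp; omega, fun M hM => ?_, fun r hr => ?_, fun v hv => ?_⟩
      · rw [j1 M hM, Env.set_arr, i1 M hM, himg, Finset.filter_insert]
        by_cases hH : Elim.Hit A col (S i) u M
        · rw [if_pos hH, if_pos ⟨hnu, hH⟩, Finset.card_insert_of_notMem, add_assoc]
          exact fun hc => hnew (Finset.mem_filter.1 hc).1
        · rw [if_neg hH, if_neg fun hc => hH hc.2, add_zero]
      · rw [j2 r hr, Env.set_arr, i2 r hr]
      · rw [j3 v, Env.set_arr, i3 v hv, himg]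
        by_cases hvu : v = u
        · subst hvu
          simp [hnew, hnu]
        · simp [hvu]
  · rintro t4 τ4 ht4 ⟨i1, i2, i3⟩ -
    have himg := hR3.image
    rw [himg] at i1 i3
    simp at ht4
    have g1 : (S p).card * (600 * 2 ^ k + 13) ≤ k * (613 * 2 ^ k) :=
      Nat.mul_le_mul hcp.le (by omega)
    have g2 : 1 * 2 ^ k ≤ k * 2 ^ k := Nat.mul_le_mul_right _ (by omega)
    have g3 : k * (613 * 2 ^ k) = 613 * (k * 2 ^ k) := by ring
    have g4 : 1200 * k * 2 ^ k = 1200 * (k * 2 ^ k) := by ring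
    refine ⟨by simp; omega, fun M hM => ?_, i2, fun u hu => ?_⟩
    · have hM2 : ∀ c, (τ2.arr a_pr i M).testBit c = true ↔
          M.testBit c = true ∧ ∃ z ∈ S i, col z = c := by
        intro c
        simpa using (hpr M hM).2 c
      have e1 := Elim.down_add_up hE hproper hi hp hM2
      have e2 := Elim.up_le_total hE hi hp hM2
      rw [i1 M hM]
      simp only [D]
      omega
    · rw [i3 u hu]
      congr 1
      refine if_congr ⟨fun h => ⟨hp.1, hp.2.symm ▸ h.1, h.2⟩, fun h => ⟨hp.2 ▸ h.2.1, h.2.2⟩⟩ rfl rfl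

end Loop

/-! ### All descendants and non-descendants -/

namespace Loop

variable {B n k : ℕ} {A : ℕ → ℕ → Prop} {S : ℕ → Finset ℕ} {col : ℕ → ℕ} {σ τ : Env}

/-- Computes, from the roots of the elimination tree to its leaves, the tables `total` in `a_W`, and
counts for every vertex all vertices at distance at most two that have no common bag with it. -/
def downPass : Cmd :=
  .forTo v_i v_iEnd †v_n
    (.ite (.get a_size 0 †v_i) descend .skip ;;
      .put a_ans 0 †v_i (.get a_ans 0 †v_i + .get a_Y †v_i (.get a_nbp †v_i (†v_P - 1))) ;;
      .forTo v_M v_MEnd †v_P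
        (.put a_W †v_i †v_M (.get a_W †v_i †v_M + .get a_Y †v_i (.get a_rm †v_i †v_M))))

open Classical in
/-- The number of vertices at distance at most two from `u` that have been counted when the vertices
below `i` have been processed. -/
noncomputable def counted (n : ℕ) (A : ℕ → ℕ → Prop) (S : ℕ → Finset ℕ) (col : ℕ → ℕ)
    (m : ℕ → ℕ → ℕ) (i u : ℕ) : ℕ :=
  ((Finset.range n).filter fun v => Elim.LocalNear n A S u v).card +
    (if u < i then Elim.down n A S col u (m u u) else 0) +
    ∑ j ∈ (Finset.range n).filter (fun j => Elim.Exits S u j ∧ j < i), Elim.up n A S col j (m u j)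

open Classical in
theorem counted_succ {m : ℕ → ℕ → ℕ} {i u : ℕ} (hi : i < n) :
    counted n A S col m (i + 1) u = counted n A S col m i u +
      (if u = i then Elim.down n A S col u (m u u) else 0) +
      if Elim.Exits S u i then Elim.up n A S col i (m u i) else 0 := by
  rw [counted, counted, Elim.sum_filter_lt_succ (fun j => Elim.up n A S col j (m u j)) hi]
  rcases lt_trichotomy u i with h | rfl | h
  · simp only [h, h.ne, Nat.lt_succ_of_lt h, if_true, if_false]
    ring
  · simp only [lt_irrefl, Nat.lt_succ_self, if_true, if_false]
    ring
  · simp only [h.ne', h.not_gt, not_lt.2 (Nat.succ_le_of_lt h), if_false]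
    ring

open Classical in
theorem counted_all {m : ℕ → ℕ → ℕ} {u : ℕ} (hE : Elim.IsElimination n A S)
    (hproper : Elim.Proper n S col)
    (hm : ∀ v < n, ∀ i < n, ∀ c, (m v i).testBit c = true ↔ ∃ z ∈ S i, A v z ∧ col z = c)
    (hu : u < n) :
    counted n A S col m n u = ((Finset.range n).filter fun v => Elim.Near A u v).card := by
  rw [Elim.card_near hE hproper hu (m u) (hm u hu), counted, if_pos hu]
  congr 1
  refine Finset.sum_congr (Finset.filter_congr fun j hj => ?_) fun _ _ => rfl
  simp only [Finset.mem_range.1 hj, and_true]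

/-- Together with `counted_all`, this bounds every intermediate counter by `n`. -/
theorem counted_mono {m : ℕ → ℕ → ℕ} {i u : ℕ} (hi : i ≤ n) (hu : u < n) :
    counted n A S col m i u ≤ counted n A S col m n u := by
  classical
  rw [counted, counted, if_pos hu]
  refine Nat.add_le_add (Nat.add_le_add le_rfl ?_) (Finset.sum_le_sum_of_subset fun j => ?_)
  · split_ifs <;> simp
  · simp only [Finset.mem_filter]
    rintro ⟨h1, h2, h3⟩
    exact ⟨h1, h2, by omega⟩

-- Parents precede children in ascending order, so the totals of the parent are available when `i`
-- is treated. The array `a_W` passes in place, row by row, from sums over children to totals.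
open Classical in
set_option maxHeartbeats 800000 in
theorem wp_downPass {m : ℕ → ℕ → ℕ} (h : Setup B n k A S col σ) (hB : 16 * (n + k + 1) ≤ B)
    (hk : 2 ^ k ≤ 2 * n) (hE : Elim.IsElimination n A S) (hproper : Elim.Proper n S col)
    (hcol : ∀ i < n, col i < k) (hcard : ∀ i < n, (S i).card < k)
    (hm : ∀ v < n, ∀ i < n, ∀ c, (m v i).testBit c = true ↔ ∃ z ∈ S i, A v z ∧ col z = c)
    (hU : UpTables n k A S col 0 σ)
    (hW : ∀ p < n, ∀ M < 2 ^ k, σ.arr a_W p M =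
      ∑ c ∈ (Finset.range n).filter (fun c => Elim.Child S c p), Elim.up n A S col c M)
    (hY : ∀ r M, σ.arr a_Y r M = 0) (hans : Marked n (Elim.LocalNear n A S) σ) :
    wp B downPass (fun t τ => t ≤ 1500 * n * k * 2 ^ k + 20 ∧
      ∀ u < n, τ.arr a_ans 0 u = ((Finset.range n).filter fun v => Elim.Near A u v).card) σ := by
  have hkk : k < 2 ^ k := Nat.lt_two_pow_self
  have hle : ∀ i ≤ n, ∀ u < n, counted n A S col m i u ≤ n := by
    intro i hi u hu
    refine (counted_mono hi hu).trans ?_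
    rw [counted_all hE hproper hm hu]
    simpa using Finset.card_filter_le (Finset.range n) fun v => Elim.Near A u v
  refine wp_for (fun i τ => (∀ r < i, ∀ M < 2 ^ k, τ.arr a_W r M = Elim.total n A S col r M) ∧
      (∀ r < n, i ≤ r → τ.arr a_W r = σ.arr a_W r) ∧ (∀ r ≥ i, ∀ M, τ.arr a_Y r M = 0) ∧
      ∀ u < n, τ.arr a_ans 0 u = counted n A S col m i u) n (1400 * k * 2 ^ k)
    (by decide) (by decide) (by decide) (by omega) (by simp) (by simp [h.size])
    ⟨by simp, by simp, by simp [hY], fun u hu => ?_⟩ ?_ ?_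
  · simp [counted, hans.ans]
  · rintro i hi τ hvi - hf ⟨hW1, hW2, hY1, ha⟩
    have h1 : Setup B n k A S col τ := h.frame hf rfl
    have hT1 := hf.arr a_T rfl
    have hnbp1 := hf.arr a_nbp rfl
    have hrm1 := hf.arr a_rm rfl
    have hU1 : UpTables n k A S col 0 τ := ⟨hnbp1 ▸ hU.nbp, hrm1 ▸ hU.rm, hT1 ▸ hU.up⟩
    have hR := h1.row i hi
    have hci := hcard i hi
    have g2 : 1 * 2 ^ k ≤ k * 2 ^ k := Nat.mul_le_mul_right _ (by omega)
    have g4 : 1400 * k * 2 ^ k = 1400 * (k * 2 ^ k) := by ring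
    -- The part of the body that is common to roots and other vertices, once `a_Y` holds the table
    -- `down` of `i`.
    have tail : ∀ t2 τ2, t2 ≤ 1200 * (k * 2 ^ k) + 20 → τ2.var v_i = i → Setup B n k A S col τ2 →
        τ2.arr a_nbp = σ.arr a_nbp → τ2.arr a_rm = σ.arr a_rm → τ2.arr a_W = τ.arr a_W →
        (∀ M < 2 ^ k, τ2.arr a_Y i M = Elim.down n A S col i M) →
        (∀ r ≠ i, τ2.arr a_Y r = τ.arr a_Y r) →
        (∀ u < n, τ2.arr a_ans 0 u = τ.arr a_ans 0 u +
          if Elim.Exits S u i then Elim.up n A S col i (m u i) else 0) →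
        wp B (.put a_ans 0 †v_i (.get a_ans 0 †v_i + .get a_Y †v_i (.get a_nbp †v_i (†v_P - 1))) ;;
          .forTo v_M v_MEnd †v_P
            (.put a_W †v_i †v_M (.get a_W †v_i †v_M + .get a_Y †v_i (.get a_rm †v_i †v_M))))
          (fun t' τ' => t2 + t' ≤ 1400 * k * 2 ^ k ∧
            (∀ r < i + 1, ∀ M < 2 ^ k,
              (τ'.set v_i (i + 1)).arr a_W r M = Elim.total n A S col r M) ∧
            (∀ r < n, i + 1 ≤ r → (τ'.set v_i (i + 1)).arr a_W r = σ.arr a_W r) ∧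
            (∀ r ≥ i + 1, ∀ M, (τ'.set v_i (i + 1)).arr a_Y r M = 0) ∧
            ∀ u < n, (τ'.set v_i (i + 1)).arr a_ans 0 u = counted n A S col m (i + 1) u) τ2 := by
      intro t2 τ2 ht2 w1 w2 w3 w4 w5 w6 w7 w8
      obtain ⟨g5, g6⟩ := hU.nbp i hi (Nat.zero_le _) (2 ^ k - 1) (by omega)
      have g7 := g6.eq_of_all (fun z hz => hcol z ((hE.lt i hi z hz).trans hi)) (hm i hi i hi)
      have g8 := w6 _ g5
      rw [g7] at g5 g8
      have hnew : ∀ u < n, (if u = i then τ2.arr a_ans 0 i + Elim.down n A S col i (m i i)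
          else τ2.arr a_ans 0 u) = counted n A S col m (i + 1) u := by
        intro u hu
        rw [counted_succ hi]
        by_cases hui : u = i
        · subst hui
          rw [if_pos rfl, if_pos rfl, w8 u hu, ha u hu]
          ring
        · rw [if_neg hui, if_neg hui, w8 u hu, ha u hu, add_zero]
      have hb := hle (i + 1) hi i hi
      rw [← hnew i hi, if_pos rfl] at hb
      rw [wp_seq, wp_put]
      simp only [eval_get, eval_var, eval_ofNat, eval_sub, eval_add, w1, w2.two_pow, w3, g7, g8]
      refine ⟨by simp [w1, w2.bound, w3, w2.two_pow, g7, g8]; omega, ?_⟩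
      refine wp_for (fun M τ => (∀ M' < M, τ.arr a_W i M' = Elim.total n A S col i M') ∧
          (∀ M', M ≤ M' → τ.arr a_W i M' = σ.arr a_W i M') ∧
          ∀ r ≠ i, τ.arr a_W r = τ2.arr a_W r) (2 ^ k) 80
        (by decide) (by decide) (by decide) (by omega) (by simp) (by simp [w2.two_pow])
        ⟨by simp, by simp [w5, hW2 i hi le_rfl], fun r hr => by funext y; simp⟩ ?_ ?_
      · rintro M hM τ3 hvM - hf3 ⟨i1, i2, i3⟩
        have hvB3 := hf3.var v_B rfl
        have hvi3 := hf3.var v_i rfl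
        have hrm3 : ∀ M, τ3.arr a_rm i M = σ.arr a_rm i M := by
          intro M
          rw [hf3.arr a_rm rfl]
          simp [w4]
        have hY3 := hf3.arr a_Y rfl
        simp [w1, w2.bound] at hvB3 hvi3
        have hY3' : ∀ M, τ3.arr a_Y i M = τ2.arr a_Y i M := by
          intro M
          rw [hY3]
          simp
        obtain ⟨hr1, hr2⟩ := hU.rm i hi (Nat.zero_le _) M hM
        have e1 := i2 M le_rfl
        have e2 := w6 _ hr1
        have e3 := hW i hi M hM
        have e4 := Elim.total_eq hE hproper hi hr2
        have e5 : σ.arr a_W i M + Elim.down n A S col i (σ.arr a_rm i M) =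
            Elim.total n A S col i M := by rw [e3, e4]
        have e6 : Elim.total n A S col i M ≤ n := Elim.total_le i M
        simp only [wp_put, eval_var, eval_add, eval_get, hvi3, hvM, hrm3, hY3', e1, e2, e5]
        refine ⟨by simp [hvB3, hvi3, hvM, hrm3, e1, hY3', e2]; omega, by simp, fun M' hM' => ?_,
          fun M' hM' => ?_, fun r hr => ?_⟩
        · simp
          split_ifs with h'
          · rw [h']
          · exact i1 M' (by omega)
        · have : M' ≠ M := by omega
          simpa [this] using i2 M' (by omega)
        · rw [← i3 r hr]
          funext y
          simp [hr]
      · rintro t3 τ3 ht3 ⟨i1, -, i3⟩ hf3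
        have hY3 := hf3.arr a_Y rfl
        have ha3 := hf3.arr a_ans rfl
        simp at ht3
        refine ⟨by simp; omega, fun r hr M hM => ?_, fun r hr hr' => ?_, fun r hr M => ?_,
          fun u hu => ?_⟩
        · rw [Env.set_arr]
          rcases Nat.lt_succ_iff_lt_or_eq.1 hr with hr | rfl
          · rw [i3 r (by omega), w5]
            exact hW1 r hr M hM
          · exact i1 M hM
        · rw [Env.set_arr, i3 r (by omega), w5]
          exact hW2 r hr (by omega)
        · rw [Env.set_arr, hY3]
          have := hY1 r (by omega) M
          rw [← w7 r (by omega)] at this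
          simpa using this
        · rw [Env.set_arr, ha3, ← hnew u hu]
          simp
    rw [wp_seq, wp_ite, wp_skip]
    refine ⟨by simp [h1.bound, hvi]; omega, fun hne => ?_, fun h0 => ?_⟩
    · have hne' : (S i).Nonempty := by
        rw [Finset.nonempty_iff_ne_empty]
        intro hc
        simp [hvi, hR.size, hc] at hne
      have hp : Elim.Child S i (Elim.par S i) := ⟨hne', rfl⟩
      have hpi := hp.lt hE hi
      refine (wp_descend h1 hB hk hE hproper hcol hcard hm hU1 hvi hi hp
        (hW1 _ hpi) fun u hu hex => ?_).mono ?_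
      · have := hle (i + 1) hi u hu
        rw [counted_succ hi, if_pos hex] at this
        rw [ha u hu]
        omega
      · rintro t2 τ2 ⟨ht2, j1, j2, j3⟩ hf2
        refine tail _ τ2 ?_ ((hf2.var v_i rfl).trans hvi) (h1.frame hf2 rfl)
          ((hf2.arr a_nbp rfl).trans hnbp1) ((hf2.arr a_rm rfl).trans hrm1) (hf2.arr a_W rfl)
          j1 j2 j3
        have g5 : 1200 * k * 2 ^ k = 1200 * (k * 2 ^ k) := by ring
        simp
        omega
    -- At a root, row `i` of `a_Y` has not been written, and its initial zeros are the right table.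
    · have hS : S i = ∅ := by simpa [hvi, hR.size] using h0
      refine tail _ τ ?_ hvi h1 hnbp1 hrm1 rfl ?_ (fun _ _ => rfl) ?_
      · simp
      · intro M hM
        rw [hY1 i le_rfl, Elim.down_of_eq_empty hS]
      · intro u hu
        have : ¬ Elim.Exits S u i := fun hc => by simpa [hS] using hc.1
        simp [this]
  · rintro t τ ht ⟨-, -, -, ha⟩ -
    simp at ht
    refine ⟨?_, fun u hu => ?_⟩
    · rcases Nat.eq_zero_or_pos n with rfl | hn
      · simp at ht; omega
      have hk0 : 1 ≤ k := by have := hcard 0 hn; omega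
      have g2 : 1 ≤ k * 2 ^ k := Nat.mul_pos hk0 (by positivity)
      nlinarith
    · rw [ha u hu, counted_all hE hproper hm hu]

end Loop

/-! ### The words of the input -/

namespace Loop

theorem length_pairsToWords {k : ℕ} (l : List (Fin k × Fin k)) :
    (pairsToWords l).length = 2 * l.length := by
  induction l with
  | nil => rfl
  | cons a l ih =>
    simp only [pairsToWords, List.flatMap_cons, List.length_append, List.length_cons] at ih ⊢
    rw [ih]
    simp
    omega

theorem getD_pairsToWords {k : ℕ} (l : List (Fin k × Fin k)) (e : ℕ) (he : e < l.length) :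
    (pairsToWords l).getD (2 * e) 0 = l[e].1 ∧ (pairsToWords l).getD (2 * e + 1) 0 = l[e].2 := by
  induction l generalizing e with
  | nil => simp at he
  | cons a l ih =>
    have h : pairsToWords (a :: l) = (a.1 : ℕ) :: (a.2 : ℕ) :: pairsToWords l := rfl
    rw [h]
    cases e with
    | zero => simp
    | succ e =>
      have := ih e (by simpa using he)
      rw [show 2 * (e + 1) = 2 * e + 1 + 1 by ring]
      simpa using this

theorem getD_flatMap {α : Type*} (f : α → List ℕ) (l : List α) (x : ℕ) (hx : x < l.length) (j : ℕ)
    (hj : j < (f l[x]).length) :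
    (l.flatMap f).getD (((l.take x).map fun a => (f a).length).sum + j) 0 = (f l[x]).getD j 0 := by
  induction l generalizing x with
  | nil => simp at hx
  | cons a l ih =>
    rw [List.flatMap_cons]
    cases x with
    | zero =>
      simp only [List.take_zero, List.map_nil, List.sum_nil, zero_add, List.getElem_cons_zero]
      exact List.getD_append _ _ _ _ hj
    | succ x =>
      simp only [List.take_succ_cons, List.map_cons, List.sum_cons, List.getElem_cons_succ]
      rw [List.getD_append_right _ _ _ _ (by omega), ← ih x (by simpa using hx) hj]
      congr 1
      omega

variable {n N : ℕ} (es : List (Fin n × Fin n)) (ts : List (Fin N × Fin N))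
  (bs : Fin N → List (Fin n))

theorem inputWords_eq : inputWords es ts bs =
    [n, N, es.length] ++ pairsToWords es ++ pairsToWords ts ++
      (List.ofFn bs).flatMap fun l => l.length :: l.map Fin.val := by
  -- The coercion in the definition of the input acts on the whole list as a monadic bind; it agrees
  -- with mapping the coercion over the entries.
  have h : ∀ l : List (Fin n), (do let a ← l; pure a.val) = l.map Fin.val := by
    intro l
    induction l with
    | nil => rfl
    | cons a l ih => simpa using ih
  simp only [inputWords, h, List.map_id']

/-- The list that encodes bag `x`. -/
def bagList (x : ℕ) : List (Fin n) := if h : x < N then bs ⟨x, h⟩ else []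

/-- The position of bag `x` in the input. -/
def bagPos (x : ℕ) : ℕ := 3 + 2 * es.length + 2 * ts.length +
  ∑ y ∈ Finset.range x, ((bagList bs y).length + 1)

/-- The entry `j` of bag `x`. -/
def bagEntry (x j : ℕ) : ℕ := ((bagList bs x).map Fin.val).getD j 0

theorem bagPos_succ (x : ℕ) :
    bagPos es ts bs (x + 1) = bagPos es ts bs x + (bagList bs x).length + 1 := by
  rw [bagPos, bagPos, Finset.sum_range_succ]
  ring

theorem bagPos_mono {x y : ℕ} (h : x ≤ y) : bagPos es ts bs x ≤ bagPos es ts bs y := by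
  rw [bagPos, bagPos]
  exact Nat.add_le_add_left (Finset.sum_le_sum_of_subset (by simpa using h)) _

theorem sum_take {x : ℕ} (hx : x ≤ N) : (((List.ofFn bs).take x).map fun l =>
    (l.length :: l.map Fin.val).length).sum =
      ∑ y ∈ Finset.range x, ((bagList bs y).length + 1) := by
  induction x with
  | zero => simp
  | succ x ih =>
    rw [Finset.sum_range_succ, ← ih (by omega), List.take_add_one]
    have : (List.ofFn bs)[x]? = some (bs ⟨x, by omega⟩) := by simp [show x < N by omega]
    rw [this]
    simp [bagList, show x < N by omega]

theorem length_inputWords : (inputWords es ts bs).length = bagPos es ts bs N := by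
  have h := sum_take bs le_rfl
  rw [List.take_of_length_le (by simp)] at h
  simp only [inputWords_eq, List.length_append, length_pairsToWords, List.length_flatMap, h, bagPos]
  simp

theorem getD_inputWords_edge {e : ℕ} (he : e < es.length) :
    (inputWords es ts bs).getD (3 + 2 * e) 0 = es[e].1 ∧
      (inputWords es ts bs).getD (3 + 2 * e + 1) 0 = es[e].2 := by
  have h := length_pairsToWords es
  have h' := getD_pairsToWords es e he
  rw [inputWords_eq]
  constructor
  · rw [List.getD_append _ _ _ _ (by simp; omega), List.getD_append _ _ _ _ (by simp; omega),
      List.getD_append_right _ _ _ _ (by simp), ← h'.1]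
    congr 1
    simp
  · rw [List.getD_append _ _ _ _ (by simp; omega), List.getD_append _ _ _ _ (by simp; omega),
      List.getD_append_right _ _ _ _ (by simp; omega), ← h'.2]
    congr 1
    simp
    omega

theorem getD_inputWords_treeEdge {e : ℕ} (he : e < ts.length) :
    (inputWords es ts bs).getD (3 + 2 * es.length + 2 * e) 0 = ts[e].1 ∧
      (inputWords es ts bs).getD (4 + 2 * es.length + 2 * e) 0 = ts[e].2 := by
  have h := length_pairsToWords es
  have h1 := length_pairsToWords ts
  have h' := getD_pairsToWords ts e he
  rw [inputWords_eq]
  constructor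
  · rw [List.getD_append _ _ _ _ (by simp; omega),
      List.getD_append_right _ _ _ _ (by simp; omega), ← h'.1]
    congr 1
    simp
    omega
  · rw [List.getD_append _ _ _ _ (by simp; omega),
      List.getD_append_right _ _ _ _ (by simp; omega), ← h'.2]
    congr 1
    simp
    omega

theorem getD_inputWords_bag {x j : ℕ} (hx : x < N) (hj : j < (bagList bs x).length + 1) :
    (inputWords es ts bs).getD (bagPos es ts bs x + j) 0 =
      ((bagList bs x).length :: (bagList bs x).map Fin.val).getD j 0 := by
  have h := length_pairsToWords es
  have h1 := length_pairsToWords ts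
  have hget : (List.ofFn bs)[x]'(by simpa using hx) = bagList bs x := by simp [bagList, hx]
  have h2 := getD_flatMap (fun l : List (Fin n) => l.length :: l.map Fin.val) (List.ofFn bs)
    x (by simpa using hx) j (by rw [hget]; simpa using hj)
  rw [hget, sum_take bs hx.le] at h2
  rw [inputWords_eq, List.getD_append_right _ _ _ _ (by simp [bagPos]; omega), ← h2]
  congr 1
  simp [bagPos]
  omega

theorem getD_inputWords_bagSize {x : ℕ} (hx : x < N) :
    (inputWords es ts bs).getD (bagPos es ts bs x) 0 = (bagList bs x).length := by
  simpa using getD_inputWords_bag es ts bs hx (Nat.succ_pos _)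

theorem getD_inputWords_bagEntry {x j : ℕ} (hx : x < N) (hj : j < (bagList bs x).length) :
    (inputWords es ts bs).getD (bagPos es ts bs x + 1 + j) 0 = bagEntry bs x j := by
  have := getD_inputWords_bag es ts bs hx (j := j + 1) (by omega)
  rw [add_assoc, add_comm 1 j, this]
  simp [bagEntry]

theorem bagEntry_eq {x j : ℕ} (hj : j < (bagList bs x).length) :
    bagEntry bs x j = (bagList bs x)[j] := by
  rw [bagEntry, List.getD_eq_getElem _ _ (by simpa using hj), List.getElem_map]

variable {es ts bs} {β : Fin N → Finset (Fin n)}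

theorem exists_bagEntry (hb : ListsBags β bs) (x : Fin N) (v : Fin n) :
    (∃ j < (bagList bs x).length, bagEntry bs x j = v) ↔ v ∈ β x := by
  have hx : bagList bs x = bs x := by simp [bagList]
  rw [← (hb x).2, List.mem_iff_getElem]
  constructor
  · rintro ⟨j, hj, h⟩
    rw [bagEntry_eq bs hj] at h
    exact ⟨j, hx ▸ hj, by simpa [hx] using Fin.val_injective h⟩
  · rintro ⟨j, hj, rfl⟩
    have hj' : j < (bagList bs x).length := by rw [hx]; exact hj
    exact ⟨j, hj', by rw [bagEntry_eq bs hj']; simp [hx]⟩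

theorem length_bagList (hb : ListsBags β bs) (x : Fin N) : (bagList bs x).length = (β x).card := by
  classical
  have hx : bagList bs x = bs x := by simp [bagList]
  rw [hx, ← List.toFinset_card_of_nodup (hb x).1]
  congr 1
  ext v
  simp [(hb x).2]

theorem bagEntry_inj (hb : ListsBags β bs) {x l j : ℕ} (hx : x < N)
    (hl : l < (bagList bs x).length) (hj : j < (bagList bs x).length)
    (h : bagEntry bs x l = bagEntry bs x j) : l = j := by
  rw [bagEntry_eq bs hl, bagEntry_eq bs hj] at h
  have hd : (bagList bs x).Nodup := by simpa [bagList, hx] using (hb ⟨x, hx⟩).1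
  exact hd.getElem_inj_iff.1 (Fin.val_injective h)

theorem sum_bagList (hb : ListsBags β bs) :
    ∑ x ∈ Finset.range N, ((bagList bs x).length + 1) = decompSize β := by
  rw [decompSize, Finset.sum_range]
  exact Finset.sum_congr rfl fun x _ => by rw [length_bagList hb, add_comm]

theorem sup_bagList_le (hb : ListsBags β bs) :
    (Finset.range N).sup (fun x => (bagList bs x).length) ≤ decompWidth β + 1 := by
  refine Finset.sup_le fun x hx => ?_
  have hx := Finset.mem_range.1 hx
  have h := length_bagList hb ⟨x, hx⟩
  have : (β ⟨x, hx⟩).card - 1 ≤ decompWidth β :=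
    Finset.le_sup (f := fun x => (β x).card - 1) (Finset.mem_univ _)
  simp only at h
  omega

/-- Every vertex lies in a bag. Hence time linear in `n` is paid for by the size of the
decomposition, and the numbers of vertices are smaller than the length of the input. -/
theorem le_sum_bagList (hb : ListsBags β bs) (hD : ∀ v : Fin n, ∃ x, v ∈ β x) :
    n ≤ ∑ x ∈ Finset.range N, (bagList bs x).length := by
  classical
  calc n = (Finset.univ : Finset (Fin n)).card := by simp
    _ ≤ (Finset.univ.biUnion β).card := by
        refine Finset.card_le_card fun v _ => ?_
        simpa using hD v
    _ ≤ ∑ x, (β x).card := Finset.card_biUnion_le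
    _ = _ := by
        rw [Finset.sum_range]
        exact Finset.sum_congr rfl fun x _ => (length_bagList hb x).symm

/-- All words of the input are smaller than its length. -/
theorem getD_inputWords_lt (hb : ListsBags β bs) (hD : ∀ v : Fin n, ∃ x, v ∈ β x) (i : ℕ) :
    (inputWords es ts bs).getD i 0 < (inputWords es ts bs).length := by
  have hn := le_sum_bagList hb hD
  have hL : (inputWords es ts bs).length = 3 + 2 * es.length + 2 * ts.length +
      (∑ x ∈ Finset.range N, (bagList bs x).length + N) := by
    rw [length_inputWords, bagPos, Finset.sum_add_distrib]
    simp
  rw [List.getD_eq_getElem?_getD]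
  rcases lt_or_ge i (inputWords es ts bs).length with hi | hi
  swap
  · simp [List.getElem?_eq_none hi]
    omega
  rw [List.getElem?_eq_getElem hi, Option.getD_some]
  have hmem := List.getElem_mem hi
  generalize (inputWords es ts bs)[i] = v at hmem
  rw [hL]
  simp only [inputWords_eq, List.mem_append, List.mem_cons, List.not_mem_nil, or_false, pairsToWords,
    List.mem_flatMap, List.mem_map, List.mem_ofFn] at hmem
  rcases hmem with (((rfl | rfl | rfl) | ⟨e, -, rfl | rfl⟩) | ⟨e, -, rfl | rfl⟩) |
    ⟨l, ⟨x, rfl⟩, rfl | ⟨u, -, rfl⟩⟩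
  · omega
  · omega
  · omega
  · omega
  · omega
  · omega
  · omega
  · have h1 := Finset.single_le_sum (f := fun x => (bagList bs x).length) (fun _ _ => Nat.zero_le _)
      (Finset.mem_range.2 x.2)
    have hx : bagList bs x = bs x := by simp [bagList]
    simp only [hx] at h1
    omega
  · have := u.2
    omega

end Loop

/-! ### The ordering of the vertices is a ranking -/

namespace Loop

section
variable {k : ℕ} (f : Fin k → ℕ) (l : List (Fin k × Fin k))

/-- The image of the first end of edge `e`. -/
def fstAt (e : ℕ) : ℕ := if h : e < l.length then f l[e].1 else 0

/-- The image of the second end of edge `e`. -/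
def sndAt (e : ℕ) : ℕ := if h : e < l.length then f l[e].2 else 0

variable {f l}

theorem joined_iff {G : SimpleGraph (Fin k)} (hl : ListsEdges G l) {a b : ℕ} :
    Joined l.length (fstAt f l) (sndAt f l) a b ↔ ∃ u v, G.Adj u v ∧ f u = a ∧ f v = b := by
  constructor
  · rintro ⟨e, he, h⟩
    have hadj : G.Adj l[e].1 l[e].2 :=
      (hl.2 s(l[e].1, l[e].2)).2 (List.mem_map.2 ⟨l[e], List.getElem_mem he, rfl⟩)
    simp only [fstAt, sndAt, he, dif_pos] at h
    rcases h with ⟨rfl, rfl⟩ | ⟨rfl, rfl⟩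
    · exact ⟨_, _, hadj, rfl, rfl⟩
    · exact ⟨_, _, hadj.symm, rfl, rfl⟩
  · rintro ⟨u, v, h, rfl, rfl⟩
    obtain ⟨p, hp, hs⟩ := List.mem_map.1 ((hl.2 s(u, v)).1 h)
    obtain ⟨e, he, rfl⟩ := List.mem_iff_getElem.1 hp
    refine ⟨e, he, ?_⟩
    simp only [fstAt, sndAt, he, dif_pos]
    rcases Sym2.eq_iff.1 hs with ⟨h1, h2⟩ | ⟨h1, h2⟩
    · exact .inl ⟨by rw [h1], by rw [h2]⟩
    · exact .inr ⟨by rw [h2], by rw [h1]⟩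

end

/-- The number of tree edges is not part of the input; the position of the first bag depends on this
value. -/
theorem length_treeEdges {N : ℕ} {T : SimpleGraph (Fin N)} {ts : List (Fin N × Fin N)}
    (hT : T.IsTree) (hl : ListsEdges T ts) : ts.length = N - 1 := by
  classical
  have h := hT.card_edgeFinset
  have h2 : T.edgeFinset = (ts.map fun e => s(e.1, e.2)).toFinset := by
    ext e
    rw [SimpleGraph.mem_edgeFinset, List.mem_toFinset]
    exact hl.2 e
  rw [h2, List.toFinset_card_of_nodup hl.1, List.length_map, Fintype.card_fin] at h
  omega

theorem mem_of_closed {N : ℕ} {T : SimpleGraph (Fin N)} (hT : T.IsTree) {D : Set ℕ} (h0 : 0 ∈ D)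
    (h : ∀ x y : Fin N, T.Adj x y → (x : ℕ) ∈ D → (y : ℕ) ∈ D) {x : ℕ} (hx : x < N) : x ∈ D := by
  obtain ⟨w⟩ := hT.connected.preconnected ⟨0, by omega⟩ ⟨x, hx⟩
  have key : ∀ {a b : Fin N}, T.Walk a b → (a : ℕ) ∈ D → (b : ℕ) ∈ D := by
    intro a b w
    induction w with
    | nil => exact id
    | cons hadj _ ih => exact fun ha => ih (h _ _ hadj ha)
  exact key w h0

/-- The earlier elements of the first bag of the vertex of rank `i`. -/
def rowSet (σ : Env) (i : ℕ) : Finset ℕ := (Finset.range (σ.arr a_size 0 i)).image (σ.arr a_S i)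

theorem Row.eq_rowSet {X : Finset ℕ} {r : ℕ} {σ : Env} (h : Row X r σ) : rowSet σ r = X := by
  rw [rowSet, h.size, h.image]

/-- Here `pos` inverts the order of the queue, and `top v` is the node whose bag was current when
`v` received its rank. The traversal supplies the earlier neighbour of each node. -/
theorem exists_isRanking {n N : ℕ} {G : SimpleGraph (Fin n)} {T : SimpleGraph (Fin N)}
    {β : Fin N → Finset (Fin n)} {bs : Fin N → List (Fin n)} {R : ℕ → ℕ → Prop} {q : ℕ → ℕ}
    {σ : Env} (hD : IsTreeDecomposition G T β) (hb : ListsBags β bs)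
    (hR : ∀ a b, R a b → ∃ x y : Fin N, T.Adj x y ∧ (x : ℕ) = a ∧ (y : ℕ) = b)
    (hq : IsTraversal N R q N)
    (ho : Ordered n q (fun x => (bagList bs x).length) (bagEntry bs) N
      (fun v => ∃ i < N, ∃ j < (bagList bs (q i)).length, bagEntry bs (q i) j = v) σ) :
    ∃ (pos : Fin N → ℕ) (top : Fin n → Fin N),
      Elim.IsRanking β pos (fun v => σ.arr a_rank 0 v - 1) top (rowSet σ) ∧
      Function.Injective pos ∧ (∀ x, pos x ≠ 0 → ∃ y, T.Adj x y ∧ pos y < pos x) ∧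
      (∀ v : Fin n, σ.arr a_rank 0 v ≠ 0) ∧ (∀ i < n, Row (rowSet σ i) i σ) ∧
      ∀ i < n, (rowSet σ i).card < (Finset.range N).sup fun x => (bagList bs x).length := by
  classical
  have hpos : ∀ x : Fin N, ∃ i < N, q i = x := by
    intro x
    have := image_range_eq hq.lt hq.inj ▸ Finset.mem_range.2 x.2
    obtain ⟨i, hi, h⟩ := Finset.mem_image.1 this
    exact ⟨i, Finset.mem_range.1 hi, h⟩
  choose pos hpos1 hpos2 using hpos
  have hposq : ∀ i (hi : i < N), pos ⟨q i, hq.lt i hi⟩ = i := fun i hi =>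
    hq.inj _ (hpos1 _) _ hi (hpos2 _)
  have hne : ∀ v : Fin n, σ.arr a_rank 0 v ≠ 0 := by
    intro v
    obtain ⟨x, hx⟩ := hD.exists_mem_bag v
    refine (ho.dom v).2 ⟨pos x, hpos1 x, ?_⟩
    rw [hpos2]
    exact (exists_bagEntry hb x v).2 hx
  have htop : ∀ v : Fin n, ∃ x : Fin N, TopAt q (fun x => (bagList bs x).length) (bagEntry bs)
      (pos x) v ∧ Row ((rankSet (σ.arr a_rank 0) (bagEntry bs x) (bagList bs x).length).filter
        (· < σ.arr a_rank 0 v - 1)) (σ.arr a_rank 0 v - 1) σ := by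
    intro v
    obtain ⟨a, -, h1, h2⟩ := ho.row v (hne v)
    obtain ⟨i, hi, j, hj, h⟩ := (ho.dom v).1 (hne v)
    -- `Ordered` only gives `a ≤ N`. An occurrence of `v` at a position below `N` makes the
    -- inequality strict, since no occurrence precedes the first bag.
    have hai : a ≤ i := by
      by_contra hlt
      exact h1.2 i (by omega) j hj h
    have ha : a < N := by omega
    exact ⟨⟨q a, hq.lt a ha⟩, by rwa [hposq a ha], h2⟩
  choose top htop1 htop2 using htop
  have hrow : ∀ v : Fin n, rowSet σ (σ.arr a_rank 0 v - 1) =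
      (rankSet (σ.arr a_rank 0) (bagEntry bs (top v)) (bagList bs (top v)).length).filter
        (· < σ.arr a_rank 0 v - 1) := fun v => (htop2 v).eq_rowSet
  have hle : σ.var v_r ≤ n := by
    rw [← ho.card]
    simpa using Finset.card_filter_le (Finset.range n) fun v => σ.arr a_rank 0 v ≠ 0
  have hrank : Elim.IsRanking β pos (fun v => σ.arr a_rank 0 v - 1) top (rowSet σ) := by
    refine ⟨fun u v h => ?_, fun v => ?_, fun v => ?_, fun v x hx => ?_, fun u v h => ?_,
      fun v j => ?_⟩
    · have h1 := hne u
      have h2 := hne v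
      exact Fin.val_injective (ho.inj u v h1 (by omega))
    · have h1 := hne v
      have h2 := ho.le v
      omega
    · obtain ⟨j, hj, h⟩ := (htop1 v).1
      rw [hpos2] at hj h
      exact (exists_bagEntry hb _ v).1 ⟨j, hj, h⟩
    · by_contra hlt
      obtain ⟨j, hj, h⟩ := (exists_bagEntry hb x v).2 hx
      refine (htop1 v).2 (pos x) (by omega) j ?_ ?_
      · rw [hpos2]; exact hj
      · rw [hpos2]; exact h
    · have h1 := hne u
      have h2 := hne v
      exact ho.mono u v _ _ h1 (by omega) (htop1 u) (htop1 v)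
    · rw [hrow, Finset.mem_filter, mem_rankSet]
      constructor
      · rintro ⟨⟨j', hj', h1⟩, h2⟩
        have hlt : bagEntry bs (top v) j' < n := by
          rw [bagEntry_eq bs hj']
          exact Fin.isLt _
        refine ⟨⟨_, hlt⟩, (exists_bagEntry hb _ _).1 ⟨j', hj', rfl⟩, ?_, h2⟩
        simp [h1]
      · rintro ⟨u, hu, rfl, h2⟩
        obtain ⟨j', hj', h1⟩ := (exists_bagEntry hb _ u).2 hu
        refine ⟨⟨j', hj', ?_⟩, h2⟩
        have := hne u
        rw [h1]
        omega
  refine ⟨pos, top, hrank, fun x y h => ?_, fun x hx => ?_, hne, fun i hi => ?_, fun i hi => ?_⟩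
  · exact Fin.val_injective (by rw [← hpos2 x, ← hpos2 y, h])
  · obtain ⟨i, hi, h⟩ := hq.pred _ (hpos1 x) hx
    obtain ⟨y, z, hadj, h1, h2⟩ := hR _ _ h
    rw [hpos2] at h1
    obtain rfl := Fin.val_injective h1
    refine ⟨z, hadj, ?_⟩
    have : pos z = i := hq.inj _ (hpos1 z) _ (hi.trans (hpos1 y)) (by rw [hpos2, h2])
    omega
  · obtain ⟨v, rfl⟩ := hrank.surj hi
    have := htop2 v
    rwa [hrow v]
  · obtain ⟨v, rfl⟩ := hrank.surj hi
    -- The vertex itself belongs to its first bag but not to its row, so rows are strictly smaller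
    -- than the largest bag.
    have hsub : insert (σ.arr a_rank 0 v - 1) (rowSet σ (σ.arr a_rank 0 v - 1)) ⊆
        (β (top v)).image fun u : Fin n => σ.arr a_rank 0 u - 1 := by
      intro j hj
      rcases Finset.mem_insert.1 hj with rfl | hj
      · exact Finset.mem_image.2 ⟨v, hrank.mem_top v, rfl⟩
      · obtain ⟨u, hu, h, -⟩ := (hrank.mem_iff v j).1 hj
        exact Finset.mem_image.2 ⟨u, hu, h⟩
    have h1 := (Finset.card_le_card hsub).trans Finset.card_image_le
    rw [Finset.card_insert_of_notMem, ← length_bagList hb (top v)] at h1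
    · have h2 := Finset.le_sup (f := fun x => (bagList bs x).length) (Finset.mem_range.2 (top v).2)
      omega
    · intro hmem
      obtain ⟨u, -, h, h2⟩ := (hrank.mem_iff v _).1 hmem
      exact lt_irrefl _ h2

end Loop

/-! ### Preparation of the tables -/

namespace Loop

/-- Reads the input, orders the vertices, and prepares the tables. -/
def prepare : Cmd := scan ;; starts ;; treeLists ;; bfs ;; order ;; adjacency ;; powers

/-- The tables that describe the graph, with the vertices renumbered by `rk`. -/
structure Prepared {n N : ℕ} (G : SimpleGraph (Fin n)) (T : SimpleGraph (Fin N))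
    (β : Fin N → Finset (Fin n)) (m B k : ℕ) (rk : Fin n → ℕ) (S : ℕ → Finset ℕ) (τ : Env) :
    Prop where
  ranking : ∃ pos top, Elim.IsRanking β pos rk top S ∧ Function.Injective pos ∧
    ∀ x, pos x ≠ 0 → ∃ y, T.Adj x y ∧ pos y < pos x
  bound : τ.var v_B = B
  size : τ.var v_n = n
  edges : τ.var v_m = m
  width : τ.var v_k = k
  rank : ∀ v : Fin n, τ.arr a_rank 0 v = rk v + 1
  row : ∀ i < n, Row (S i) i τ
  card : ∀ i < n, (S i).card < k
  adj : ∀ a < n, ∀ b < n, τ.arr a_adj a b ≠ 0 ↔ Elim.rankAdj G rk a b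
  pow : τ.var v_big = 0 ∧ τ.var v_P = 2 ^ k ∧ 2 ^ k ≤ 2 * n ∧ (∀ c < k, τ.arr a_pow 0 c = 2 ^ c) ∨
    τ.var v_big ≠ 0 ∧ n < 2 ^ (k - 1)

variable {n N : ℕ} {G : SimpleGraph (Fin n)} {T : SimpleGraph (Fin N)}
  {β : Fin N → Finset (Fin n)} {es : List (Fin n × Fin n)} {ts : List (Fin N × Fin N)}
  {bs : Fin N → List (Fin n)}

theorem rankAdj_iff {rk : Fin n → ℕ} (hes : ListsEdges G es) (hlt : ∀ v, rk v < n)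
    (hsurj : ∀ i < n, ∃ v, rk v = i) {a b : ℕ} : Elim.rankAdj G rk a b ↔
      a < n ∧ b < n ∧ (a = b ∨ Joined es.length (fstAt rk es) (sndAt rk es) a b) := by
  rw [joined_iff hes]
  constructor
  · rintro ⟨u, v, rfl, rfl, rfl | h⟩
    · exact ⟨hlt u, hlt u, .inl rfl⟩
    · exact ⟨hlt u, hlt v, .inr ⟨u, v, h, rfl, rfl⟩⟩
  · rintro ⟨ha, hb, rfl | ⟨u, v, h, rfl, rfl⟩⟩
    · obtain ⟨v, rfl⟩ := hsurj a ha
      exact ⟨v, v, rfl, rfl, .inl rfl⟩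
    · exact ⟨u, v, rfl, rfl, .inr h⟩

theorem edgeList_of_cell {rk : Fin n → ℕ} {σ : Env} (hlt : ∀ v, rk v < n)
    (hcell : ∀ i, σ.cell i = (inputWords es ts bs).getD i 0)
    (hrank : ∀ v : Fin n, σ.arr a_rank 0 v = rk v + 1) :
    EdgeList n es.length (fstAt rk es) (sndAt rk es) σ := by
  refine ⟨fun e he => ?_, fun e he => ?_, fun e he => ?_, fun e he => ?_⟩
  · simp [fstAt, sndAt, he, hlt]
  · rw [hcell, hcell, (getD_inputWords_edge es ts bs he).1, (getD_inputWords_edge es ts bs he).2]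
    exact ⟨Fin.isLt _, Fin.isLt _⟩
  · rw [hcell, (getD_inputWords_edge es ts bs he).1, hrank]
    simp [fstAt, he]
  · rw [hcell, (getD_inputWords_edge es ts bs he).2, hrank]
    simp [sndAt, he]

-- All stages are linear in the sizes they read, except for the ordering of the vertices, which
-- accounts for `k * n`.
set_option maxHeartbeats 800000 in
theorem wp_prepare {B k : ℕ} {σ : Env} (hD : IsTreeDecomposition G T β) (hes : ListsEdges G es)
    (hts : ListsEdges T ts) (hb : ListsBags β bs)
    (hcell : ∀ i, σ.cell i = (inputWords es ts bs).getD i 0)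
    (hB : B = 64 * (inputWords es ts bs).length) (hn0 : 0 < n) (hvn : σ.var v_n = n)
    (harr : ∀ j a b, σ.arr j a b = 0)
    (hk : k = (Finset.range N).sup fun x => (bagList bs x).length) :
    wp B prepare (fun t τ => t ≤ 3000 * (decompSize β + k * n + es.length) ∧
      ∃ rk S, Prepared G T β es.length B k rk S τ) σ := by
  obtain ⟨x0, hx0⟩ := hD.exists_mem_bag ⟨0, hn0⟩
  have hN0 : 0 < N := x0.pos
  have htl := length_treeEdges hD.isTree hts
  have hL := length_inputWords es ts bs
  have hnle := le_sum_bagList hb hD.exists_mem_bag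
  have hs := sum_bagList hb
  have hs' : ∑ x ∈ Finset.range N, ((bagList bs x).length + 1) =
      ∑ x ∈ Finset.range N, (bagList bs x).length + N := by
    rw [Finset.sum_add_distrib]
    simp
  have hLN : bagPos es ts bs N = 3 + 2 * es.length + 2 * (N - 1) + decompSize β := by
    rw [bagPos, hs, htl]
  have hpos0 : bagPos es ts bs 0 = 3 + 2 * es.length + 2 * (N - 1) := by
    simp [bagPos, htl]
  have hmono : ∀ x ≤ N, bagPos es ts bs x ≤ bagPos es ts bs N := fun x hx => bagPos_mono es ts bs hx
  have hsucc : ∀ x < N, bagPos es ts bs (x + 1) =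
      bagPos es ts bs x + (bagList bs x).length + 1 := fun x _ => bagPos_succ es ts bs x
  rw [hL] at hB
  -- From here on the positions of the bags enter only through the equations above, which keeps the
  -- arithmetic linear.
  generalize hoff : bagPos es ts bs = off at *
  have hlen : ∀ x < N, off x + (bagList bs x).length + 1 ≤ off N := fun x hx => by
    rw [← hsucc x hx]
    exact hmono _ hx
  have hk0 : 0 < k := by
    have h1 := Finset.le_sup (f := fun x => (bagList bs x).length) (Finset.mem_range.2 x0.2)
    have h2 := length_bagList hb x0
    have h3 := Finset.card_pos.2 ⟨_, hx0⟩
    simp only [← hk] at h1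
    omega
  have hkL : k ≤ off N := by
    rw [hk]
    refine Finset.sup_le fun x hx => ?_
    have := hlen x (Finset.mem_range.1 hx)
    omega
  have hsize : ∀ x < N, σ.cell (off x) = (bagList bs x).length := by
    intro x hx
    rw [hcell, ← hoff, getD_inputWords_bagSize es ts bs hx]
  simp only [prepare, wp_seq]
  refine (wp_scan (B := B) (N := N) (m := es.length) (off := off)
    (len := fun x => (bagList bs x).length) (by rw [hcell]; rfl) (by rw [hcell]; rfl)
    (by omega) hsucc hsize hB hmono).mono ?_
  rintro t1 τ1 ⟨ht1, hN1, hm1, hbags1, hk1, hvB1⟩ hf1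
  have hc1 := hf1.cell rfl
  rw [← hk] at hk1
  refine (wp_starts (B := B) (N := N) (off := off) (len := fun x => (bagList bs x).length) hN1
    hbags1 hsucc (by rwa [hc1]) (by omega) hvB1 hmono (by omega)).mono ?_
  rintro t2 τ2 ⟨ht2, hst2⟩ hf2
  have hc2 := (hf2.cell rfl).trans hc1
  have hvB2 := (hf2.var v_B rfl).trans hvB1
  have hN2 := (hf2.var v_N rfl).trans hN1
  have hm2 := (hf2.var v_m rfl).trans hm1
  refine (wp_treeLists (xe := fstAt Fin.val ts) (ye := sndAt Fin.val ts) hN2 hm2 hvB2 (by omega)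
    (fun e he => ?_) fun a => ?_).mono ?_
  · have he' : e < ts.length := by omega
    have h1 := getD_inputWords_treeEdge es ts bs he'
    rw [hc2, hcell, hcell, h1.1, h1.2]
    simp [fstAt, sndAt, he']
  · rw [hf2.arr _ rfl, hf1.arr _ rfl, harr]
  rintro t3 τ3 ⟨ht3, hnb3⟩ hf3
  have hvB3 := (hf3.var v_B rfl).trans hvB2
  have hN3 := (hf3.var v_N rfl).trans hN2
  have hR : ∀ a b, (∃ e < N - 1, a = fstAt Fin.val ts e ∧ b = sndAt Fin.val ts e ∨
      a = sndAt Fin.val ts e ∧ b = fstAt Fin.val ts e) ↔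
      ∃ x y : Fin N, T.Adj x y ∧ (x : ℕ) = a ∧ (y : ℕ) = b := by
    intro a b
    rw [← htl]
    exact joined_iff hts
  refine (wp_bfs hN3 hvB3 (by omega) hN0 hnb3 (fun a b h => ?_) (fun D h0 hcl x hx => ?_)
    fun x => ?_).mono ?_
  · obtain ⟨x, y, hadj, rfl, rfl⟩ := (hR a b).1 h
    exact ⟨x.2, y.2, (hR _ _).2 ⟨y, x, hadj.symm, rfl, rfl⟩⟩
  · exact mem_of_closed hD.isTree h0 (fun x y hadj hx => hcl _ hx _
      ((hR _ _).2 ⟨x, y, hadj, rfl, rfl⟩)) hx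
  · rw [hf3.arr _ rfl, hf2.arr _ rfl, hf1.arr _ rfl, harr]
  rintro t4 τ4 ⟨ht4, hq4⟩ hf4
  have hc4 : τ4.cell = σ.cell := (hf4.cell rfl).trans ((hf3.cell rfl).trans hc2)
  have hvB4 := (hf4.var v_B rfl).trans hvB3
  have hN4 := (hf4.var v_N rfl).trans hN3
  have hst4 : τ4.arr a_start = τ2.arr a_start := (hf4.arr _ rfl).trans (hf3.arr _ rfl)
  generalize hq : τ4.arr a_queue 0 = q at hq4
  refine (wp_order (K := k) (len := fun x => (bagList bs x).length) (el := bagEntry bs) (q := q)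
    (off := off) (n := n) hvB4 hN4 hq4.lt (fun i _ => by rw [hq]) hq4.inj (by rwa [hst4])
    (by rwa [hc4]) (fun x hx j hj => ⟨?_, ?_⟩) (fun x hx l hl j hj => bagEntry_inj hb hx hl hj)
    (fun x hx => ?_) (fun x hx => ?_) hN0 (fun v => ?_) fun r u => ?_).mono ?_
  · rw [hc4, hcell, ← hoff, getD_inputWords_bagEntry es ts bs hx hj]
  · rw [bagEntry_eq bs hj]
    exact Fin.isLt _
  · have := hlen x hx
    omega
  · rw [hk]
    exact Finset.le_sup (f := fun x => (bagList bs x).length) (Finset.mem_range.2 hx)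
  · rw [hf4.arr _ rfl, hf3.arr _ rfl, hf2.arr _ rfl, hf1.arr _ rfl, harr]
  · rw [hf4.arr _ rfl, hf3.arr _ rfl, hf2.arr _ rfl, hf1.arr _ rfl, harr]
  rintro t5 τ5 ⟨ht5, ho⟩ hf5
  obtain ⟨pos, top, hr, hpinj, hpar, hne, hrow, hcard⟩ :=
    exists_isRanking hD hb (fun a b h => (hR a b).1 h) hq4 ho
  have hrank : ∀ v : Fin n, τ5.arr a_rank 0 v = (τ5.arr a_rank 0 v - 1) + 1 := fun v => by
    have := hne v
    omega
  have hc5 : τ5.cell = σ.cell := (hf5.cell rfl).trans hc4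
  have hvB5 := (hf5.var v_B rfl).trans hvB4
  have hn5 : τ5.var v_n = n := by
    rw [hf5.var _ rfl, hf4.var _ rfl, hf3.var _ rfl, hf2.var _ rfl, hf1.var _ rfl, hvn]
  have hm5 : τ5.var v_m = es.length := by
    rw [hf5.var _ rfl, hf4.var _ rfl, hf3.var _ rfl, hm2]
  have hk5 : τ5.var v_k = k := by
    rw [hf5.var _ rfl, hf4.var _ rfl, hf3.var _ rfl, hf2.var _ rfl, hk1]
  have hE5 := edgeList_of_cell (es := es) (ts := ts) (bs := bs) (σ := τ5) hr.lt
    (fun i => by rw [hc5, hcell]) hrank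
  refine (wp_adjacency hvB5 hn5 hm5 (by omega) hE5 fun a b => ?_).mono ?_
  · rw [hf5.arr _ rfl, hf4.arr _ rfl, hf3.arr _ rfl, hf2.arr _ rfl, hf1.arr _ rfl, harr]
  rintro t6 τ6 ⟨ht6, had6⟩ hf6
  have hvB6 := (hf6.var v_B rfl).trans hvB5
  have hn6 := (hf6.var v_n rfl).trans hn5
  have hk6 := (hf6.var v_k rfl).trans hk5
  refine (wp_powers hvB6 hn6 hk6 (by omega) hn0).mono ?_
  rintro t7 τ7 ⟨ht7, hp7⟩ hf7
  have hrk7 : τ7.arr a_rank = τ5.arr a_rank := (hf7.arr _ rfl).trans (hf6.arr _ rfl)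
  refine ⟨?_, fun v => τ5.arr a_rank 0 v - 1, rowSet τ5, ⟨pos, top, hr, hpinj, hpar⟩,
    (hf7.var v_B rfl).trans hvB6, (hf7.var v_n rfl).trans hn6,
    (hf7.var v_m rfl).trans ((hf6.var v_m rfl).trans hm5), (hf7.var v_k rfl).trans hk6,
    fun v => by rw [hrk7]; exact hrank v, fun i hi => (hrow i hi).congr ?_ ?_ ?_ ?_,
    fun i hi => (hcard i hi).trans_eq hk.symm, fun a ha b hb => ?_, hp7⟩
  · have h1 : 1 * n ≤ k * n := Nat.mul_le_mul_right _ hk0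
    have h2 : k * 1 ≤ k * n := Nat.mul_le_mul_left _ hn0
    have h3 : 100 * (k + 3) * n = 100 * (k * n) + 300 * n := by ring
    omega
  · rw [hf7.arr _ rfl, hf6.arr _ rfl]
  · rw [hf7.arr _ rfl, hf6.arr _ rfl]
  · rw [hf7.arr _ rfl, hf6.arr _ rfl]
  · rw [hf7.arr _ rfl, hf6.arr _ rfl]
  · rw [hf7.arr _ rfl, had6 a ha b hb, rankAdj_iff hes hr.lt fun i hi => hr.surj hi]
    simp [ha, hb]

end Loop

/-! ### The whole algorithm -/

namespace Loop

/-- Counts by means of the tables. -/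
def count : Cmd := colour ;; markLocal ;; upPass ;; downPass

/-- Serves to absorb the cubic cost of local marking into `k * 2 ^ k`. -/
theorem succ_sq_le (k : ℕ) : (k + 1) ^ 2 ≤ 4 * 2 ^ k := by
  induction k with
  | zero => norm_num
  | succ k ih =>
    rcases Nat.lt_or_ge k 2 with h | h
    · interval_cases k <;> norm_num
    · rw [pow_succ 2 k]
      nlinarith

theorem wp_count {B n k : ℕ} {A : ℕ → ℕ → Prop} {S : ℕ → Finset ℕ} {σ : Env}
    (hB : 16 * (n + k + 1) ≤ B) (hvB : σ.var v_B = B) (hn : σ.var v_n = n) (hvk : σ.var v_k = k)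
    (hvP : σ.var v_P = 2 ^ k) (hpow : ∀ c < k, σ.arr a_pow 0 c = 2 ^ c) (hk : 2 ^ k ≤ 2 * n)
    (hE : Elim.IsElimination n A S) (hrow : ∀ i < n, Row (S i) i σ)
    (hcard : ∀ i < n, (S i).card < k) (hadj : ∀ a < n, ∀ b < n, σ.arr a_adj a b ≠ 0 ↔ A a b)
    (hused : ∀ a b, σ.arr a_used a b = 0) (hM : Marked n (fun _ _ => False) σ)
    (hW : ∀ a b, σ.arr a_W a b = 0) (hY : ∀ a b, σ.arr a_Y a b = 0) :
    wp B count (fun t τ => t ≤ 6000 * (n * (k * 2 ^ k) + 1) ∧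
      ∀ u < n, open Classical in τ.arr a_ans 0 u =
        ((Finset.range n).filter fun v => Elim.Near A u v).card) σ := by
  simp only [count, wp_seq]
  refine (wp_colour hvB hn hvk hB hrow hE.lt hcard hused).mono ?_
  rintro t1 τ1 ⟨ht1, hc1⟩ hf1
  have hrow1 : ∀ i < n, Row (S i) i τ1 := fun i hi => (hrow i hi).congr (by rw [hf1.arr _ rfl])
    (by rw [hf1.arr _ rfl]) (by rw [hf1.arr _ rfl]) (by rw [hf1.arr _ rfl])
  have hadj1 : ∀ a < n, ∀ b < n, τ1.arr a_adj a b ≠ 0 ↔ A a b := by rwa [hf1.arr _ rfl]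
  obtain ⟨col, hcol⟩ : ∃ col, col = τ1.arr a_col 0 := ⟨_, rfl⟩
  rw [← hcol] at hc1
  have hproper : Elim.Proper n S col := Elim.proper_of_ne hE fun i hi => (hc1 i hi).2
  have hlt : ∀ i < n, col i < k := fun i hi => (hc1 i hi).1
  refine (wp_markLocal (k := k) ((hf1.var v_B rfl).trans hvB) ((hf1.var v_n rfl).trans hn) hB
    hrow1 hE.lt hcard hadj1
    (hM.congr (fun _ _ => Iff.rfl) (hf1.arr _ rfl) (hf1.arr _ rfl))).mono ?_
  rintro t2 τ2 ⟨ht2, hM2⟩ hf2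
  have h2 : Setup B n k A S col τ2 := by
    refine ⟨?_, ?_, ?_, ?_, ?_, fun i hi => (hrow1 i hi).congr ?_ ?_ ?_ ?_, ?_, ?_⟩
    · rw [hf2.var _ rfl, hf1.var _ rfl, hvB]
    · rw [hf2.var _ rfl, hf1.var _ rfl, hn]
    · rw [hf2.var _ rfl, hf1.var _ rfl, hvk]
    · rw [hf2.var _ rfl, hf1.var _ rfl, hvP]
    · rwa [hf2.arr _ rfl, hf1.arr _ rfl]
    · rw [hf2.arr _ rfl]
    · rw [hf2.arr _ rfl]
    · rw [hf2.arr _ rfl]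
    · rw [hf2.arr _ rfl]
    · rwa [hf2.arr _ rfl]
    · intro i _
      rw [hf2.arr _ rfl, hcol]
  refine (wp_upPass h2 hB hk hE hproper hlt hcard fun p M => ?_).mono ?_
  · rw [hf2.arr _ rfl, hf1.arr _ rfl, hW]
  rintro t3 τ3 ⟨ht3, hU3, hW3⟩ hf3
  classical
  -- The masks of the neighbours of `v` in `S i`; `proj` merely provides numbers with the prescribed
  -- bits.
  let m : ℕ → ℕ → ℕ := fun v i =>
    proj (fun c => if ∃ z ∈ S i, A v z ∧ col z = c then 1 else 0) k (2 ^ k - 1)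
  have hm : ∀ v < n, ∀ i < n, ∀ c, (m v i).testBit c = true ↔ ∃ z ∈ S i, A v z ∧ col z = c := by
    intro v hv i hi c
    rw [testBit_proj, Nat.testBit_two_pow_sub_one]
    simp only [ne_eq, ite_eq_right_iff, one_ne_zero, imp_false, not_not, decide_eq_true_eq]
    constructor
    · exact fun h => h.2.1
    · rintro ⟨z, hz, hA, rfl⟩
      have := hlt z ((hE.lt i hi z hz).trans hi)
      exact ⟨this, ⟨z, hz, hA, rfl⟩, this⟩
  refine (wp_downPass (m := m) (h2.frame hf3 rfl) hB hk hE hproper hlt hcard hm hU3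
    (fun p hp M hM => by rw [hW3 p hp M hM]) (fun r M => ?_)
    (hM2.congr (fun _ _ => Iff.rfl) (hf3.arr _ rfl) (hf3.arr _ rfl))).mono ?_
  · rw [hf3.arr _ rfl, hf2.arr _ rfl, hf1.arr _ rfl, hY]
  rintro t4 τ4 ⟨ht4, ha⟩ -
  refine ⟨?_, fun u hu => by rw [ha u hu]⟩
  rcases Nat.eq_zero_or_pos n with rfl | hn0
  · simp at ht1 ht2 ht3 ht4
    omega
  have hk0 : 1 ≤ k := by
    have := hcard 0 hn0
    omega
  have hP : 1 ≤ 2 ^ k := Nat.one_le_two_pow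
  have hkk : k < 2 ^ k := Nat.lt_two_pow_self
  have h1 : (k + 1) ^ 3 ≤ 8 * (k * 2 ^ k) := by
    have := succ_sq_le k
    calc (k + 1) ^ 3 = (k + 1) ^ 2 * (k + 1) := by ring
      _ ≤ (4 * 2 ^ k) * (2 * k) := Nat.mul_le_mul this (by omega)
      _ = 8 * (k * 2 ^ k) := by ring
  have h2 : k + 1 ≤ 2 * (k * 2 ^ k) := by nlinarith
  have h3 : 2 ^ k ≤ k * 2 ^ k := by nlinarith
  have e1 : n * (k + 1) ≤ n * (2 * (k * 2 ^ k)) := Nat.mul_le_mul_left _ h2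
  have e2 : n * (k + 1) ^ 3 ≤ n * (8 * (k * 2 ^ k)) := Nat.mul_le_mul_left _ h1
  have e3 : n * 2 ^ k ≤ n * (k * 2 ^ k) := Nat.mul_le_mul_left _ h3
  have e4 : 0 < n * (k * 2 ^ k) := Nat.mul_pos hn0 (by omega)
  rw [mul_left_comm] at e1 e2
  rw [mul_assoc] at ht1 ht2 ht3
  rw [mul_assoc, mul_assoc] at ht4
  omega

/-- Writes the numbers of vertices to the output. -/
def output : Cmd := .forTo v_i v_iEnd †v_n (.out †v_i (.get a_ans 0 (.get a_rank 0 †v_i - 1)))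

theorem wp_output {B n : ℕ} {σ : Env} (hvB : σ.var v_B = B) (hn : σ.var v_n = n)
    (hB : 16 * (n + 1) ≤ B) (hr : ∀ v < n, σ.arr a_rank 0 v ≤ n) :
    wp B output (fun t τ => t ≤ 100 * (n + 1) ∧
      ∀ v < n, τ.cell v = σ.arr a_ans 0 (σ.arr a_rank 0 v - 1)) σ := by
  refine wp_for (fun i τ => ∀ v < i, τ.cell v = σ.arr a_ans 0 (σ.arr a_rank 0 v - 1)) n 50
    (by decide) (by decide) (by decide) (by omega) (by simp) (by simp [hn]) (by simp) ?_ ?_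
  · rintro i hi τ hvi - hf hI
    have hv0 := hf.var v_B rfl
    have h1 := hf.arr a_rank rfl
    have h2 := hf.arr a_ans rfl
    have h3 := hr i hi
    simp [hv0, hvB, hvi, h1, h2]
    and_intros
    all_goals first | omega | skip
    intro v hv
    split_ifs with h
    · rw [h]
    · exact hI v (by omega)
  · rintro t τ ht hI -
    simp at ht
    exact ⟨by omega, hI⟩

/-- Closed 2-Neighbourhood Sizes. -/
def solve : Cmd :=
  v_n ::= .raw 0 ;; .ite †v_n (prepare ;; .ite †v_big brute count ;; output) .skip

variable {n N : ℕ} {G : SimpleGraph (Fin n)} {T : SimpleGraph (Fin N)}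
  {β : Fin N → Finset (Fin n)} {es : List (Fin n × Fin n)} {ts : List (Fin N × Fin N)}
  {bs : Fin N → List (Fin n)}

/-- Since `k ≤ w + 1`, the tables cost `O(n k 2 ^ k)`, within the bound. The quadratic algorithm
runs only if `n < 2 ^ (k - 1) ≤ 2 ^ w`; with at most `n (k - 1)` edges, its cost `n (m + 1)` is at
most `n * n * k`, within the bound as well. -/
theorem wp_solve {B : ℕ} {σ : Env} (hD : IsTreeDecomposition G T β) (hes : ListsEdges G es)
    (hts : ListsEdges T ts) (hb : ListsBags β bs)
    (hcell : ∀ i, σ.cell i = (inputWords es ts bs).getD i 0)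
    (hB : B = 64 * (inputWords es ts bs).length) (harr : ∀ j a b, σ.arr j a b = 0) :
    wp B solve (fun t τ =>
      t ≤ 50000 * (2 ^ decompWidth β * (decompWidth β + 1) * n + decompSize β) ∧
      ∀ v : Fin n, τ.cell v = (closedNbhd G 2 v).ncard) σ := by
  classical
  have hL := length_inputWords es ts bs
  have hlow : 3 + 2 * es.length + decompSize β ≤ (inputWords es ts bs).length := by
    rw [hL, bagPos, sum_bagList hb]
    omega
  have hn0 : σ.cell 0 = n := by rw [hcell]; rfl
  have hx0 : 0 < N := by
    have := hD.isTree.connected.nonempty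
    exact (Classical.arbitrary (Fin N)).pos
  have hs0 : N ≤ decompSize β := by
    rw [← sum_bagList hb, Finset.sum_add_distrib]
    simp
  have hsn : n ≤ decompSize β := by
    have := le_sum_bagList hb hD.exists_mem_bag
    rw [← sum_bagList hb, Finset.sum_add_distrib]
    omega
  simp only [solve, wp_seq, wp_assign]
  refine ⟨by simp; omega, ?_⟩
  rw [wp_ite, wp_skip]
  simp only [eval_raw, eval_ofNat, eval_var, Env.set_var, hn0, if_true]
  refine ⟨by simp, fun hne => ?_, fun h0 => ?_⟩
  swap
  · refine ⟨by simp; omega, fun v => ?_⟩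
    have := v.pos
    omega
  have hnpos : 0 < n := Nat.pos_of_ne_zero hne
  obtain ⟨k, hk⟩ : ∃ k, k = (Finset.range N).sup fun x => (bagList bs x).length := ⟨_, rfl⟩
  rw [wp_seq]
  refine (wp_prepare (σ := σ.set v_n n) (k := k) hD hes hts hb (by simpa using hcell) hB hnpos
    (by simp) (by simpa using harr) hk).mono ?_
  rintro t1 τ1 ⟨ht1, rk, S, h1⟩ hf1
  have harr1 : ∀ j, prepare.modArr j = false → ∀ a b, τ1.arr j a b = 0 := by
    intro j hj a b
    rw [hf1.arr j hj, Env.set_arr, harr]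
  obtain ⟨pos, top, hr, hpinj, hpar⟩ := h1.ranking
  have hE := hr.isElimination hD hpinj hpar
  have hkw : k ≤ decompWidth β + 1 := hk ▸ sup_bagList_le hb
  have hk0 : 0 < k := by
    have := h1.card 0 hnpos
    omega
  have hm : es.length ≤ n * (k - 1) := by
    refine (hr.length_edges_le hE hes).trans ?_
    calc _ ≤ ∑ i ∈ Finset.range n, (k - 1) := Finset.sum_le_sum fun i hi => by
          have := h1.card i (Finset.mem_range.1 hi)
          omega
      _ = n * (k - 1) := by simp
  have hkL : k ≤ decompSize β := by
    rw [hk, ← sum_bagList hb]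
    refine Finset.sup_le fun x hx => ?_
    have := Finset.single_le_sum (f := fun x => (bagList bs x).length + 1)
      (fun _ _ => Nat.zero_le _) hx
    omega
  have hMk : Marked n (fun _ _ => False) τ1 :=
    ⟨fun a b => by simp [harr1 a_near rfl], fun a => by simp [harr1 a_ans rfl]⟩
  rw [wp_seq, wp_ite]
  -- What both algorithms have in common: the output undoes the renumbering, and the cost of the
  -- preparation is absorbed.
  have tail : ∀ t2 t3 τ3, t2 + t3 ≤ 20000 * (2 ^ decompWidth β * (decompWidth β + 1) * n) →
      τ3.var v_B = B → τ3.var v_n = n → τ3.arr a_rank = τ1.arr a_rank →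
      (∀ u < n, τ3.arr a_ans 0 u =
        ((Finset.range n).filter fun v => Elim.Near (Elim.rankAdj G rk) u v).card) →
      wp B output (fun t4 τ => (Expr.raw 0).cost + 2 + ((†v_n).cost + 2 + (t1 + (t2 + t3 + t4))) ≤
        50000 * (2 ^ decompWidth β * (decompWidth β + 1) * n + decompSize β) ∧
        ∀ v : Fin n, τ.cell v = (closedNbhd G 2 v).ncard) τ3 := by
    intro t2 t3 τ3 ht3 w1 w2 w3 w4
    refine (wp_output w1 w2 (by omega) fun v hv => ?_).mono ?_
    · have := h1.rank ⟨v, hv⟩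
      have := hr.lt ⟨v, hv⟩
      rw [w3]
      simp only at *
      omega
    · rintro t4 τ4 ⟨ht4, h4⟩ -
      refine ⟨?_, fun v => ?_⟩
      · have e1 : k * n ≤ (decompWidth β + 1) * n := Nat.mul_le_mul_right _ hkw
        have e2 : n * (k - 1) ≤ (decompWidth β + 1) * n := by
          rw [mul_comm]
          exact Nat.mul_le_mul_right _ (by omega)
        have e3 : 1 * ((decompWidth β + 1) * n) ≤ 2 ^ decompWidth β * ((decompWidth β + 1) * n) :=
          Nat.mul_le_mul_right _ Nat.one_le_two_pow
        rw [mul_assoc] at ht3 ⊢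
        simp
        omega
      · rw [h4 v v.2, w3, h1.rank v, Nat.add_sub_cancel, w4 _ (hr.lt v), hr.ncard_closedNbhd]
  have hX : 2 ^ k ≤ 2 * 2 ^ decompWidth β := by
    rw [mul_comm, ← pow_succ]
    exact Nat.pow_le_pow_right (by omega) hkw
  refine ⟨by simp, fun hbig => ?_, fun hbig => ?_⟩
  · rw [eval_var] at hbig
    have hlt : n < 2 ^ (k - 1) := h1.pow.elim (fun h => absurd h.1 hbig) fun h => h.2
    have hE1 := edgeList_of_cell (es := es) (ts := ts) (bs := bs) (σ := τ1) hr.lt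
      (fun i => by rw [hf1.cell rfl, Env.set_cell, hcell]) h1.rank
    refine (wp_brute h1.bound h1.size h1.edges (by omega) hE1
      (fun a b => rankAdj_iff hes hr.lt fun i hi => hr.surj hi) h1.adj hMk).mono ?_
    rintro t3 τ3 ⟨ht3, h3⟩ hf3
    refine tail _ _ τ3 ?_ ((hf3.var v_B rfl).trans h1.bound) ((hf3.var v_n rfl).trans h1.size)
      (hf3.arr _ rfl) fun u _ => by rw [h3.ans]
    have e0 : 2 ^ (k - 1) ≤ 2 ^ decompWidth β := Nat.pow_le_pow_right (by omega) (by omega)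
    have e1 : n * (es.length + 1) ≤ 2 ^ decompWidth β * (decompWidth β + 1) * n := by
      calc n * (es.length + 1) ≤ n * (2 ^ decompWidth β * (decompWidth β + 1)) := by
            refine Nat.mul_le_mul_left _ ?_
            calc es.length + 1 ≤ n * (k - 1) + n := by omega
              _ = n * k := by rw [← Nat.mul_succ]; congr 1; omega
              _ ≤ _ := Nat.mul_le_mul (by omega) hkw
        _ = _ := by ring
    have e2 : n * 1 ≤ n * (es.length + 1) := Nat.mul_le_mul_left _ (by omega)
    simp
    omega
  · rw [eval_var] at hbig
    obtain ⟨-, hP, hk2, hpow⟩ := h1.pow.elim id fun h => absurd hbig h.1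
    refine (wp_count (k := k) (by omega) h1.bound h1.size h1.width hP hpow hk2 hE h1.row h1.card
      h1.adj (harr1 _ rfl) hMk (harr1 _ rfl) (harr1 _ rfl)).mono ?_
    rintro t3 τ3 ⟨ht3, h3⟩ hf3
    refine tail _ _ τ3 ?_ ((hf3.var v_B rfl).trans h1.bound) ((hf3.var v_n rfl).trans h1.size)
      (hf3.arr _ rfl) h3
    have e1 : n * (k * 2 ^ k) ≤ 2 * (2 ^ decompWidth β * (decompWidth β + 1) * n) := by
      calc n * (k * 2 ^ k) ≤ n * ((decompWidth β + 1) * (2 * 2 ^ decompWidth β)) :=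
            Nat.mul_le_mul_left _ (Nat.mul_le_mul hkw hX)
        _ = _ := by ring
    have e2 : 1 ≤ n * (k * 2 ^ k) := Nat.mul_pos hnpos (Nat.mul_pos hk0 (by positivity))
    simp
    omega

open WordRAM in
theorem computesWithin_solve {n N : ℕ} {G : SimpleGraph (Fin n)} {T : SimpleGraph (Fin N)}
    {β : Fin N → Finset (Fin n)} (hD : IsTreeDecomposition G T β) {es : List (Fin n × Fin n)}
    {ts : List (Fin N × Fin N)} {bs : Fin N → List (Fin n)}
    (hes : ListsEdges G es) (hts : ListsEdges T ts) (hb : ListsBags β bs) {b : ℕ}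
    (hL : (inputWords es ts bs).length ^ 12 ≤ 2 ^ b) :
    ComputesWithin b (solve.code 0 ++ [.halt]) (inputWords es ts bs)
      (fun v => (closedNbhd G 2 v).ncard)
      (50000 * (2 ^ decompWidth β * (decompWidth β + 1) * n + decompSize β)) := by
  have hx0 : 0 < N := by
    have := hD.isTree.connected.nonempty
    exact (Classical.arbitrary (Fin N)).pos
  -- Three leading numbers and the size of at least one bag.
  have hlen : 4 ≤ (inputWords es ts bs).length := by
    rw [length_inputWords, bagPos, Finset.sum_add_distrib]
    simp
    omega
  have hlt := getD_inputWords_lt (es := es) (ts := ts) hb hD.exists_mem_bag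
  obtain ⟨t, τ, hex, ht, hout⟩ := wp_solve (σ := ⟨fun _ => 0, fun _ _ _ => 0, fun i =>
    (inputWords es ts bs).getD i 0⟩) hD hes hts hb (fun _ => rfl) rfl fun _ _ _ => rfl
  have hv : ∀ v : Fin n, (v : ℕ) < 64 * (inputWords es ts bs).length := by
    intro v
    have := hlt 0
    have h0 : (inputWords es ts bs).getD 0 0 = n := rfl
    have := v.2
    omega
  generalize inputWords es ts bs = w at *
  -- Addresses are quadratic in the length of the input. The constant `64 * 65 ^ 2 = 270400` is
  -- below `4 ^ 10`, hence below the tenth power of the length; this is the origin of the exponent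
  -- `12`.
  have hB : 64 * (64 * w.length + 1) ^ 2 ≤ 2 ^ b := by
    refine le_trans ?_ hL
    calc 64 * (64 * w.length + 1) ^ 2 ≤ 64 * (65 * w.length) ^ 2 := by gcongr; omega
      _ = 270400 * w.length ^ 2 := by ring
      _ ≤ 4 ^ 10 * w.length ^ 2 := by gcongr; norm_num
      _ ≤ w.length ^ 10 * w.length ^ 2 := by gcongr
      _ = w.length ^ 12 := by ring
  have hw : w.length ≤ 2 ^ b := by nlinarith
  have hR : Represents b (64 * w.length) ⟨fun _ => 0, fun _ _ _ => 0, fun i => w.getD i 0⟩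
      (init w) := by
    refine ⟨⟨?_, ?_⟩, ?_, ?_, ?_⟩
    · intro x
      exact Nat.two_pow_pos b
    · intro i
      exact (hlt i).trans_le hw
    · intro x
      rfl
    · intro i _
      rfl
    -- The arrays start at address `64 * w.length`, beyond the input, where memory is zero.
    · intro j _ x _ y _
      exact List.getD_eq_default _ _ (by omega)
  obtain ⟨s, hs, hpc, hRs⟩ := hex.run_code (P := solve.code 0 ++ [.halt]) hB hR
    (by
      intro i hi
      have hi' : i < (solve.code 0).length := hi
      change (solve.code 0 ++ [.halt])[0 + i]? = (solve.code 0)[i]?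
      rw [zero_add, List.getElem?_append_left hi'])
  refine ⟨t, ht, s, hs, ?_, fun v => ?_⟩
  · rw [hpc, show (init w).pc = 0 from rfl, zero_add, ← Cmd.length_code solve 0]
    simp
  · rw [hRs.cell v (hv v), hout v]

end Loop

theorem theorem4p3 :
    ∃ (P : WordRAM.Program) (c C : ℕ),
      ∀ (n N : ℕ) (G : SimpleGraph (Fin n)) (T : SimpleGraph (Fin N))
        (β : Fin N → Finset (Fin n)), IsTreeDecomposition G T β →
      ∀ (es : List (Fin n × Fin n)) (ts : List (Fin N × Fin N)) (bs : Fin N → List (Fin n)),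
        ListsEdges G es → ListsEdges T ts → ListsBags β bs →
      ∀ b : ℕ, (inputWords es ts bs).length ^ c ≤ 2 ^ b →
        WordRAM.ComputesWithin b P (inputWords es ts bs)
          (fun v => (closedNbhd G 2 v).ncard)
          (C * (2 ^ decompWidth β * (decompWidth β + 1) * n + decompSize β)) := by
  exact ⟨Loop.solve.code 0 ++ [.halt], 12, 50000,
    fun _ _ _ _ _ hD _ _ _ hes hts hb _ hL => Loop.computesWithin_solve hD hes hts hb hL⟩
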